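/- A Lie conformal algebra is a $\mathbb{C}[\partial]$-module with a $\mathbb{C}$-bilinear $\lambda$-bracket $[a_\lambda b]\in\mathcal{A}[\lambda]$ satisfying $[\partial a_\lambda b]=-\lambda[a_\lambda b]$, $[a_\lambda\partial b]=(\partial+\lambda)[a_\lambda b]$, $[a_\lambda b]=-[b_{-\lambda-\partial}a]$ and $[a_\lambda[b_\mu c]]=[[a_\lambda b]_{\lambda+\mu}c]+[b_\mu[a_\lambda c]]$. Consider the following Lie conformal algebras, with free $\mathbb{C}[\partial]$-bases $\{L_i\}$ and $b,s\in\mathbb{C}$: - $CL_1(s)=\bigoplus_{i\ge -1}\mathbb{C}[\partial]L_i$, $[{L_i}_\lambda L_j]=((i+1)\partial+(i+j+2)\lambda+s(j-i))L_{i+j}$; - $CL_2(b,s)=\bigoplus_{i\in\mathbb{Z}}\mathbb{C}[\partial]L_i$ with $b\neq 0$, $[{L_i}_\lambda L_j]=((i+b)\partial+(i+j+2b)\lambda+s(i-j))L_{i+j}$; - $SCL_2(b,s)$ with $0\ne 2b\in\mathbb{Z}$, the ideal $\bigoplus_{i\neq -2b}\mathbb{C}[\partial]L_i\oplus\mathbb{C}[\partial](\partial+2s)L_{-2b}$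 of $CL_2(b,s)$; - $\mathcal{V}(s)=\bigoplus_{i\in\mathbb{Z}}\mathbb{C}[\partial]L_i$, $[{L_i}_\lambda L_j]=(\partial+2\lambda+s(i-j))L_{i+j}$. Let $\mathcal{L}=\bigoplus_{i\in\mathbb{Z}}\mathcal{L}_i$ be a $\mathbb{Z}$-graded Lie conformal algebra (each $\mathcal{L}_i$ a $\mathbb{C}[\partial]$-submodule, $[{\mathcal{L}_i}_\lambda\mathcal{L}_j]\subseteq\mathcal{L}_{i+j}[\lambda]$) which is simple, i.e. its only graded ideals are $0$ and $\mathcal{L}$, such that every $\mathcal{L}_i$ has rank at most one over $\mathbb{C}[\partial]$ and $\mathcal{L}_0$ is the Virasoro Lie conformal algebra, i.e. $\mathcal{L}_0=\mathbb{C}[\partial]L$ is free of rank one with $[L_\lambda L]=(\partial+2\lambda)L$. Let $k>0$ be an integer such that $\mathcal{L}_k$, $\mathcal{L}_{-k}$ are free of rank one with bases $L_k$, $L_{-k}$, and such that, for a basis $L_0$ of $\mathcal{L}_0$, $[{L_k}_\lambda L_{-k}]=p_{k,-k}(\partial,\lambda)L_0$ where $p_{k,-k}$ has total degree $1$ or $2$.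 Then the subalgebra $\mathcal{L}[k]$ of $\mathcal{L}$ generated by $L_k$ and $L_{-k}$ is isomorphic, as a Lie conformal algebra, to $CL_1(s)$ for some $s\in\mathbb{C}$, or to $CL_2(b,s)$ for some $b,s\in\mathbb{C}$ with $b\ne0$, or to $SCL_2(b,s)$ for some $b,s\in\mathbb{C}$ with $0\neq 2b\in\mathbb{Z}$, or to $\mathcal{V}(s)$ for some $s\in\mathbb{C}$. -/

import Mathlib

open Polynomial

noncomputable section

/-! ### Lie conformal algebras

A `ℂ[∂]`-module is a module over `ℂ[X]`, the variable `X` being `∂`.  The space `A[λ]` of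
polynomials in `λ` with coefficients in `A` is `PolynomialModule ℂ[X] A`; it is a module over
`ℂ[∂][λ] = ℂ[X][X]`, in which `λ` is the outer variable `X` and `∂` is the constant `C X`. -/

/-- A Lie conformal algebra: a `ℂ[∂]`-module with a `ℂ`-bilinear `λ`-bracket with values in `A[λ]`
satisfying conformal sesquilinearity, skew-symmetry and the Jacobi identity.  The Jacobi identity
is an identity between polynomials in `λ, μ` with coefficients in the complex vector space `A`; it
is stated as the equality of their values at all complex numbers `z = λ`, `w = μ`. -/
class LieConformalAlgebra (A : Type*) [AddCommGroup A] [Module ℂ A] [Module ℂ[X] A]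
    [IsScalarTower ℂ ℂ[X] A] where
  /-- `bracket a b` is `[a_λ b]`. -/
  bracket : A →ₗ[ℂ] A →ₗ[ℂ] PolynomialModule ℂ[X] A
  /-- `[∂a_λ b] = -λ [a_λ b]` -/
  bracket_del_left : ∀ a b : A,
    bracket ((X : ℂ[X]) • a) b = (-X : ℂ[X][X]) • bracket a b
  /-- `[a_λ ∂b] = (∂ + λ) [a_λ b]` -/
  bracket_del_right : ∀ a b : A,
    bracket a ((X : ℂ[X]) • b) = (C X + X : ℂ[X][X]) • bracket a b
  /-- `[a_λ b] = -[b_{-λ-∂} a]` -/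
  skew : ∀ a b : A,
    bracket a b = -PolynomialModule.comp (-X - C X : ℂ[X][X]) (bracket b a)
  /-- `[a_λ [b_μ c]] = [[a_λ b]_{λ+μ} c] + [b_μ [a_λ c]]` -/
  jacobi : ∀ (a b c : A) (z w : ℂ),
    PolynomialModule.eval (C z : ℂ[X])
        (bracket a (PolynomialModule.eval (C w : ℂ[X]) (bracket b c))) =
      PolynomialModule.eval (C (z + w) : ℂ[X])
        (bracket (PolynomialModule.eval (C z : ℂ[X]) (bracket a b)) c) +
      PolynomialModule.eval (C w : ℂ[X])
        (bracket b (PolynomialModule.eval (C z : ℂ[X]) (bracket a c)))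

namespace LieConformalAlgebra

section Basic

variable {A : Type*} [AddCommGroup A] [Module ℂ A] [Module ℂ[X] A] [IsScalarTower ℂ ℂ[X] A]
  [LieConformalAlgebra A]

/-- The element `p(∂, λ) v` of `A[λ]`, for `p ∈ ℂ[∂][λ]` and `v ∈ A`. -/
def polySmul (p : ℂ[X][X]) (v : A) : PolynomialModule ℂ[X] A :=
  p • PolynomialModule.single ℂ[X] 0 v

end Basic

/-- A subalgebra: a `ℂ[∂]`-submodule `S` with `[S_λ S] ⊆ S[λ]`. -/
structure Subalgebra (A : Type*) [AddCommGroup A] [Module ℂ A] [Module ℂ[X] A]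
    [IsScalarTower ℂ ℂ[X] A] [LieConformalAlgebra A] where
  /-- The underlying `ℂ[∂]`-submodule. -/
  toSubmodule : Submodule ℂ[X] A
  bracket_mem : ∀ a ∈ toSubmodule, ∀ b ∈ toSubmodule, ∀ n : ℕ,
    (bracket a b).coeff n ∈ toSubmodule

section Sub

variable {A : Type*} [AddCommGroup A] [Module ℂ A] [Module ℂ[X] A] [IsScalarTower ℂ ℂ[X] A]
  [LieConformalAlgebra A]
variable {B : Type*} [AddCommGroup B] [Module ℂ B] [Module ℂ[X] B] [IsScalarTower ℂ ℂ[X] B]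
  [LieConformalAlgebra B]

/-- The whole algebra as a subalgebra. -/
def Subalgebra.whole (A : Type*) [AddCommGroup A] [Module ℂ A] [Module ℂ[X] A]
    [IsScalarTower ℂ ℂ[X] A] [LieConformalAlgebra A] : Subalgebra A where
  toSubmodule := ⊤
  bracket_mem _ _ _ _ _ := Submodule.mem_top

/-- The subalgebra generated by a set: the intersection of all subalgebras containing it. -/
def Subalgebra.generatedBy (s : Set A) : Subalgebra A where
  toSubmodule := sInf {N | ∃ S : Subalgebra A, S.toSubmodule = N ∧ s ⊆ (N : Set A)}
  bracket_mem a ha b hb n := by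
    rw [Submodule.mem_sInf] at *
    rintro N ⟨S, rfl, hs⟩
    exact S.bracket_mem a (ha _ ⟨S, rfl, hs⟩) b (hb _ ⟨S, rfl, hs⟩) n

/-- `S ≅ T` as Lie conformal algebras: there is an isomorphism `φ : S → T` of `ℂ[∂]`-modules with
`φ [a_λ b] = [φ(a)_λ φ(b)]`, where `φ` is applied to each coefficient of the polynomial. -/
def Subalgebra.Iso (S : Subalgebra A) (T : Subalgebra B) : Prop :=
  ∃ φ : S.toSubmodule ≃ₗ[ℂ[X]] T.toSubmodule, ∀ (a b : S.toSubmodule) (n : ℕ),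
    (φ ⟨(bracket (a : A) (b : A)).coeff n, S.bracket_mem a a.2 b b.2 n⟩ : B) =
      (bracket (φ a : B) (φ b : B)).coeff n

/-! ### Gradings -/

/-- A `ℤ`-graded Lie conformal algebra: `A = ⨁ 𝒢 i` as `ℂ[∂]`-module and
`[(𝒢 i)_λ (𝒢 j)] ⊆ 𝒢 (i + j)[λ]`. -/
structure IsGrading (𝒢 : ℤ → Submodule ℂ[X] A) : Prop where
  isInternal : DirectSum.IsInternal 𝒢
  bracket_mem : ∀ i j : ℤ, ∀ a ∈ 𝒢 i, ∀ b ∈ 𝒢 j, ∀ n : ℕ, (bracket a b).coeff n ∈ 𝒢 (i + j)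

/-- A graded ideal: a `ℂ[∂]`-submodule `I` with `[A_λ I] ⊆ I[λ]` which is the sum of its
homogeneous parts. -/
structure IsGradedIdeal (𝒢 : ℤ → Submodule ℂ[X] A) (I : Submodule ℂ[X] A) : Prop where
  bracket_mem : ∀ a : A, ∀ b ∈ I, ∀ n : ℕ, (bracket a b).coeff n ∈ I
  homogeneous : I = ⨆ i : ℤ, I ⊓ 𝒢 i

/-- Simplicity of a `ℤ`-graded Lie conformal algebra: no graded ideals except `0` and `A`. -/
def IsGradedSimple (𝒢 : ℤ → Submodule ℂ[X] A) : Prop :=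
  ∀ I : Submodule ℂ[X] A, IsGradedIdeal 𝒢 I → I = ⊥ ∨ I = ⊤

/-- `N` is a free `ℂ[∂]`-module of rank one with basis `{x}`. -/
def IsBasis (N : Submodule ℂ[X] A) (x : A) : Prop :=
  Submodule.span ℂ[X] {x} = N ∧ ∀ f : ℂ[X], f • x = 0 → f = 0

/-- `N` is the Virasoro Lie conformal algebra: `N = ℂ[∂]L` is free of rank one and
`[L_λ L] = (∂ + 2λ)L`. -/
def IsVirasoro (N : Submodule ℂ[X] A) : Prop :=
  ∃ L : A, IsBasis N L ∧ bracket L L = polySmul (C X + 2 * X) L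

/-- The total degree of `p(∂, λ) ∈ ℂ[∂][λ]`. -/
def totalDeg (p : ℂ[X][X]) : ℕ :=
  p.support.sup fun n => (p.coeff n).natDegree + n

/-- The set `I_d` of all `k > 0` such that `𝒢 k` and `𝒢 (-k)` have rank one and, for bases `x` of
`𝒢 k`, `y` of `𝒢 (-k)` and `L` of `𝒢 0`, one has `[x_λ y] = p(∂, λ)L` with `p = p_{k,-k}` nonzero
of total degree `d`.  Bases are unique up to nonzero complex factors, so `d` does not depend on
them. -/
def degSet (𝒢 : ℤ → Submodule ℂ[X] A) (d : ℕ) : Set ℤ :=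
  {k | 0 < k ∧ ∃ (x y L : A) (p : ℂ[X][X]), IsBasis (𝒢 k) x ∧ IsBasis (𝒢 (-k)) y ∧
    IsBasis (𝒢 0) L ∧ bracket x y = polySmul p L ∧ p ≠ 0 ∧ totalDeg p = d}

/-- The subalgebra generated by `𝒢 k` and `𝒢 (-k)`. -/
def subalgebraAt (𝒢 : ℤ → Submodule ℂ[X] A) (k : ℤ) : Subalgebra A :=
  Subalgebra.generatedBy ((𝒢 k : Set A) ∪ (𝒢 (-k) : Set A))

end Sub

/-! ### The algebras of the classification

The free `ℂ[∂]`-module with basis `L_i`, `i ∈ ℤ`, and the `λ`-bracket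
`[L_i_λ L_j] = ((m i + b)∂ + (m (i + j) + 2b)λ + s (i - j)) L_{i+j}`
contains all of them: `CL_2(b,s)` is the case `m = 1`, `𝒱(s)` is the case `m = 0`, `b = 1`. -/

/-- The `ℂ`-bilinear map on `⨁_{i ∈ ℤ} ℂ[∂] L_i` with prescribed values `T i j f g` on
`(f(∂)L_i, g(∂)L_j)`. -/
def bilinExt {N : Type*} [AddCommGroup N] [Module ℂ N] (T : ℤ → ℤ → ℂ[X] →ₗ[ℂ] ℂ[X] →ₗ[ℂ] N) :
    (ℤ →₀ ℂ[X]) →ₗ[ℂ] (ℤ →₀ ℂ[X]) →ₗ[ℂ] N :=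
  Finsupp.lsum ℂ fun i : ℤ => (Finsupp.lsum ℂ fun j : ℤ => (T i j).flip).flip

theorem bilinExt_single {N : Type*} [AddCommGroup N] [Module ℂ N]
    (T : ℤ → ℤ → ℂ[X] →ₗ[ℂ] ℂ[X] →ₗ[ℂ] N) (i j : ℤ) (f g : ℂ[X]) :
    bilinExt T (Finsupp.single i f) (Finsupp.single j g) = T i j f g := by
  simp [bilinExt]

/-- The underlying module `⨁_{i ∈ ℤ} ℂ[∂] L_i`. -/
def QuadModel (_m _b _s : ℂ) : Type := ℤ →₀ ℂ[X]

namespace QuadModel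

variable {m b s : ℂ}

instance : AddCommGroup (QuadModel m b s) := inferInstanceAs (AddCommGroup (ℤ →₀ ℂ[X]))
instance : Module ℂ (QuadModel m b s) := inferInstanceAs (Module ℂ (ℤ →₀ ℂ[X]))
instance : Module ℂ[X] (QuadModel m b s) := inferInstanceAs (Module ℂ[X] (ℤ →₀ ℂ[X]))
instance : IsScalarTower ℂ ℂ[X] (QuadModel m b s) :=
  inferInstanceAs (IsScalarTower ℂ ℂ[X] (ℤ →₀ ℂ[X]))

/-- The element `f(∂) L_i`. -/
def mono (i : ℤ) (f : ℂ[X]) : QuadModel m b s := Finsupp.single i f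

/-- The coefficient of `L_i`. -/
def coord (a : QuadModel m b s) (i : ℤ) : ℂ[X] := DFunLike.coe (F := ℤ →₀ ℂ[X]) a i

/-- The coefficient polynomial of `[L_i_λ L_j]`. -/
def P (m b s : ℂ) (i j : ℤ) : ℂ[X][X] :=
  C (C (m * i + b)) * C X + C (C (m * (i + j) + 2 * b)) * X + C (C (s * (i - j)))

/-- `(f, g) ↦ [f(∂)L_i _λ g(∂)L_j] = f(-λ) g(∂+λ) p_{i,j}(∂,λ) L_{i+j}`. -/
def brMono (m b s : ℂ) (i j : ℤ) :
    ℂ[X] →ₗ[ℂ] ℂ[X] →ₗ[ℂ] PolynomialModule ℂ[X] (QuadModel m b s) :=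
  LinearMap.mk₂ ℂ
    (fun f g => polySmul (aeval (-X : ℂ[X][X]) f * aeval (C X + X : ℂ[X][X]) g * P m b s i j)
      (mono (i + j) 1 : QuadModel m b s))
    (by intro f f' g; simp only [polySmul, map_add, add_mul, add_smul])
    (by intro c f g; simp only [polySmul, map_smul, smul_mul_assoc, smul_assoc])
    (by intro f g g'; simp only [polySmul, map_add, mul_add, add_mul, add_smul])
    (by intro c f g; simp only [polySmul, map_smul, mul_smul_comm, smul_mul_assoc, smul_assoc])

/-- The `ℂ`-bilinear extension of `brMono`. -/
def br (m b s : ℂ) :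
    QuadModel m b s →ₗ[ℂ] QuadModel m b s →ₗ[ℂ] PolynomialModule ℂ[X] (QuadModel m b s) :=
  bilinExt (brMono m b s)

theorem br_mono (i j : ℤ) (f g : ℂ[X]) :
    br m b s (mono i f) (mono j g) =
      polySmul (aeval (-X : ℂ[X][X]) f * aeval (C X + X : ℂ[X][X]) g * P m b s i j)
        (mono (i + j) 1) :=
  bilinExt_single (brMono m b s) i j f g

theorem induct {p : QuadModel m b s → Prop} (a : QuadModel m b s) (h0 : p 0)
    (hadd : ∀ x y, p x → p y → p (x + y)) (h1 : ∀ i f, p (mono i f)) : p a :=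
  Finsupp.induction_linear a h0 hadd h1

theorem smul_mono (f g : ℂ[X]) (i : ℤ) :
    f • (mono i g : QuadModel m b s) = mono i (f * g) :=
  Finsupp.smul_single f i g

theorem mono_add (f g : ℂ[X]) (i : ℤ) :
    (mono i (f + g) : QuadModel m b s) = mono i f + mono i g :=
  Finsupp.single_add i f g

theorem eval_br_mono (i j : ℤ) (f g : ℂ[X]) (z : ℂ) :
    PolynomialModule.eval (C z : ℂ[X]) (br m b s (mono i f) (mono j g)) =
      mono (i + j) (C (f.eval (-z)) * g.comp (X + C z) *
        (C (m * i + b) * X + C ((m * (i + j) + 2 * b) * z + s * (i - j)))) := by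
  rw [br_mono, polySmul, PolynomialModule.eval_smul, PolynomialModule.eval_single, pow_zero,
    one_smul, smul_mono, mul_one]
  congr 1
  have h1 : Polynomial.eval (C z) (aeval (-X : ℂ[X][X]) f) = C (f.eval (-z)) := by
    induction f using Polynomial.induction_on' with
    | add p q hp hq => simp [hp, hq]
    | monomial n c =>
      simp [aeval_monomial, Polynomial.algebraMap_apply]
  have h2 : Polynomial.eval (C z) (aeval (C X + X : ℂ[X][X]) g) = g.comp (X + C z) := by
    induction g using Polynomial.induction_on' with
    | add p q hp hq => simp [hp, hq]
    | monomial n c =>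
      simp [aeval_monomial, Polynomial.algebraMap_apply]
  rw [eval_mul, eval_mul, h1, h2]
  congr 1
  simp only [P, eval_add, eval_mul, eval_C, eval_X, C_add, C_mul]
  ring

theorem comp_polySmul (q p : ℂ[X][X]) (v : QuadModel m b s) :
    PolynomialModule.comp q (polySmul p v) = polySmul (p.comp q) v := by
  rw [polySmul, PolynomialModule.comp_smul, PolynomialModule.comp_single]
  simp [polySmul]

instance : LieConformalAlgebra (QuadModel m b s) where
  bracket := br m b s
  bracket_del_left a c := by
    induction a using induct with
    | h0 => simp
    | hadd x y hx hy => simp only [smul_add, map_add, LinearMap.add_apply, hx, hy]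
    | h1 i f =>
      induction c using induct with
      | h0 => simp
      | hadd x y hx hy => simp only [smul_add, map_add, hx, hy]
      | h1 j g =>
        rw [smul_mono, br_mono, br_mono, polySmul, polySmul, smul_smul]
        simp [mul_assoc]
  bracket_del_right a c := by
    induction a using induct with
    | h0 => simp
    | hadd x y hx hy => simp only [smul_add, map_add, LinearMap.add_apply, hx, hy]
    | h1 i f =>
      induction c using induct with
      | h0 => simp
      | hadd x y hx hy => simp only [smul_add, map_add, hx, hy]
      | h1 j g =>
        rw [smul_mono, br_mono, br_mono, polySmul, polySmul, smul_smul]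
        congr 1
        simp
        ring
  skew a c := by
    induction a using induct with
    | h0 => simp
    | hadd x y hx hy =>
      simp only [map_add, LinearMap.add_apply, hx, hy, neg_add]
    | h1 i f =>
      induction c using induct with
      | h0 => simp
      | hadd x y hx hy => simp only [map_add, LinearMap.add_apply, hx, hy, neg_add]
      | h1 j g =>
        rw [br_mono, br_mono, comp_polySmul, polySmul, polySmul, ← neg_smul, add_comm j i]
        congr 1
        have h (u : ℂ[X]) (v : ℂ[X][X]) (q : ℂ[X][X]) :
            (aeval v u).comp q = aeval (v.comp q) u := by
          induction u using Polynomial.induction_on' with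
          | add p q hp hq => simp [hp, hq]
          | monomial n c => simp [aeval_monomial, Polynomial.algebraMap_apply]
        have h2 : (C (C 2) : ℂ[X][X]) = 2 := rfl
        simp only [mul_comp, h]
        simp [P, h2]
        ring
  jacobi a c d z w := by
    induction a using induct with
    | h0 => simp
    | hadd x y hx hy =>
      simp only [map_add, LinearMap.add_apply, hx, hy]
      abel
    | h1 i f =>
      induction c using induct with
      | h0 => simp
      | hadd x y hx hy =>
        simp only [map_add, LinearMap.add_apply, hx, hy]
        abel
      | h1 j g =>
        induction d using induct with
        | h0 => simp
        | hadd x y hx hy =>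
          simp only [map_add, hx, hy]
          abel
        | h1 l h =>
          simp only [eval_br_mono]
          rw [← add_assoc i j l, ← add_assoc j i l, add_comm j i, ← mono_add]
          congr 1
          have h2 : (C 2 : ℂ[X]) = 2 := rfl
          have e2 : (-(z + w) + z : ℂ) = -w := by ring
          have e3 : (X + C z + C w : ℂ[X]) = X + C (z + w) := by rw [C_add]; ring
          have e4 : (X + C w + C z : ℂ[X]) = X + C (z + w) := by rw [C_add]; ring
          simp only [mul_comp, add_comp, comp_assoc, C_comp, X_comp, eval_mul, eval_comp,
            eval_add, eval_C, eval_X, e2, e3, e4]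
          generalize h.comp (X + C (z + w)) = h'
          simp only [C_mul, C_add, C_sub, C_neg, Int.cast_add, h2]
          ring

theorem bracket_def (a c : QuadModel m b s) : bracket a c = br m b s a c := rfl

/-- The `λ`-brackets of the basis elements `L_i`. -/
theorem bracket_basis (i j : ℤ) :
    bracket (mono i 1 : QuadModel m b s) (mono j 1) =
      polySmul (C (C (m * i + b)) * C X + C (C (m * (i + j) + 2 * b)) * X + C (C (s * (i - j))))
        (mono (i + j) 1) := by
  rw [bracket_def, br_mono]
  simp [P]

theorem coord_add (a c : QuadModel m b s) (i : ℤ) : (a + c).coord i = a.coord i + c.coord i := rfl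

theorem coord_smul (f : ℂ[X]) (a : QuadModel m b s) (i : ℤ) :
    (f • a).coord i = f * a.coord i := rfl

theorem coord_zero (i : ℤ) : (0 : QuadModel m b s).coord i = 0 := rfl

theorem coord_mono (i j : ℤ) (f : ℂ[X]) :
    (mono i f : QuadModel m b s).coord j = if i = j then f else 0 := by
  classical
  exact Finsupp.single_apply

/-- The coefficients of `[f(∂)L_i _λ g(∂)L_j]`. -/
theorem coeff_br_mono (i j : ℤ) (f g : ℂ[X]) (n : ℕ) :
    (br m b s (mono i f) (mono j g)).coeff n =
      mono (i + j)
        ((aeval (-X : ℂ[X][X]) f * aeval (C X + X : ℂ[X][X]) g * P m b s i j).coeff n) := by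
  rw [br_mono, polySmul, PolynomialModule.smul_single_apply]
  simp [smul_mono]

end QuadModel

/-- `CL_2(b,s) = ⨁_{i ∈ ℤ} ℂ[∂]L_i` with
`[L_i_λ L_j] = ((i + b)∂ + (i + j + 2b)λ + s(i - j))L_{i+j}`. -/
abbrev CL2 (b s : ℂ) : Type := QuadModel 1 b s

/-- `𝒱(s) = ⨁_{i ∈ ℤ} ℂ[∂]L_i` with `[L_i_λ L_j] = (∂ + 2λ + s(i - j))L_{i+j}`. -/
abbrev LoopVir (s : ℂ) : Type := QuadModel 0 1 s

theorem CL2.dvd_coeff (b s : ℂ) (a c : CL2 b s) (n : ℕ) (i : ℤ) (hi : (i : ℂ) = -2 * b) :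
    (X + C (2 * s)) ∣ QuadModel.coord ((bracket a c).coeff n) i := by
  induction a using QuadModel.induct with
  | h0 => simp [QuadModel.coord_zero]
  | hadd x y hx hy =>
    simp only [map_add, LinearMap.add_apply, PolynomialModule.coeff_add, Finsupp.add_apply,
      QuadModel.coord_add]
    exact dvd_add hx hy
  | h1 j f =>
    induction c using QuadModel.induct with
    | h0 => simp [QuadModel.coord_zero]
    | hadd x y hx hy =>
      simp only [map_add, PolynomialModule.coeff_add, Finsupp.add_apply, QuadModel.coord_add]
      exact dvd_add hx hy
    | h1 l g =>
      rw [QuadModel.bracket_def, QuadModel.coeff_br_mono, QuadModel.coord_mono]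
      split_ifs with h
      · have hl : (l : ℂ) = -2 * b - j := by
          rw [← hi, ← h]
          push_cast
          ring
        have hP : QuadModel.P 1 b s j l = C (X + C (2 * s)) * C (C (j + b)) := by
          have e1 : (1 * ((j : ℂ) + l) + 2 * b) = 0 := by rw [hl]; ring
          have e2 : s * ((j : ℂ) - l) = (2 * s) * (j + b) := by rw [hl]; ring
          rw [QuadModel.P, e1, e2]
          simp only [C_mul, C_add, one_mul, C_0]
          ring
        rw [hP, mul_left_comm, coeff_C_mul]
        exact dvd_mul_right _ _
      · exact dvd_zero _

/-- `SCL_2(b,s)`, for `2b ∈ ℤ`: the subalgebra (in fact an ideal)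
`⨁_{i ≠ -2b} ℂ[∂]L_i ⊕ ℂ[∂](∂ + 2s)L_{-2b}` of `CL_2(b,s)`. -/
def SCL2 (b s : ℂ) : Subalgebra (CL2 b s) where
  toSubmodule :=
    { carrier := {a | ∀ i : ℤ, (i : ℂ) = -2 * b → (X + C (2 * s)) ∣ a.coord i}
      add_mem' := fun ha hc i hi => dvd_add (ha i hi) (hc i hi)
      zero_mem' := fun _ _ => dvd_zero _
      smul_mem' := fun f _ ha i hi => Dvd.dvd.mul_left (ha i hi) f }
  bracket_mem a _ c _ n i hi := CL2.dvd_coeff b s a c n i hi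

/-- The projection to the span of the `L_i` with `i ≥ -1`. -/
def QuadModel.trunc {m b s : ℂ} (a : QuadModel m b s) : QuadModel m b s :=
  Finsupp.filter (M := ℂ[X]) (fun i : ℤ => -1 ≤ i) a

theorem QuadModel.trunc_eq {m b s : ℂ} (a : QuadModel m b s)
    (h : ∀ i : ℤ, i < -1 → a.coord i = 0) : a.trunc = a :=
  Finsupp.filter_eq_self_iff _ _ |>.2 fun i hi => by
    by_contra hlt
    exact hi (h i (not_le.1 hlt))

theorem QuadModel.trunc_add {m b s : ℂ} (a c : QuadModel m b s) :
    (a + c).trunc = a.trunc + c.trunc := Finsupp.filter_add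

theorem QuadModel.trunc_zero {m b s : ℂ} : (0 : QuadModel m b s).trunc = 0 :=
  Finsupp.filter_zero _

theorem QuadModel.trunc_mono {m b s : ℂ} (i : ℤ) (f : ℂ[X]) :
    (mono i f : QuadModel m b s).trunc = if -1 ≤ i then mono i f else 0 := by
  split_ifs with h
  · exact Finsupp.filter_single_of_pos _ h
  · exact Finsupp.filter_single_of_neg _ h

theorem CL2.coeff_trunc (s : ℂ) (a c : CL2 1 (-s)) (n : ℕ) (i : ℤ) (hi : i < -1) :
    QuadModel.coord ((bracket a.trunc c.trunc).coeff n) i = 0 := by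
  induction a using QuadModel.induct with
  | h0 => simp [QuadModel.coord_zero, QuadModel.trunc_zero]
  | hadd x y hx hy =>
    simp only [map_add, LinearMap.add_apply, PolynomialModule.coeff_add, Finsupp.add_apply,
      QuadModel.coord_add, QuadModel.trunc_add, hx, hy, add_zero]
  | h1 j f =>
    induction c using QuadModel.induct with
    | h0 => simp [QuadModel.coord_zero, QuadModel.trunc_zero]
    | hadd x y hx hy =>
      simp only [map_add, PolynomialModule.coeff_add, Finsupp.add_apply, QuadModel.coord_add,
        QuadModel.trunc_add, hx, hy, add_zero]
    | h1 l g =>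
      rw [QuadModel.trunc_mono, QuadModel.trunc_mono]
      split_ifs with h1 h2
      · rw [QuadModel.bracket_def, QuadModel.coeff_br_mono, QuadModel.coord_mono]
        split_ifs with h
        · obtain rfl : j = -1 := by omega
          obtain rfl : l = -1 := by omega
          have hP : QuadModel.P 1 1 (-s) (-1) (-1) = 0 := by
            simp only [QuadModel.P]
            norm_num
          rw [hP, mul_zero, coeff_zero]
        · rfl
      all_goals simp [QuadModel.coord_zero]

/-- `CL_1(s) = ⨁_{i ≥ -1} ℂ[∂]L_i` with
`[L_i_λ L_j] = ((i + 1)∂ + (i + j + 2)λ + s(j - i))L_{i+j}`.  This is the span of the `L_i`,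
`i ≥ -1`, in `CL_2(1,-s)`; it is closed because the formula gives `[L_{-1}_λ L_{-1}] = 0`. -/
def CL1 (s : ℂ) : Subalgebra (CL2 1 (-s)) where
  toSubmodule :=
    { carrier := {a | ∀ i : ℤ, i < -1 → a.coord i = 0}
      add_mem' := by
        intro a c ha hc i hi
        rw [QuadModel.coord_add, ha i hi, hc i hi, add_zero]
      zero_mem' := fun i _ => QuadModel.coord_zero i
      smul_mem' := by
        intro f a ha i hi
        rw [QuadModel.coord_smul, ha i hi, mul_zero] }
  bracket_mem a ha c hc n i hi := by
    rw [← QuadModel.trunc_eq a ha, ← QuadModel.trunc_eq c hc]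
    exact CL2.coeff_trunc s a c n i hi

end LieConformalAlgebra
end

open LieConformalAlgebra

noncomputable section

namespace LieConformalAlgebra

/-! ### Polynomials with coefficients in a complex vector space -/

section Values

variable {A : Type*} [AddCommGroup A] [Module ℂ A] [Module ℂ[X] A] [IsScalarTower ℂ ℂ[X] A]

/-! A polynomial in `λ` is determined by its values, so every bracket is replaced by its values
`brAt z` at complex numbers, and sesquilinearity and Jacobi become ordinary identities.

Simplicity kills every stable graded family that vanishes in degree 0 (`eq_bot_of_stable`). Hence
there is no torsion, and the Virasoro element `L` annihilates no nonzero homogeneous element. A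
nonzero component is then free, with a generator satisfying `[L_λ n] = (∂ + α + δλ)n`
(`exists_primary`). Structure polynomials between such generators are homogeneous about a shifted
origin, of degree read off from the weights (`Equivariant.homogeneous`). In total degree one,
`p_{k,-k}` is fixed up to a scalar by the weight of degree `k`, and the opposite weights sum to 4;
in total degree two the weights are 1 and 4. So `L`, `L_k`, `L_{-k}` satisfy the relations of three
elements of degrees `0, 1, -1` in a model: `𝒱(s)` for weight 2, `CL_2(b,s)` with `b = 1/(δ-2)` for
other linear brackets, and `CL_2(1/2,s)` with `(∂+2s)L_{-1}` for quadratic ones.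

Local relations are globalized through the subalgebra of the product `A × B` generated by the three
pairs. It is the graph of an isomorphism once it contains no nonzero `(0,v)` and no nonzero `(a,0)`
(`Subalgebra.Iso.of_graph`). The first holds because lowering operators of the model are injective
outside the local part. The second follows from rank one wherever the model side of the degree is
nonzero.

The exception is `b = 1` (weights 3 and 1): the model side vanishes in degrees below `-1`, so `y =
L_{-k}` must be shown to commute with itself (`Frame.brAt_self_eq_zero`). Otherwise `[y_λ y]` gives
a nonzero generator `v` in degree `-2k` killed by degrees `k` and `2k`. Below it the weights are
negative integers, while degree `nk` has weight `2+n` for `n ≥ 1`. By simplicity some product of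
generators carries `v` to degree 0; in a shortest product the factors commute, and some factor has
degree `d ≠ k` on the same side as `k`. Commutation forces the bracket between degrees `d` and `-d`
to be constant or linear, and produces another pair of weights 3 and 1 in degrees `±d`. Comparing
weights at common multiples of `d` and `k` is contradictory. -/

theorem C_smul_eq (c : ℂ) (a : A) : (C c : ℂ[X]) • a = c • a := by
  rw [← algebraMap_smul ℂ[X] c a]; rfl

theorem eval_C_eq_sum (P : PolynomialModule ℂ[X] A) (z : ℂ) :
    PolynomialModule.eval (C z : ℂ[X]) P = P.coeff.sum fun i m => z ^ i • m := by
  rw [PolynomialModule.eval_apply]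
  simp only [← C_pow, C_smul_eq]

theorem eval_mem_of_coeff_mem {P : PolynomialModule ℂ[X] A} {N : Submodule ℂ A}
    (h : ∀ n, P.coeff n ∈ N) (z : ℂ) : PolynomialModule.eval (C z : ℂ[X]) P ∈ N := by
  rw [eval_C_eq_sum]
  exact N.sum_mem fun i _ => N.smul_mem _ (h i)

/-- A functional that kills `N` but not the coefficient would turn `P` into a nonzero scalar
polynomial with infinitely many roots. Allowing any infinite `S` lets exceptional values of `λ` be
discarded. -/
theorem coeff_mem_of_eval_mem {P : PolynomialModule ℂ[X] A} {N : Submodule ℂ A} {S : Set ℂ}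
    (hS : S.Infinite) (h : ∀ z ∈ S, PolynomialModule.eval (C z : ℂ[X]) P ∈ N) (n : ℕ) :
    P.coeff n ∈ N := by
  by_contra hn
  obtain ⟨φ, hφ, hN⟩ := Submodule.exists_le_ker_of_notMem hn
  let q : ℂ[X] := P.coeff.sum fun i m => monomial i (φ m)
  have hq : q = 0 := by
    refine Polynomial.eq_zero_of_infinite_isRoot _ (hS.mono fun z hz => ?_)
    have h0 : φ (PolynomialModule.eval (C z : ℂ[X]) P) = 0 := hN (h z hz)
    rw [eval_C_eq_sum, Finsupp.sum, map_sum] at h0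
    simp only [Set.mem_ofPred_eq, IsRoot, q, Finsupp.sum, eval_finsetSum, eval_monomial]
    rw [← h0]
    exact Finset.sum_congr rfl fun i _ => by rw [map_smul, smul_eq_mul, mul_comm]
  have h1 : q.coeff n = φ (P.coeff n) := by
    simp only [q, Finsupp.sum, finsetSum_coeff, coeff_monomial, Finset.sum_ite_eq']
    split_ifs with h2
    · rfl
    · rw [Finsupp.notMem_support_iff.1 h2, map_zero]
  exact hφ (by rw [← h1, hq, coeff_zero])

theorem eq_zero_of_eval_eq_zero {P : PolynomialModule ℂ[X] A} {S : Set ℂ}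
    (hS : S.Infinite) (h : ∀ z ∈ S, PolynomialModule.eval (C z : ℂ[X]) P = 0) : P = 0 := by
  ext n
  have := coeff_mem_of_eval_mem (P := P) (N := (⊥ : Submodule ℂ A)) hS
    (fun z hz => by simp [h z hz]) n
  simpa using this

theorem ext_eval {P Q : PolynomialModule ℂ[X] A}
    (h : ∀ z, PolynomialModule.eval (C z : ℂ[X]) P = PolynomialModule.eval (C z : ℂ[X]) Q) :
    P = Q := by
  rw [← sub_eq_zero]
  refine eq_zero_of_eval_eq_zero Set.infinite_univ fun z _ => ?_
  rw [map_sub, h, sub_self]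

/-- The value `p(∂, z)` of `p ∈ ℂ[∂][λ]` at `λ = z`. -/
abbrev valAt (p : ℂ[X][X]) (z : ℂ) : ℂ[X] := p.eval (C z)

theorem exists_polynomial_of_mem_span {P : PolynomialModule ℂ[X] A} {v : A}
    (h : ∀ z, PolynomialModule.eval (C z : ℂ[X]) P ∈ Submodule.span ℂ[X] {v}) :
    ∃ p : ℂ[X][X], P = polySmul p v := by
  have h1 : ∀ n, ∃ c : ℂ[X], c • v = P.coeff n := fun n =>
    Submodule.mem_span_singleton.1 (coeff_mem_of_eval_mem
      (N := (Submodule.span ℂ[X] {v}).restrictScalars ℂ) Set.infinite_univ (fun z _ => h z) n)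
  choose c hc using h1
  refine ⟨∑ n ∈ P.coeff.support, monomial n (c n), ?_⟩
  ext n
  rw [polySmul, PolynomialModule.smul_single_apply]
  simp only [zero_le, if_true, Nat.sub_zero, finsetSum_coeff, coeff_monomial, Finset.sum_ite_eq']
  split_ifs with h2
  · exact (hc n).symm
  · rw [zero_smul, Finsupp.notMem_support_iff.1 h2]

theorem eval_of_smul (z : ℂ) (c : ℂ) (P : PolynomialModule ℂ[X] A) :
    PolynomialModule.eval (C z : ℂ[X]) (c • P) = c • PolynomialModule.eval (C z : ℂ[X]) P := by
  rw [← algebraMap_smul ℂ[X] c P, map_smul, algebraMap_smul]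

end Values

/-! ### The bracket at a complex number -/

section BrAt

variable {A : Type*} [AddCommGroup A] [Module ℂ A] [Module ℂ[X] A] [IsScalarTower ℂ ℂ[X] A]
  [LieConformalAlgebra A]

/-- The value of `[a_λ b]` at `λ = z`. -/
def brAt (z : ℂ) (a b : A) : A := PolynomialModule.eval (C z : ℂ[X]) (bracket a b)

theorem brAt_add_left (z : ℂ) (a a' b : A) : brAt z (a + a') b = brAt z a b + brAt z a' b := by
  simp [brAt]

theorem brAt_add_right (z : ℂ) (a b b' : A) : brAt z a (b + b') = brAt z a b + brAt z a b' := by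
  simp [brAt]

@[simp] theorem brAt_zero_left (z : ℂ) (b : A) : brAt z 0 b = 0 := by simp [brAt]

@[simp] theorem brAt_zero_right (z : ℂ) (a : A) : brAt z a 0 = 0 := by simp [brAt]

theorem brAt_csmul_left (z c : ℂ) (a b : A) : brAt z (c • a) b = c • brAt z a b := by
  rw [brAt, map_smul, LinearMap.smul_apply, eval_of_smul, brAt]

theorem brAt_csmul_right (z c : ℂ) (a b : A) : brAt z a (c • b) = c • brAt z a b := by
  rw [brAt, map_smul, eval_of_smul, brAt]

theorem brAt_X_left (z : ℂ) (a b : A) : brAt z ((X : ℂ[X]) • a) b = (-z) • brAt z a b := by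
  rw [brAt, bracket_del_left, PolynomialModule.eval_smul, ← C_smul_eq]
  simp [brAt]

theorem brAt_X_right (z : ℂ) (a b : A) :
    brAt z a ((X : ℂ[X]) • b) = (X + C z : ℂ[X]) • brAt z a b := by
  rw [brAt, bracket_del_right, PolynomialModule.eval_smul]
  simp [brAt]

theorem brAt_smul_left (z : ℂ) (f : ℂ[X]) (a b : A) :
    brAt z (f • a) b = (C (f.eval (-z)) : ℂ[X]) • brAt z a b := by
  induction f using Polynomial.induction_on with
  | C c => rw [C_smul_eq, brAt_csmul_left, eval_C, C_smul_eq]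
  | add p q hp hq => rw [add_smul, brAt_add_left, hp, hq, eval_add, C_add, add_smul]
  | monomial n c ih =>
    have h1 : (C c * X ^ (n + 1) : ℂ[X]) = X * (C c * X ^ n) := by ring
    rw [h1, mul_smul, brAt_X_left, ih, ← C_smul_eq, smul_smul, ← C_mul, eval_mul (p := X), eval_X]

theorem brAt_smul_right (z : ℂ) (f : ℂ[X]) (a b : A) :
    brAt z a (f • b) = f.comp (X + C z) • brAt z a b := by
  induction f using Polynomial.induction_on with
  | C c => rw [C_smul_eq, brAt_csmul_right, C_comp, C_smul_eq]
  | add p q hp hq => rw [add_smul, brAt_add_right, hp, hq, add_comp, add_smul]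
  | monomial n c ih =>
    have h1 : (C c * X ^ (n + 1) : ℂ[X]) = X * (C c * X ^ n) := by ring
    rw [h1, mul_smul, brAt_X_right, ih, smul_smul, mul_comp X, X_comp]

theorem brAt_jacobi (z w : ℂ) (a b c : A) :
    brAt z a (brAt w b c) = brAt (z + w) (brAt z a b) c + brAt w b (brAt z a c) :=
  jacobi a b c z w

theorem brAt_brAt_left (z w : ℂ) (a b c : A) :
    brAt w (brAt z a b) c = brAt z a (brAt (w - z) b c) - brAt (w - z) b (brAt z a c) := by
  rw [brAt_jacobi]
  simp

theorem bracket_eq_of_brAt {p : ℂ[X][X]} {v a b : A} (h : ∀ z, brAt z a b = valAt p z • v) :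
    bracket a b = polySmul p v := by
  refine ext_eval fun z => ?_
  rw [polySmul, PolynomialModule.eval_smul, PolynomialModule.eval_single, pow_zero, one_smul]
  exact h z

theorem brAt_of_bracket_eq {p : ℂ[X][X]} {v a b : A} (h : bracket a b = polySmul p v) (z : ℂ) :
    brAt z a b = valAt p z • v := by
  rw [brAt, h, polySmul, PolynomialModule.eval_smul, PolynomialModule.eval_single, pow_zero,
    one_smul]

/-- `p(∂, -λ-∂)`. -/
def flipPoly (p : ℂ[X][X]) : ℂ[X][X] := p.comp (-X - C X)

theorem eval_eval_eq (p : ℂ[X][X]) (q : ℂ[X]) (t : ℂ) :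
    eval t (eval q p) = p.evalEval t (q.eval t) := by
  induction p using Polynomial.induction_on' with
  | add p q hp hq => simp [hp, hq]
  | monomial n c => simp [evalEval]

theorem evalEval_flipPoly (p : ℂ[X][X]) (t z : ℂ) :
    (flipPoly p).evalEval t z = p.evalEval t (-z - t) := by
  rw [flipPoly, evalEval, eval_comp, eval_eval_eq]
  simp

theorem brAt_skew {p : ℂ[X][X]} {v a b : A} (h : ∀ z, brAt z b a = valAt p z • v) (z : ℂ) :
    brAt z a b = -(valAt (flipPoly p) z • v) := by
  rw [brAt, skew, bracket_eq_of_brAt h, polySmul, PolynomialModule.comp_smul,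
    PolynomialModule.comp_single, map_neg]
  simp [flipPoly]

theorem brAt_eq_zero_comm {a b : A} (h : ∀ z, brAt z b a = 0) (z : ℂ) : brAt z a b = 0 := by
  have := brAt_skew (p := 0) (v := (0 : A)) (a := a) (b := b) (by simpa using h) z
  simpa using this

theorem brAt_eq_zero_of_infinite {a b : A} {S : Set ℂ} (hS : S.Infinite)
    (h : ∀ z ∈ S, brAt z a b = 0) (z : ℂ) : brAt z a b = 0 := by
  rw [brAt, eq_zero_of_eval_eq_zero hS h, map_zero]

theorem exists_brAt_eq {a b v : A} (h : ∀ z, brAt z a b ∈ Submodule.span ℂ[X] {v}) :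
    ∃ p : ℂ[X][X], ∀ z, brAt z a b = valAt p z • v := by
  obtain ⟨p, hp⟩ := exists_polynomial_of_mem_span h
  exact ⟨p, brAt_of_bracket_eq hp⟩

theorem infinite_eval_neg_ne_zero {f : ℂ[X]} (hf : f ≠ 0) :
    {z : ℂ | f.eval (-z) ≠ 0}.Infinite := by
  have h1 : f.comp (-X) ≠ 0 := by
    intro h
    have : (f.comp (-X)).comp (-X) = 0 := by rw [h, zero_comp]
    rw [comp_assoc] at this
    simp at this
    exact hf this
  have h2 : {z : ℂ | f.eval (-z) ≠ 0} = {z | (f.comp (-X)).IsRoot z}ᶜ := by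
    ext z
    simp [IsRoot, eval_comp]
  rw [h2]
  exact (Polynomial.finite_setOfPred_isRoot h1).infinite_compl

/-- A nonzero multiple of `a` can be cancelled on the left. -/
theorem brAt_eq_zero_of_smul_left {f : ℂ[X]} (hf : f ≠ 0) {a b : A}
    (h : ∀ z, brAt z (f • a) b = 0) (z : ℂ) : brAt z a b = 0 := by
  refine brAt_eq_zero_of_infinite (infinite_eval_neg_ne_zero hf) (fun w hw => ?_) z
  have := h w
  rw [brAt_smul_left, C_smul_eq] at this
  exact (smul_eq_zero.1 this).resolve_left hw

end BrAt

/-! ### Polynomials in two variables -/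

section TwoVariables

theorem eq_of_evalEval {p q : ℂ[X][X]} (h : ∀ t z, p.evalEval t z = q.evalEval t z) : p = q := by
  have h1 : ∀ z, valAt p z = valAt q z := fun z => Polynomial.funext fun t => h t z
  rw [← sub_eq_zero]
  refine Polynomial.eq_zero_of_infinite_isRoot _ ((Set.infinite_range_of_injective
    (C_injective (R := ℂ))).mono ?_)
  rintro _ ⟨z, rfl⟩
  simp [IsRoot, h1 z]

theorem exists_evalEval_ne_zero {p : ℂ[X][X]} (h : p ≠ 0) : ∃ t z, p.evalEval t z ≠ 0 := by
  by_contra! h1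
  exact h (eq_of_evalEval fun t z => by rw [h1, evalEval_zero])

/-- The polynomial `p(t, ·)`. -/
def sliceLeft (p : ℂ[X][X]) (t : ℂ) : ℂ[X] := p.map (evalRingHom t)

theorem eval_sliceLeft (p : ℂ[X][X]) (t z : ℂ) : (sliceLeft p t).eval z = p.evalEval t z :=
  map_evalRingHom_eval t z p

theorem eval_valAt (p : ℂ[X][X]) (t z : ℂ) : (valAt p z).eval t = p.evalEval t z := rfl

/-- The polynomial `p(t + a, z + b)`. -/
def shiftPoly (p : ℂ[X][X]) (a b : ℂ) : ℂ[X][X] :=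
  (p.map (compRingHom (X + C a))).comp (X + C (C b))

theorem evalEval_shiftPoly (p : ℂ[X][X]) (a b t z : ℂ) :
    (shiftPoly p a b).evalEval t z = p.evalEval (t + a) (z + b) := by
  rw [shiftPoly, evalEval, eval_comp]
  induction p using Polynomial.induction_on' with
  | add p q hp hq =>
    simp only [evalEval, Polynomial.map_add, eval_add] at hp hq ⊢
    rw [hp, hq]
  | monomial n c => simp [evalEval, eval_comp]

/-- The Euler operator: its eigenvectors are the homogeneous polynomials, which the second clause
makes visible on coefficients. -/
theorem exists_euler (p : ℂ[X][X]) : ∃ q : ℂ[X][X],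
    (∀ t z, q.evalEval t z =
      t * (derivative (valAt p z)).eval t + z * (derivative (sliceLeft p t)).eval z) ∧
    ∀ a b, (q.coeff b).coeff a = (a + b : ℂ) * (p.coeff b).coeff a := by
  induction p using Polynomial.induction_on' with
  | add p q hp hq =>
    obtain ⟨p', h1, h2⟩ := hp
    obtain ⟨q', h3, h4⟩ := hq
    refine ⟨p' + q', fun t z => ?_, fun a b => ?_⟩
    · rw [evalEval_add, h1, h3]
      simp only [sliceLeft, eval_add, derivative_add, Polynomial.map_add]
      ring
    · simp only [coeff_add, h2, h4]
      ring
  | monomial n c =>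
    refine ⟨monomial n (X * derivative c + (n : ℂ[X]) * c), fun t z => ?_, fun a b => ?_⟩
    · rcases n with _ | n
      · simp [evalEval, sliceLeft]
      · simp only [evalEval, sliceLeft, eval_monomial, map_monomial, derivative_monomial,
          derivative_mul, eval_mul, eval_add, eval_X, eval_natCast, ← C_pow, derivative_C, eval_C,
          coe_evalRingHom, mul_zero, add_zero, Nat.add_sub_cancel]
        push_cast
        ring
    · rw [coeff_monomial, coeff_monomial]
      split_ifs with h
      · subst h
        rcases a with _ | a
        · simp
        · rw [coeff_add, coeff_X_mul, coeff_derivative, ← C_eq_natCast, coeff_C_mul]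
          push_cast
          ring
      · simp

theorem evalEval_scale {p : ℂ[X][X]} {n : ℕ}
    (h : ∀ a b, (p.coeff b).coeff a ≠ 0 → a + b = n) (s t z : ℂ) :
    p.evalEval (s * t) (s * z) = s ^ n * p.evalEval t z := by
  simp only [evalEval, eval_eq_sum (p := p), Polynomial.sum, eval_finsetSum, eval_mul, eval_pow,
    eval_C, Finset.mul_sum]
  refine Finset.sum_congr rfl fun b _ => ?_
  rw [eval_eq_sum, eval_eq_sum, Polynomial.sum, Polynomial.sum, Finset.sum_mul, Finset.sum_mul,
    Finset.mul_sum]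
  refine Finset.sum_congr rfl fun a ha => ?_
  rw [← h a b (mem_support_iff.1 ha)]
  ring

end TwoVariables

/-! ### Equivariance under the Virasoro conformal algebra -/

section Equivariance

/-- The condition on `p` for `[a_λ b] = p(∂, λ)c` to be compatible with the actions
`[L_λ a] = (∂ + α + Δλ)a`, `[L_λ b] = (∂ + α' + Δ'λ)b`, `[L_λ c] = (∂ + α'' + Δ''λ)c`. -/
def Equivariant (p : ℂ[X][X]) (α Δ α' Δ' α'' Δ'' : ℂ) : Prop :=
  ∀ t z w : ℂ, p.evalEval (t + z) w * (t + α'' + Δ'' * z) =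
    (-z - w + α + Δ * z) * p.evalEval t (z + w) + (t + w + α' + Δ' * z) * p.evalEval t w

variable {p : ℂ[X][X]} {α Δ α' Δ' α'' Δ'' : ℂ}

/-- At `z = 0` the weights drop out and only the shifts remain. -/
theorem Equivariant.add_eq (h : Equivariant p α Δ α' Δ' α'' Δ'') (hp : p ≠ 0) : α'' = α + α' := by
  obtain ⟨t, w, hw⟩ := exists_evalEval_ne_zero hp
  have h1 := h t 0 w
  simp only [add_zero, zero_add] at h1
  have h2 : (α'' - (α + α')) * p.evalEval t w = 0 := by linear_combination h1
  exact sub_eq_zero.1 ((mul_eq_zero.1 h2).resolve_right hw)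

theorem Equivariant.shift (h : Equivariant p α Δ α' Δ' (α + α') Δ'') :
    Equivariant (shiftPoly p (-(α + α')) α) 0 Δ 0 Δ' 0 Δ'' := by
  intro t z w
  simp only [evalEval_shiftPoly]
  have h1 := h (t + -(α + α')) z (w + α)
  rw [show t + -(α + α') + z = t + z + -(α + α') by ring,
    show z + (w + α) = z + w + α by ring] at h1
  linear_combination h1

/-- With zero shifts, differentiating the equivariance identity in `z` at `z = 0` gives Euler's
equation with eigenvalue `Δ + Δ' - 1 - Δ''`. -/
theorem Equivariant.euler (h : Equivariant p 0 Δ 0 Δ' 0 Δ'') (a b : ℕ) :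
    ((a + b : ℂ) - (Δ + Δ' - 1 - Δ'')) * (p.coeff b).coeff a = 0 := by
  obtain ⟨q, hq, hc⟩ := exists_euler p
  have h1 : q = C (C (Δ + Δ' - 1 - Δ'')) * p := by
    refine eq_of_evalEval fun t w => ?_
    have h2 : (valAt p w).comp (C t + X) * (C t + C Δ'' * X) =
        (-X - C w + C Δ * X) * (sliceLeft p t).comp (X + C w) +
        (C t + C w + C Δ' * X) * C (p.evalEval t w) := by
      refine Polynomial.funext fun z => ?_
      have := h t z w
      simp only [eval_mul, eval_add, eval_comp, eval_C, eval_X, eval_sub, eval_neg, eval_sliceLeft]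
      rw [eval_valAt]
      linear_combination this
    have h3 := congrArg (fun f => (derivative f).eval 0) h2
    simp only [derivative_mul, derivative_add, derivative_sub, derivative_neg, derivative_comp,
      derivative_C, derivative_X, eval_mul, eval_add, eval_comp, eval_C, eval_X, eval_sub,
      eval_neg, eval_zero, eval_one, eval_valAt, eval_sliceLeft] at h3
    rw [hq, evalEval_mul, evalEval_C, eval_C]
    simp only [add_zero, zero_add, mul_zero, mul_one, sub_zero, one_mul, neg_zero] at h3
    linear_combination h3
  have h4 := hc a b
  rw [h1, coeff_C_mul, coeff_C_mul] at h4
  linear_combination -h4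

/-- An equivariant polynomial is homogeneous in the shifted variables. -/
theorem Equivariant.homogeneous (h : Equivariant p α Δ α' Δ' α'' Δ'') (hp : p ≠ 0) :
    ∃ n : ℕ, Δ + Δ' - 1 - Δ'' = n ∧ ∀ s t z : ℂ,
      p.evalEval (s * t - α'') (s * z + α) = s ^ n * p.evalEval (t - α'') (z + α) := by
  obtain rfl := h.add_eq hp
  have h1 := h.shift
  set q := shiftPoly p (-(α + α')) α with hq
  have hq0 : q ≠ 0 := by
    obtain ⟨t, z, hz⟩ := exists_evalEval_ne_zero hp
    intro h0
    have := evalEval_shiftPoly p (-(α + α')) α (t + (α + α')) (z - α)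
    rw [← hq, h0, evalEval_zero] at this
    simp only [add_neg_cancel_right, sub_add_cancel] at this
    exact hz this.symm
  obtain ⟨b, hb⟩ : ∃ b, q.coeff b ≠ 0 := by
    by_contra! h0
    exact hq0 (Polynomial.ext fun n => by rw [h0, coeff_zero])
  obtain ⟨a, ha⟩ : ∃ a, (q.coeff b).coeff a ≠ 0 := by
    by_contra! h0
    exact hb (Polynomial.ext fun n => by rw [h0, coeff_zero])
  have key : ∀ a b, (q.coeff b).coeff a ≠ 0 → (a + b : ℂ) = Δ + Δ' - 1 - Δ'' := fun a b hab =>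
    sub_eq_zero.1 ((mul_eq_zero.1 (h1.euler a b)).resolve_right hab)
  refine ⟨a + b, by rw [← key a b ha]; push_cast; ring, fun s t z => ?_⟩
  have h2 := evalEval_scale (p := q) (n := a + b) (fun a' b' h' => by
    have := (key a' b' h').trans (key a b ha).symm
    exact_mod_cast this) s t z
  rw [hq, evalEval_shiftPoly, evalEval_shiftPoly] at h2
  simpa only [sub_eq_add_neg] using h2

/-- The point `(-α'', α)` is the centre of homogeneity, and a homogeneous polynomial that is nonzero
at its centre has degree 0. -/
theorem Equivariant.eq_const (h : Equivariant p α Δ α' Δ' α'' Δ'')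
    (hp : p.evalEval (-α'') α ≠ 0) :
    Δ + Δ' - 1 - Δ'' = 0 ∧ ∀ t z, p.evalEval t z = p.evalEval (-α'') α := by
  have hp0 : p ≠ 0 := by
    rintro rfl
    simp at hp
  obtain ⟨n, hn, hs⟩ := h.homogeneous hp0
  have h0 := hs 0 0 0
  simp only [zero_mul, zero_sub, zero_add] at h0
  have hn0 : n = 0 := by
    by_contra hne
    rw [zero_pow hne, zero_mul] at h0
    exact hp h0
  subst hn0
  refine ⟨by simpa using hn, fun t z => ?_⟩
  have := hs 0 (t + α'') (z - α)
  simpa using this.symm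

/-- If `p(0, ·)` vanished, the identity at `t = 0` would reduce to `2z p(z, w) = 0`. -/
theorem Equivariant.slice_zero_ne (h : Equivariant p α Δ α' Δ' 0 2) (hp : p ≠ 0) :
    sliceLeft p 0 ≠ 0 := by
  intro h0
  have h1 : ∀ w, p.evalEval 0 w = 0 := fun w => by rw [← eval_sliceLeft, h0, eval_zero]
  refine hp (eq_of_evalEval fun t w => ?_)
  have h3 : X * valAt p w = 0 := by
    refine Polynomial.funext fun z => ?_
    have := h 0 z w
    rw [h1, h1] at this
    simp only [zero_add, mul_zero, add_zero] at this
    rw [eval_mul, eval_X, eval_valAt, eval_zero]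
    linear_combination this / 2
  have h4 := (mul_eq_zero.1 h3).resolve_left X_ne_zero
  rw [← eval_valAt, h4, evalEval_zero, eval_zero]

/-- If `p(·, α)` vanished, the identity at `w = α` would reduce to `(Δ - 1) z p(t, z + α) = 0`; this
is why weight 1 needs separate treatment. -/
theorem Equivariant.slice_ne (h : Equivariant p α Δ α' Δ' α'' Δ'') (hp : p ≠ 0) (hΔ : Δ ≠ 1) :
    valAt p α ≠ 0 := by
  intro h0
  have h1 : ∀ t, p.evalEval t α = 0 := fun t => by rw [← eval_valAt, h0, eval_zero]
  refine hp (eq_of_evalEval fun t w => ?_)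
  have h3 : X * (sliceLeft p t).comp (X + C α) = 0 := by
    refine Polynomial.funext fun z => ?_
    have := h t z α
    rw [h1, h1] at this
    rw [eval_mul, eval_X, eval_comp, eval_sliceLeft, eval_zero, eval_add, eval_X, eval_C]
    have h5 : (Δ - 1) * (z * p.evalEval t (z + α)) = 0 := by linear_combination -this
    exact (mul_eq_zero.1 h5).resolve_left (sub_ne_zero.2 hΔ)
  have h4 := (mul_eq_zero.1 h3).resolve_left X_ne_zero
  have h5 := congrArg (fun f => f.eval (w - α)) h4
  simp only [eval_comp, eval_add, eval_X, eval_C, sub_add_cancel, eval_zero, eval_sliceLeft] at h5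
  rw [h5, evalEval_zero]

theorem exists_eval_mul_ne_zero {f g : ℂ[X]} (hf : f ≠ 0) (hg : g ≠ 0) :
    ∃ z, f.eval z ≠ 0 ∧ g.eval z ≠ 0 := by
  by_contra! h
  refine mul_ne_zero hf hg (Polynomial.funext fun z => ?_)
  rw [eval_mul, eval_zero, mul_eq_zero]
  by_cases h1 : f.eval z = 0
  · exact Or.inl h1
  · exact Or.inr (h z h1)

variable {A B D E : ℂ[X][X]} {γ Γ γ' Γ' γ'' Γ'' : ℂ} {η H η' H' : ℂ}

/-- At `t = 0`, `z = α` the right-hand side is `D(w, α)E(0, w)`, nonzero for some `w` because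
neither slice vanishes. So `B` is nonzero at its centre of homogeneity and is constant. -/
theorem const_of_commuting (hABDE : ∀ t z w, A.evalEval (t + z) w * B.evalEval t z =
      D.evalEval (t + w) z * E.evalEval t w)
    (hB : Equivariant B α Δ α' Δ' 0 2) (hD : Equivariant D α Δ γ' Γ' γ'' Γ'')
    (hE : Equivariant E η H η' H' 0 2) (hD0 : D ≠ 0) (hE0 : E ≠ 0) (hΔ : Δ ≠ 1) :
    Δ + Δ' = 3 ∧ ∃ c : ℂ, c ≠ 0 ∧ ∀ t z, B.evalEval t z = c := by
  obtain ⟨w, h1, h2⟩ := exists_eval_mul_ne_zero (hD.slice_ne hD0 hΔ) (hE.slice_zero_ne hE0)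
  rw [eval_valAt] at h1
  rw [eval_sliceLeft] at h2
  have h3 := hABDE 0 α w
  rw [zero_add, zero_add] at h3
  have h4 : B.evalEval 0 α ≠ 0 := by
    intro h0
    rw [h0, mul_zero] at h3
    exact mul_ne_zero h1 h2 h3.symm
  have h5 : B.evalEval (-0) α ≠ 0 := by rwa [neg_zero]
  obtain ⟨h6, h7⟩ := hB.eq_const h5
  exact ⟨by linear_combination h6, _, h5, h7⟩

theorem exists_of_valAt_eq_zero (h : valAt p α = 0) :
    ∃ q : ℂ[X][X], p = (X - C (C α)) * q := dvd_iff_isRoot.2 h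

/-- Dividing by `λ - α` corresponds to dividing the left vector by `∂ + α`, which lowers weight 1 to
weight 0. -/
theorem Equivariant.divide {q : ℂ[X][X]} (h : Equivariant p α 1 α' Δ' α'' Δ'')
    (hq : p = (X - C (C α)) * q) : Equivariant q α 0 α' Δ' α'' Δ'' := by
  have h1 : ∀ t z, p.evalEval t z = (z - α) * q.evalEval t z := fun t z => by
    rw [hq, evalEval_mul, evalEval_sub, evalEval_X, evalEval_C, eval_C]
  have h2 : ∀ t z w, (w - α) * (q.evalEval (t + z) w * (t + α'' + Δ'' * z) -
      ((-z - w + α + 0 * z) * q.evalEval t (z + w) + (t + w + α' + Δ' * z) * q.evalEval t w))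
      = 0 := by
    intro t z w
    have := h t z w
    rw [h1, h1, h1] at this
    linear_combination this
  intro t z w
  have h3 : (X - C α) * ((sliceLeft q (t + z)) * C (t + α'' + Δ'' * z) -
      ((- C z - X + C α) * (sliceLeft q t).comp (C z + X) +
        (C t + X + C α' + C (Δ' * z)) * sliceLeft q t)) = 0 := by
    refine Polynomial.funext fun w => ?_
    have := h2 t z w
    simp only [eval_mul, eval_add, eval_sub, eval_neg, eval_X, eval_C, eval_comp, eval_sliceLeft,
      eval_zero]
    linear_combination this
  have h4 := (mul_eq_zero.1 h3).resolve_left (X_sub_C_ne_zero α)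
  have h5 := congrArg (fun f => f.eval w) h4
  simp only [eval_mul, eval_add, eval_sub, eval_neg, eval_X, eval_C, eval_comp, eval_sliceLeft,
    eval_zero] at h5
  linear_combination h5

/-- If `B` vanishes on the line `λ = α`, so does `D`, and cancelling `λ - α` from both reduces to
weight 0, where `const_of_commuting` applies. If not, equivariance along that line shows that `B` is
nonzero at its centre. -/
theorem linear_of_commuting (hABDE : ∀ t z w, A.evalEval (t + z) w * B.evalEval t z =
      D.evalEval (t + w) z * E.evalEval t w)
    (hB : Equivariant B α 1 α' Δ' 0 2) (hD : Equivariant D α 1 γ' Γ' γ'' Γ'')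
    (hE : Equivariant E η H η' H' 0 2) (hD0 : D ≠ 0) (hE0 : E ≠ 0) :
    (Δ' = 2 ∧ ∃ c : ℂ, c ≠ 0 ∧ ∀ t z, B.evalEval t z = c) ∨
    (Δ' = 3 ∧ ∃ c : ℂ, c ≠ 0 ∧ ∀ t z, B.evalEval t z = c * (z - α)) := by
  by_cases hs : valAt B α = 0
  · right
    have h1 : ∀ t, B.evalEval t α = 0 := fun t => by rw [← eval_valAt, hs, eval_zero]
    have hDs : valAt D α = 0 := by
      by_contra hne
      obtain ⟨w, h2, h3⟩ := exists_eval_mul_ne_zero hne (hE.slice_zero_ne hE0)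
      have h4 := hABDE 0 α w
      rw [zero_add, zero_add, h1, mul_zero, ← eval_sliceLeft E, ← eval_valAt D] at h4
      exact mul_ne_zero h2 h3 h4.symm
    obtain ⟨B', hB'⟩ := exists_of_valAt_eq_zero hs
    obtain ⟨D', hD'⟩ := exists_of_valAt_eq_zero hDs
    have hD'0 : D' ≠ 0 := by
      rintro rfl
      rw [mul_zero] at hD'
      exact hD0 hD'
    have ev : ∀ q : ℂ[X][X], ∀ t z, ((X - C (C α)) * q).evalEval t z = (z - α) * q.evalEval t z :=
      fun q t z => by rw [evalEval_mul, evalEval_sub, evalEval_X, evalEval_C, eval_C]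
    have h5 : ∀ t z w, A.evalEval (t + z) w * B'.evalEval t z =
        D'.evalEval (t + w) z * E.evalEval t w := by
      intro t z w
      have h6 : (X - C α) * ((valAt A w).comp (C t + X) * sliceLeft B' t -
          sliceLeft D' (t + w) * C (E.evalEval t w)) = 0 := by
        refine Polynomial.funext fun z => ?_
        have := hABDE t z w
        rw [hB', hD', ev, ev] at this
        simp only [eval_mul, eval_sub, eval_X, eval_C, eval_comp, eval_sliceLeft, eval_zero,
          eval_add, eval_valAt]
        linear_combination this
      have h7 := (mul_eq_zero.1 h6).resolve_left (X_sub_C_ne_zero α)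
      have h8 := congrArg (fun f => f.eval z) h7
      simp only [eval_mul, eval_sub, eval_X, eval_C, eval_comp, eval_sliceLeft, eval_zero,
          eval_add, eval_valAt] at h8
      linear_combination h8
    obtain ⟨h9, c, hc, h10⟩ := const_of_commuting h5 (hB.divide hB') (hD.divide hD') hE hD'0 hE0
      zero_ne_one
    exact ⟨by linear_combination h9, c, hc, fun t z => by rw [hB', ev, h10, mul_comm]⟩
  · left
    have h1 : ∀ z, z ≠ 0 → B.evalEval z α = Δ' / 2 * B.evalEval 0 α := by
      intro z hz
      have := hB 0 z α
      simp only [zero_add] at this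
      have hne : 2 * z ≠ 0 := mul_ne_zero two_ne_zero hz
      have hz0 := hB 0 0 α
      simp only [zero_add, add_zero, mul_zero] at hz0
      have : 2 * z * (B.evalEval z α - Δ' / 2 * B.evalEval 0 α) = 0 := by
        linear_combination this - hz0
      exact sub_eq_zero.1 ((mul_eq_zero.1 this).resolve_left hne)
    have h2 : B.evalEval 0 α ≠ 0 := by
      intro h0
      refine hs (Polynomial.funext fun z => ?_)
      rw [eval_valAt, eval_zero]
      by_cases hz : z = 0
      · rw [hz, h0]
      · rw [h1 z hz, h0, mul_zero]
    have h5 : B.evalEval (-0) α ≠ 0 := by rwa [neg_zero]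
    obtain ⟨h6, h7⟩ := hB.eq_const h5
    exact ⟨by linear_combination h6, _, h5, h7⟩

end Equivariance

/-! ### Rank one modules over the Virasoro conformal algebra -/

/-- At a `t₁` where the leading coefficient in `λ` survives, comparing leading terms in `z` makes
each `q(·, w)` monic of degree one. Then `q(t, z) = t + β(z)`, and the identity becomes a functional
equation for `β` with only affine solutions. -/
theorem linear_of_module_equation {q : ℂ[X][X]}
    (h : ∀ t z w, q.evalEval (t + z) w * q.evalEval t z - q.evalEval (t + w) z * q.evalEval t w =
      (z - w) * q.evalEval t (z + w)) (hq : q ≠ 0) :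
    ∃ α δ : ℂ, ∀ t z, q.evalEval t z = t + α + δ * z := by
  obtain ⟨t₀, z₀, h0⟩ := exists_evalEval_ne_zero hq
  have hg : sliceLeft q t₀ ≠ 0 := by
    intro h1
    rw [← eval_sliceLeft, h1, eval_zero] at h0
    exact h0 rfl
  have hlead : ∀ t, (sliceLeft q t).natDegree ≤ q.natDegree := fun t => natDegree_map_le
  obtain ⟨t₁, ht₁⟩ : ∃ t₁, q.leadingCoeff.eval t₁ ≠ 0 := by
    by_contra! h1
    exact hq (leadingCoeff_eq_zero.1 (Polynomial.funext fun t => by rw [h1, eval_zero]))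
  set g := sliceLeft q t₁ with hgdef
  have hgdeg : g.natDegree = q.natDegree := natDegree_map_of_leadingCoeff_ne_zero _ ht₁
  have hg0 : g ≠ 0 := by
    intro h1
    apply ht₁
    have : g.coeff q.natDegree = q.leadingCoeff.eval t₁ := by
      rw [hgdef, sliceLeft, coeff_map]; rfl
    rw [← this, h1, coeff_zero]
  have key : ∀ w, ∃ β, ∀ t, q.evalEval t w = t + β := by
    intro w
    have h2 : (valAt q w).comp (X + C t₁) * g =
        (X - C w) * g.comp (X + C w) + sliceLeft q (t₁ + w) * C (q.evalEval t₁ w) := by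
      refine Polynomial.funext fun z => ?_
      have := h t₁ z w
      simp only [eval_mul, eval_add, eval_sub, eval_comp, eval_X, eval_C, hgdef, eval_sliceLeft]
      rw [eval_valAt, add_comm z t₁]
      linear_combination this
    have hgc : (g.comp (X + C w)).natDegree = g.natDegree := by
      rw [natDegree_comp, natDegree_X_add_C, mul_one]
    have hgc0 : g.comp (X + C w) ≠ 0 := by
      intro h3
      have := congrArg (fun f => f.comp (X - C w)) h3
      simp [comp_assoc] at this
      exact hg0 this
    have hlc : (g.comp (X + C w)).leadingCoeff = g.leadingCoeff := by
      rw [leadingCoeff_comp (by rw [natDegree_X_add_C]; exact one_ne_zero), leadingCoeff_X_add_C,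
        one_pow, mul_one]
    have hd1 : ((X - C w) * g.comp (X + C w)).natDegree = g.natDegree + 1 := by
      rw [natDegree_mul (X_sub_C_ne_zero w) hgc0, natDegree_X_sub_C, hgc, add_comm]
    have hd2 : (sliceLeft q (t₁ + w) * C (q.evalEval t₁ w)).natDegree < g.natDegree + 1 := by
      refine Nat.lt_succ_of_le ((natDegree_mul_C_le _ _).trans ?_)
      rw [hgdeg]
      exact hlead _
    have hd3 : ((valAt q w).comp (X + C t₁) * g).natDegree = g.natDegree + 1 := by
      rw [h2, natDegree_add_eq_left_of_natDegree_lt (by rw [hd1]; exact hd2), hd1]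
    have hv0 : (valAt q w).comp (X + C t₁) ≠ 0 := by
      intro h3
      rw [h3, zero_mul, natDegree_zero] at hd3
      omega
    have hd4 : (valAt q w).natDegree = 1 := by
      rw [natDegree_mul hv0 hg0, natDegree_comp, natDegree_X_add_C, mul_one] at hd3
      omega
    have hd5 : (valAt q w).leadingCoeff = 1 := by
      have h5 := congrArg leadingCoeff h2
      rw [leadingCoeff_add_of_degree_lt' (degree_lt_degree (by rw [hd1]; exact hd2)),
        leadingCoeff_mul, leadingCoeff_mul, hlc, leadingCoeff_X_sub_C, one_mul,
        leadingCoeff_comp (by rw [natDegree_X_add_C]; exact one_ne_zero), leadingCoeff_X_add_C,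
        one_pow, mul_one] at h5
      exact mul_right_cancel₀ (leadingCoeff_ne_zero.2 hg0) (h5.trans (one_mul _).symm)
    refine ⟨(valAt q w).coeff 0, fun t => ?_⟩
    rw [leadingCoeff, hd4] at hd5
    rw [← eval_valAt, eval_eq_sum_range, hd4, Finset.sum_range_succ, Finset.sum_range_one, hd5]
    ring
  choose β hβ using key
  have hβ2 : ∀ z w, z * β z - w * β w = (z - w) * β (z + w) := by
    intro z w
    have := h 0 z w
    simp only [hβ] at this
    linear_combination this
  have hodd : ∀ z, z ≠ 0 → β (-z) = 2 * β 0 - β z := by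
    intro z hz
    have := hβ2 z (-z)
    rw [add_neg_cancel] at this
    have h1 : z * (β (-z) - (2 * β 0 - β z)) = 0 := by linear_combination this
    exact sub_eq_zero.1 ((mul_eq_zero.1 h1).resolve_left hz)
  refine ⟨β 0, β 1 - β 0, fun t z => ?_⟩
  rw [hβ]
  by_cases hz : z = 1
  · rw [hz]; ring
  -- These arguments have sum `z` and difference 1; reversing the sign of the second interchanges
  -- the roles of sum and difference, so `β z` can be expressed by `β 0` and `β 1`.
  have h1 := hβ2 ((z + 1) / 2) ((z - 1) / 2)
  have h2 := hβ2 ((z + 1) / 2) (-((z - 1) / 2))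
  rw [hodd _ (div_ne_zero (sub_ne_zero.2 hz) two_ne_zero),
    show (z + 1) / 2 + -((z - 1) / 2) = 1 by ring] at h2
  rw [show (z + 1) / 2 + (z - 1) / 2 = z by ring] at h1
  linear_combination h2 - h1

/-! ### Numerical consequences of commutation relations -/

/-- For fixed `t + z`, a zero of the second factor in `w` cannot depend on how the sum is split. The
zero `w = -2` found at `(t, z) = (0, 2)` must persist at `(1, 1)`, which forces `δ = 1`. -/
theorem weight_zero_or_one {φ ℓ : ℂ → ℂ → ℂ} {c δ : ℂ} (hc : c ≠ 0)
    (h : ∀ t z w, φ t z * ℓ (t + z) w = c * z * (t + δ * (z + w))) : δ = 0 ∨ δ = 1 := by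
  by_cases hδ : δ = 0
  · exact Or.inl hδ
  right
  have h1 := h 0 2 0
  have h2 := h 0 2 (-2)
  have h3 := h 1 1 (-2)
  rw [zero_add] at h1 h2
  have h4 : φ 0 2 ≠ 0 := by
    intro h0
    rw [h0, zero_mul] at h1
    have : c * δ = 0 := by linear_combination -h1 / 4
    exact (mul_ne_zero hc hδ) this
  have h5 : ℓ 2 (-2) = 0 := by
    refine (mul_eq_zero.1 ?_).resolve_left h4
    rw [h2]; ring
  rw [show (1 : ℂ) + 1 = 2 by norm_num, h5, mul_zero] at h3
  have h6 : c * (1 - δ) = 0 := by linear_combination -h3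
  exact (sub_eq_zero.1 ((mul_eq_zero.1 h6).resolve_left hc)).symm

/-- On `t = -w` homogeneity turns the left side into a multiple of `z ^ m * w ^ n` with `m + n = 2`.
The right side is `c z (δz + (δ - 1)w)`, so it is a monomial only for `δ = 0` or `δ = 1`. -/
theorem weight_neg_one {φ ℓ : ℂ → ℂ → ℂ} {c δ δ' : ℂ} {m n : ℕ} (hc : c ≠ 0)
    (h : ∀ t z w, φ (t + w) z * ℓ t w = c * z * (t + δ * (z + w)))
    (hφ : ∀ s t z, φ (s * t) (s * z) = s ^ m * φ t z)
    (hℓ : ∀ s t z, ℓ (s * t) (s * z) = s ^ n * ℓ t z)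
    (hm : δ - δ' = m) (hn : 2 + δ' - δ = n) : δ' = -1 := by
  have hmn : m + n = 2 := by
    have : (m + n : ℂ) = 2 := by rw [← hm, ← hn]; ring
    exact_mod_cast this
  have key : ∀ z w, z ^ m * w ^ n * (φ 0 1 * ℓ (-1) 1) = c * z * (-w + δ * (z + w)) := by
    intro z w
    have h1 := h (-w) z w
    have h2 := hφ z 0 1
    have h3 := hℓ w (-1) 1
    simp only [mul_zero, mul_one, mul_neg] at h2 h3
    rw [neg_add_cancel, h2, h3] at h1
    linear_combination h1
  obtain ⟨rfl, rfl⟩ | ⟨rfl, rfl⟩ | ⟨rfl, rfl⟩ :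
      (m = 0 ∧ n = 2) ∨ (m = 1 ∧ n = 1) ∨ (m = 2 ∧ n = 0) := by omega
  · have h1 := key 0 1
    have h2 := key 1 0
    have h3 := key 1 1
    simp at h1 h2 h3
    have h4 : δ = 0 := h2.resolve_left hc
    rw [h4] at h3
    rcases h1 with h1 | h1 <;> rw [h1] at h3 <;> simp at h3 <;> exact absurd h3 hc
  · have h2 := key 1 0
    simp at h2
    have h4 : δ = 0 := h2.resolve_left hc
    rw [h4] at hm
    linear_combination -hm
  · have h2 := key 1 0
    have h3 := key 1 1
    have h1 : c * (δ - 1) = 0 := by linear_combination h2 - h3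
    have h4 : δ = 1 := sub_eq_zero.1 ((mul_eq_zero.1 h1).resolve_left hc)
    rw [h4] at hm
    push_cast at hm
    linear_combination -hm

/-- For every `s` some `z` makes the right side nonzero, so `q` has no zeros. Since neither `f` nor
the right side involves `t`, `q` depends on `s` alone, and a polynomial in one variable without
zeros is constant. -/
theorem const_of_nowhere_zero {q : ℂ[X][X]} {f : ℂ → ℂ → ℂ} {κ : ℂ} (hκ : κ ≠ 0)
    (h : ∀ s z t, f s z * q.evalEval t s = κ * (2 * z - s)) :
    ∃ c : ℂ, c ≠ 0 ∧ ∀ t s, q.evalEval t s = c := by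
  have h1 : ∀ t s, q.evalEval t s ≠ 0 := by
    intro t s h0
    have := h s (s / 2 + 1) t
    rw [h0, mul_zero] at this
    apply hκ
    linear_combination -this / 2
  have h2 : ∀ t s, q.evalEval t s = q.evalEval 0 s := by
    intro t s
    have h3 := h s (s / 2 + 1) t
    have h4 := h s (s / 2 + 1) 0
    have h5 : f s (s / 2 + 1) ≠ 0 := by
      intro h0
      rw [h0, zero_mul] at h3
      apply hκ
      linear_combination -h3 / 2
    exact mul_left_cancel₀ h5 (h3.trans h4.symm)
  have h6 : (sliceLeft q 0).degree = 0 := by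
    by_contra hne
    obtain ⟨z, hz⟩ := IsAlgClosed.exists_root _ hne
    rw [IsRoot, eval_sliceLeft] at hz
    exact h1 _ _ hz
  refine ⟨(sliceLeft q 0).coeff 0, ?_, fun t s => ?_⟩
  · have := h1 0 0
    rw [← eval_sliceLeft, eq_C_of_degree_eq_zero h6, eval_C] at this
    exact this
  · rw [h2, ← eval_sliceLeft]
    conv_lhs => rw [eq_C_of_degree_eq_zero h6, eval_C]

/-- The 2×2 matrix of values on `{0, 1}²` has rank at most one; its determinant is `-ab` up to sign.
-/
theorem mul_eq_zero_of_separated {f g : ℂ → ℂ} {a b c : ℂ}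
    (h : ∀ t z, f z * g t = a * t + b * z + c) :
    a * b = 0 := by
  linear_combination (f 1 * g 1) * h 0 0 + (a * 0 + b * 0 + c) * h 1 1
    - (f 1 * g 0) * h 1 0 - (a * 1 + b * 0 + c) * h 0 1

/-! ### Equivariant polynomials of total degree one and two -/

section LowDegree

theorem natDegree_add_le_totalDeg (p : ℂ[X][X]) {n : ℕ} (hn : p.coeff n ≠ 0) :
    (p.coeff n).natDegree + n ≤ totalDeg p :=
  Finset.le_sup (f := fun n => (p.coeff n).natDegree + n) (mem_support_iff.2 hn)

theorem exists_eq_totalDeg {p : ℂ[X][X]} (hp : totalDeg p ≠ 0) :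
    ∃ n, p.coeff n ≠ 0 ∧ (p.coeff n).natDegree + n = totalDeg p := by
  have hne : p.support.Nonempty := by
    rw [Finset.nonempty_iff_ne_empty]
    intro h
    exact hp (by rw [totalDeg, h, Finset.sup_empty]; rfl)
  obtain ⟨n, hn, h⟩ := Finset.exists_mem_eq_sup p.support hne
    (fun n => (p.coeff n).natDegree + n)
  exact ⟨n, mem_support_iff.1 hn, h.symm⟩

theorem coeff_natDegree_le {p : ℂ[X][X]} {d : ℕ} (h : totalDeg p ≤ d) (n : ℕ) :
    (p.coeff n).natDegree ≤ d - n := by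
  by_cases hn : p.coeff n = 0
  · simp [hn]
  · have := natDegree_add_le_totalDeg p hn
    omega

theorem natDegree_le_of_totalDeg {p : ℂ[X][X]} {d : ℕ} (h : totalDeg p ≤ d) : p.natDegree ≤ d :=
  natDegree_le_iff_coeff_eq_zero.2 fun n hn => by
    by_contra h0
    have := natDegree_add_le_totalDeg p h0
    omega

theorem evalEval_of_totalDeg_le {p : ℂ[X][X]} {d : ℕ} (h : totalDeg p ≤ d) (t z : ℂ) :
    p.evalEval t z = ∑ n ∈ Finset.range (d + 1), (∑ m ∈ Finset.range (d - n + 1),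
      (p.coeff n).coeff m * t ^ m) * z ^ n := by
  rw [evalEval, eval_eq_sum_range' (Nat.lt_succ_of_le (natDegree_le_of_totalDeg h)),
    eval_finsetSum]
  refine Finset.sum_congr rfl fun n _ => ?_
  rw [eval_mul, eval_pow, eval_C,
    eval_eq_sum_range' (Nat.lt_succ_of_le (coeff_natDegree_le h n))]

theorem coeff_coeff_ne_zero {p : ℂ[X][X]} {n d : ℕ} (hn : p.coeff n ≠ 0)
    (h : (p.coeff n).natDegree + n = d) : (p.coeff n).coeff (d - n) ≠ 0 := by
  rw [← h, Nat.add_sub_cancel, coeff_natDegree]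
  exact leadingCoeff_ne_zero.2 hn

variable {p : ℂ[X][X]} {α Δ α' Δ' : ℂ}

/-- In the variables `t, z - α` the polynomial is linear without constant term; one value of the
equivariance identity fixes the ratio of its two coefficients. -/
theorem Equivariant.of_totalDeg_eq_one (h : Equivariant p α Δ α' Δ' 0 2) (hd : totalDeg p = 1) :
    Δ + Δ' = 4 ∧ ∃ c : ℂ, c ≠ 0 ∧ ∀ t z, p.evalEval t z = c * ((Δ - 1) / 2 * t + (z - α)) := by
  have hp : p ≠ 0 := by
    rintro rfl
    simp [totalDeg] at hd
  obtain ⟨a, b, k, hab, hf⟩ : ∃ a b k : ℂ, (a ≠ 0 ∨ b ≠ 0) ∧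
      ∀ t z, p.evalEval t (z + α) = a * t + b * z + k := by
    refine ⟨(p.coeff 0).coeff 1, (p.coeff 1).coeff 0,
      (p.coeff 0).coeff 0 + (p.coeff 1).coeff 0 * α, ?_, fun t z => ?_⟩
    · obtain ⟨n, hn, h1⟩ := exists_eq_totalDeg (p := p) (by rw [hd]; exact one_ne_zero)
      rw [hd] at h1
      have h2 := coeff_coeff_ne_zero hn h1
      obtain rfl | rfl : n = 0 ∨ n = 1 := by omega
      · exact Or.inl h2
      · exact Or.inr h2
    · rw [evalEval_of_totalDeg_le hd.le]
      simp only [Finset.sum_range_succ, Finset.sum_range_zero]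
      ring
  obtain ⟨n, hn, hs⟩ := h.homogeneous hp
  simp only [sub_zero, hf] at hs
  obtain ⟨t, z, hκ⟩ : ∃ t z, a * t + b * z ≠ 0 := by
    rcases hab with ha | hb
    · exact ⟨1, 0, by simpa using ha⟩
    · exact ⟨0, 1, by simpa using hb⟩
  have h0 := hs 0 t z
  have h2 := hs 2 t z
  have hn0 : n ≠ 0 := by
    rintro rfl
    apply hκ
    linear_combination -h0
  rw [zero_pow hn0] at h0
  have hk : k = 0 := by linear_combination h0
  subst hk
  have hn1 : n = 1 := by
    have h3 : (2 : ℂ) ^ n = 2 := mul_right_cancel₀ hκ (by linear_combination -h2)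
    have h4 : 2 ^ n = 2 ^ 1 := by
      rw [pow_one]
      exact_mod_cast h3
    exact Nat.pow_right_injective le_rfl h4
  rw [hn1] at hn
  have hΔ : Δ + Δ' = 4 := by
    push_cast at hn
    linear_combination hn
  have h5 := h 0 1 (0 + α)
  rw [show 1 + (0 + α) = 1 + α by ring, hf, hf, hf] at h5
  have ha : 2 * a = (Δ - 1) * b := by linear_combination h5
  refine ⟨hΔ, b, ?_, fun t z => ?_⟩
  · rintro rfl
    rcases hab with h6 | h6
    · exact h6 (by linear_combination ha / 2)
    · exact h6 rfl
  · have := hf t (z - α)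
    rw [sub_add_cancel] at this
    rw [this]
    linear_combination t / 2 * ha

/-- Homogeneity leaves a quadratic form `a t² + b t z + e z²` in shifted variables. Equivariance
gives three linear relations among `a, b, e`, compatible with a nonzero form only if `(Δ - 1)(Δ - 4)
= 0`. -/
theorem Equivariant.of_totalDeg_eq_two (h : Equivariant p α Δ α' Δ' 0 2) (hd : totalDeg p = 2) :
    Δ + Δ' = 5 ∧ (Δ = 1 ∨ Δ = 4) ∧ ∃ c : ℂ, c ≠ 0 ∧ ∀ t z, p.evalEval t z =
      c * ((Δ - 1) / 2 * t ^ 2 + (Δ - 3 / 2) * t * (z - α) + (z - α) ^ 2) := by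
  have hp : p ≠ 0 := by
    rintro rfl
    simp [totalDeg] at hd
  obtain ⟨a, b, e, a', b', k, hab, hf⟩ : ∃ a b e a' b' k : ℂ, (a ≠ 0 ∨ b ≠ 0 ∨ e ≠ 0) ∧
      ∀ t z, p.evalEval t (z + α) = a * t ^ 2 + b * t * z + e * z ^ 2 + (a' * t + b' * z) + k := by
    refine ⟨(p.coeff 0).coeff 2, (p.coeff 1).coeff 1, (p.coeff 2).coeff 0,
      (p.coeff 0).coeff 1 + (p.coeff 1).coeff 1 * α,
      (p.coeff 1).coeff 0 + 2 * (p.coeff 2).coeff 0 * α,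
      (p.coeff 0).coeff 0 + (p.coeff 1).coeff 0 * α + (p.coeff 2).coeff 0 * α ^ 2, ?_,
      fun t z => ?_⟩
    · obtain ⟨n, hn, h1⟩ := exists_eq_totalDeg (p := p) (by rw [hd]; exact two_ne_zero)
      rw [hd] at h1
      have h2 := coeff_coeff_ne_zero hn h1
      obtain rfl | rfl | rfl : n = 0 ∨ n = 1 ∨ n = 2 := by omega
      · exact Or.inl h2
      · exact Or.inr (Or.inl h2)
      · exact Or.inr (Or.inr h2)
    · rw [evalEval_of_totalDeg_le hd.le]
      simp only [Finset.sum_range_succ, Finset.sum_range_zero]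
      ring
  obtain ⟨n, hn, hs⟩ := h.homogeneous hp
  simp only [sub_zero, hf] at hs
  obtain ⟨t, z, hκ⟩ : ∃ t z, a * t ^ 2 + b * t * z + e * z ^ 2 ≠ 0 := by
    by_contra! hall
    have h1 := hall 1 0
    have h2 := hall 0 1
    have h3 := hall 1 1
    have ha : a = 0 := by linear_combination h1
    have he : e = 0 := by linear_combination h2
    have hb : b = 0 := by linear_combination h3 - h1 - h2
    rcases hab with h4 | h4 | h4 <;> contradiction
  have h0 := hs 0 t z
  have h2 := hs 2 t z
  have hm := hs (-1) t z
  have hn0 : n ≠ 0 := by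
    rintro rfl
    apply hκ
    linear_combination -(1 / 2 : ℂ) * h0 + (1 / 2 : ℂ) * (hm - h0)
  rw [zero_pow hn0] at h0
  have hk : k = 0 := by linear_combination h0
  subst hk
  have hn2 : n = 2 := by
    -- Scaling by `-1` separates the quadratic from the linear terms; odd `n` would kill the
    -- quadratic part.
    rcases Nat.even_or_odd n with he | ho
    · rw [he.neg_one_pow] at hm
      have h3 : a' * t + b' * z = 0 := by linear_combination -hm / 2
      have h4 : (2 : ℂ) ^ n = 4 := mul_right_cancel₀ hκ (by
        linear_combination -h2 + (2 - 2 ^ n) * h3)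
      have h5 : 2 ^ n = 2 ^ 2 := by
        have : (2 : ℕ) ^ n = 4 := by exact_mod_cast h4
        rw [this]; norm_num
      exact Nat.pow_right_injective le_rfl h5
    · rw [ho.neg_one_pow] at hm
      exact absurd (by linear_combination hm / 2) hκ
  subst hn2
  have hαα := h.add_eq hp
  have hlin : ∀ t z, a' * t + b' * z = 0 := fun t z => by linear_combination -hs (-1) t z / 2
  have hf' : ∀ t z, p.evalEval t (z + α) = a * t ^ 2 + b * t * z + e * z ^ 2 := fun t z => by
    rw [hf, hlin]; ring
  have hΔ : Δ + Δ' = 5 := by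
    push_cast at hn
    linear_combination hn
  have e1 := h 0 1 (0 + α)
  rw [show 1 + (0 + α) = 1 + α by ring, hf', hf', hf'] at e1
  have ha : 2 * a = (Δ - 1) * e := by linear_combination e1
  -- The values at `z = 1` and `z = -1` are added so that only the even part in `z` remains.
  have e2 := h 1 1 (0 + α)
  have e3 := h 1 (-1) (0 + α)
  rw [show 1 + (0 + α) = 1 + α by ring, hf', hf', hf'] at e2
  rw [show -1 + (0 + α) = -1 + α by ring, hf', hf', hf'] at e3
  have hb : 5 * a = (Δ - 1) * b := by linear_combination (e2 + e3) / 2 - a * hαα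
  have e4 := h 0 1 (1 + α)
  have e5 := h 0 (-1) (1 + α)
  rw [show 1 + (1 + α) = 2 + α by ring, hf', hf', hf'] at e4
  rw [show -1 + (1 + α) = 0 + α by ring, hf', hf', hf'] at e5
  have hbe : 2 * b = (2 * Δ - 3) * e := by linear_combination (e4 + e5) / 2 - e * hαα
  have he : e ≠ 0 := by
    rintro rfl
    have h6 : a = 0 := by linear_combination ha / 2
    have h7 : b = 0 := by linear_combination hbe / 2
    rcases hab with h8 | h8 | h8 <;> contradiction
  refine ⟨hΔ, ?_, e, he, fun t z => ?_⟩
  · have h6 : e * ((Δ - 1) * (Δ - 4)) = 0 := by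
      linear_combination 5 / 2 * ha - hb + (-(Δ - 1) / 2) * hbe
    rcases mul_eq_zero.1 ((mul_eq_zero.1 h6).resolve_left he) with h7 | h7
    · exact Or.inl (sub_eq_zero.1 h7)
    · exact Or.inr (sub_eq_zero.1 h7)
  · have := hf' t (z - α)
    rw [sub_add_cancel] at this
    rw [this]
    linear_combination t ^ 2 / 2 * ha + t * (z - α) / 2 * hbe

end LowDegree

/-! ### Proportionality and bases in rank one modules. -/

section Basis

variable {A : Type*} [AddCommGroup A] [Module ℂ[X] A]

theorem exists_smul_eq_smul {N : Submodule ℂ[X] A} (h : Module.rank ℂ[X] N ≤ 1) {a b : A}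
    (ha : a ∈ N) (hb : b ∈ N) : ∃ f g : ℂ[X], (f ≠ 0 ∨ g ≠ 0) ∧ f • a = g • b := by
  by_contra! hne
  have hli : LinearIndependent ℂ[X] ![(⟨a, ha⟩ : N), ⟨b, hb⟩] := by
    rw [LinearIndependent.pair_iff]
    intro s t hst
    have h1 : s • a = (-t) • b := by
      have := congrArg Subtype.val hst
      simp only [Submodule.coe_add, Submodule.coe_smul, Submodule.coe_zero] at this
      rw [neg_smul]
      exact eq_neg_of_add_eq_zero_left this
    by_contra h2
    rw [not_and_or] at h2
    exact hne s (-t) (h2.imp id fun h => neg_ne_zero.2 h) h1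
  have h2 := hli.cardinal_lift_le_rank
  have h3 : (Cardinal.lift.{_} (Cardinal.mk (Fin 2))) ≤ 1 := h2.trans (by simpa using h)
  simp at h3

theorem IsBasis.ne_zero {N : Submodule ℂ[X] A} {x : A} (h : IsBasis N x) : x ≠ 0 := by
  rintro rfl
  exact one_ne_zero (h.2 1 (smul_zero _))

theorem IsBasis.mem {N : Submodule ℂ[X] A} {x : A} (h : IsBasis N x) : x ∈ N := by
  rw [← h.1]
  exact Submodule.mem_span_singleton_self x

theorem IsBasis.exists_smul_eq {N : Submodule ℂ[X] A} {x y : A} (h : IsBasis N x) (hy : y ∈ N) :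
    ∃ f : ℂ[X], f • x = y := by
  rw [← h.1] at hy
  exact Submodule.mem_span_singleton.1 hy

theorem IsBasis.smul_injective {N : Submodule ℂ[X] A} {x : A} (h : IsBasis N x) {f g : ℂ[X]}
    (hf : f • x = g • x) : f = g := by
  rw [← sub_eq_zero]
  exact h.2 _ (by rw [sub_smul, hf, sub_self])

/-- Two bases of the same module differ by a nonzero constant. -/
theorem IsBasis.exists_const [Module ℂ A] [IsScalarTower ℂ ℂ[X] A] {N : Submodule ℂ[X] A}
    {x y : A} (hx : IsBasis N x) (hy : IsBasis N y) : ∃ c : ℂ, c ≠ 0 ∧ y = c • x := by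
  obtain ⟨f, hf⟩ := hx.exists_smul_eq hy.mem
  obtain ⟨g, hg⟩ := hy.exists_smul_eq hx.mem
  have h1 : f * g = 1 := hy.smul_injective (by rw [one_smul, mul_smul, hg, hf])
  obtain ⟨c, hc, h2⟩ := Polynomial.isUnit_iff.1 (IsUnit.of_mul_eq_one g h1)
  exact ⟨c, hc.ne_zero, by rw [← hf, ← h2, C_smul_eq]⟩

theorem eval_aeval_add (g : ℂ[X]) (z : ℂ) :
    eval (C z) (aeval (C X + X : ℂ[X][X]) g) = g.comp (X + C z) := by
  induction g using Polynomial.induction_on' with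
  | add p q hp hq => simp [hp, hq]
  | monomial n c => simp [aeval_monomial, Polynomial.algebraMap_apply]

end Basis

/-! ### Simplicity, absence of torsion, and primary generators. -/

section Graded

variable {A : Type*} [AddCommGroup A] [Module ℂ A] [Module ℂ[X] A] [IsScalarTower ℂ ℂ[X] A]
  [LieConformalAlgebra A] {𝒢 : ℤ → Submodule ℂ[X] A}

theorem IsGrading.brAt_mem (h : IsGrading 𝒢) {i j : ℤ} {a b : A} (ha : a ∈ 𝒢 i) (hb : b ∈ 𝒢 j)
    (z : ℂ) : brAt z a b ∈ 𝒢 (i + j) :=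
  eval_mem_of_coeff_mem (N := (𝒢 (i + j)).restrictScalars ℂ) (h.bracket_mem i j a ha b hb) z

/-- A family of submodules of the homogeneous components which is stable under the brackets with
homogeneous elements vanishes as soon as its component of degree `0` does. -/
theorem eq_bot_of_stable (hg : IsGrading 𝒢) (hs : IsGradedSimple 𝒢) (h0 : 𝒢 0 ≠ ⊥)
    {J : ℤ → Submodule ℂ[X] A} (hJ : ∀ i, J i ≤ 𝒢 i)
    (hbr : ∀ i j a b z, a ∈ 𝒢 i → b ∈ J j → brAt z a b ∈ J (i + j)) (hJ0 : J 0 = ⊥) (i : ℤ) :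
    J i = ⊥ := by
  have hideal : IsGradedIdeal 𝒢 (⨆ i, J i) := by
    refine ⟨fun a b hb n => ?_, le_antisymm ?_ (iSup_le fun i => inf_le_left)⟩
    · refine coeff_mem_of_eval_mem (N := (⨆ i, J i).restrictScalars ℂ) Set.infinite_univ
        (fun z _ => ?_) n
      change brAt z a b ∈ ⨆ i, J i
      have ha : a ∈ ⨆ i, 𝒢 i := by
        rw [hg.isInternal.submodule_iSup_eq_top]
        trivial
      induction ha using Submodule.iSup_induction' with
      | zero => simp
      | add x y _ _ hx hy => rw [brAt_add_left]; exact add_mem hx hy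
      | mem i x hx =>
        induction hb using Submodule.iSup_induction' with
        | zero => simp
        | add x y _ _ hx hy => rw [brAt_add_right]; exact add_mem hx hy
        | mem j y hy => exact Submodule.mem_iSup_of_mem (i + j) (hbr i j x y z hx hy)
    · exact iSup_mono fun i => le_inf (le_iSup J i) (hJ i)
  rcases hs _ hideal with h | h
  · exact (iSup_eq_bot.1 h) i
  · exfalso
    apply h0
    have hind := hg.isInternal.submodule_iSupIndep 0
    -- If the ideal were the whole algebra, `𝒢 0` would lie in the sum of the other components,
    -- against directness.
    have h1 : ⨆ i, J i ≤ ⨆ (j) (_ : j ≠ 0), 𝒢 j := by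
      refine iSup_le fun j => ?_
      by_cases hj : j = 0
      · rw [hj, hJ0]
        exact bot_le
      · exact (hJ j).trans (le_iSup₂_of_le j hj le_rfl)
    rw [h, top_le_iff] at h1
    rwa [h1, disjoint_top] at hind

/-- In a simple graded algebra with `𝒢 0` free of rank one there is no torsion. -/
theorem smul_eq_zero_of_simple (hg : IsGrading 𝒢) (hs : IsGradedSimple 𝒢) {L : A}
    (hL : IsBasis (𝒢 0) L) {i : ℤ} {a : A} (ha : a ∈ 𝒢 i) {f : ℂ[X]} (hf : f ≠ 0)
    (h : f • a = 0) : a = 0 := by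
  let J : ℤ → Submodule ℂ[X] A := fun i =>
    { carrier := {a | a ∈ 𝒢 i ∧ ∃ f : ℂ[X], f ≠ 0 ∧ f • a = 0}
      add_mem' := by
        rintro x y ⟨hx, f, hf, hfx⟩ ⟨hy, g, hg, hgy⟩
        refine ⟨add_mem hx hy, f * g, mul_ne_zero hf hg, ?_⟩
        rw [smul_add, mul_comm, mul_smul, hfx, mul_comm, mul_smul, hgy, smul_zero, smul_zero,
          add_zero]
      zero_mem' := ⟨zero_mem _, 1, one_ne_zero, smul_zero _⟩
      smul_mem' := by
        rintro c x ⟨hx, f, hf, hfx⟩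
        exact ⟨Submodule.smul_mem _ _ hx, f, hf, by rw [smul_comm, hfx, smul_zero]⟩ }
  have hJ0 : J 0 = ⊥ := by
    rw [eq_bot_iff]
    rintro x ⟨hx, f, hf, hfx⟩
    obtain ⟨g, rfl⟩ := hL.exists_smul_eq hx
    rw [smul_smul] at hfx
    rw [(mul_eq_zero.1 (hL.2 _ hfx)).resolve_left hf, zero_smul]
    exact zero_mem _
  have h0 : 𝒢 0 ≠ ⊥ := by
    intro h
    exact hL.ne_zero ((Submodule.mem_bot _).1 (h ▸ hL.mem))
  have h1 := eq_bot_of_stable hg hs h0 (J := J) (fun i x hx => hx.1)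
    (fun i j a b z ha hb => by
      obtain ⟨_, f, hf, hfb⟩ := hb
      -- Torsion elements are central: on the left, `f(∂)` acts as the scalar `f(-λ)`, nonzero for
      -- infinitely many `λ`.
      have : brAt z a b = 0 := brAt_eq_zero_comm (brAt_eq_zero_of_smul_left hf fun w => by
        rw [hfb, brAt_zero_left]) z
      rw [this]
      exact zero_mem _) hJ0 i
  have h2 : a ∈ J i := ⟨ha, f, hf, h⟩
  rw [h1] at h2
  exact (Submodule.mem_bot _).1 h2

/-- A Lie conformal algebra graded by torsion-free modules of rank at most one. -/
structure IsThin (𝒢 : ℤ → Submodule ℂ[X] A) : Prop where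
  grading : IsGrading 𝒢
  torsion : ∀ i, ∀ a ∈ 𝒢 i, ∀ f : ℂ[X], f ≠ 0 → f • a = 0 → a = 0
  rank : ∀ i, Module.rank ℂ[X] (𝒢 i) ≤ 1

/-- Proportionality of the elements of a component. -/
theorem IsThin.exists_smul_eq (h : IsThin 𝒢) {i : ℤ} {a b : A} (ha : a ∈ 𝒢 i) (hb : b ∈ 𝒢 i)
    (hb0 : b ≠ 0) : ∃ f g : ℂ[X], f ≠ 0 ∧ f • a = g • b := by
  obtain ⟨f, g, hfg, he⟩ := exists_smul_eq_smul (h.rank i) ha hb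
  refine ⟨f, g, ?_, he⟩
  rintro rfl
  rw [zero_smul] at he
  exact hb0 (h.torsion i b hb g (by simpa using hfg) he.symm)

theorem IsThin.brAt_eq_zero_left (h : IsThin 𝒢) {i : ℤ} {a b c : A} (ha : a ∈ 𝒢 i) (hb : b ∈ 𝒢 i)
    (hb0 : b ≠ 0) (hbc : ∀ z, brAt z b c = 0) (z : ℂ) : brAt z a c = 0 := by
  obtain ⟨f, g, hf, he⟩ := h.exists_smul_eq ha hb hb0
  refine brAt_eq_zero_of_smul_left hf (fun w => ?_) z
  rw [he, brAt_smul_left, hbc, smul_zero]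

theorem IsThin.brAt_eq_zero_right (h : IsThin 𝒢) {i : ℤ} {a b c : A} (ha : a ∈ 𝒢 i) (hb : b ∈ 𝒢 i)
    (hb0 : b ≠ 0) (hbc : ∀ z, brAt z c b = 0) (z : ℂ) : brAt z c a = 0 :=
  brAt_eq_zero_comm (h.brAt_eq_zero_left ha hb hb0 (brAt_eq_zero_comm hbc)) z

/-- `n` is a basis of `𝒢 i` with `[L_λ n] = (∂ + α + δλ)n`. -/
structure IsPrimary (𝒢 : ℤ → Submodule ℂ[X] A) (L : A) (i : ℤ) (n : A) (α δ : ℂ) : Prop where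
  basis : IsBasis (𝒢 i) n
  brAt_eq : ∀ z, brAt z L n = (X + C (α + δ * z)) • n

theorem IsVirasoro.brAt_brAt {L : A} (hL : ∀ z, brAt z L L = (X + C (2 * z)) • L) (z w : ℂ)
    (a : A) : brAt z L (brAt w L a) = (z - w) • brAt (z + w) L a + brAt w L (brAt z L a) := by
  rw [brAt_jacobi, hL, brAt_smul_left, C_smul_eq]
  congr 2
  simp
  ring

theorem exists_matrix_element (h : IsThin 𝒢) {L : A} (hL : L ∈ 𝒢 0) {i : ℤ} {a : A} (ha : a ∈ 𝒢 i)
    (ha0 : a ≠ 0) : ∃ (f : ℂ[X]) (q : ℂ[X][X]), f ≠ 0 ∧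
      ∀ z, f • brAt z L a = valAt q z • a := by
  have h1 : ∀ n, ∃ f g : ℂ[X], f ≠ 0 ∧ f • (bracket L a).coeff n = g • a := fun n =>
    h.exists_smul_eq (by simpa using h.grading.bracket_mem 0 i L hL a ha n) ha ha0
  choose f g hf hfg using h1
  set s := (bracket L a).coeff.support
  refine ⟨∏ n ∈ s, f n, ∑ n ∈ s, monomial n ((∏ m ∈ s.erase n, f m) * g n),
    Finset.prod_ne_zero_iff.2 fun n _ => hf n, fun z => ?_⟩
  rw [brAt, PolynomialModule.eval_apply, Finsupp.sum, Finset.smul_sum, valAt, eval_finsetSum,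
    Finset.sum_smul]
  refine Finset.sum_congr rfl fun n hn => ?_
  rw [eval_monomial, ← Finset.prod_erase_mul s f hn, mul_smul, smul_comm (f n), hfg, smul_smul,
    smul_smul]
  ring_nf

/-- A component on which the Virasoro element acts nontrivially is free, with a basis on which the
action has the standard form. -/
theorem exists_primary (h : IsThin 𝒢) {L : A} (hL0 : L ∈ 𝒢 0)
    (hL : ∀ z, brAt z L L = (X + C (2 * z)) • L) {i : ℤ} {a : A} (ha : a ∈ 𝒢 i)
    (hne : ∃ z, brAt z L a ≠ 0) : ∃ n α δ, IsPrimary 𝒢 L i n α δ := by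
  have hact : ∀ b ∈ 𝒢 i, b ≠ 0 → ∃ z, brAt z L b ≠ 0 := by
    intro b hb hb0
    by_contra! hall
    obtain ⟨z, hz⟩ := hne
    exact hz (h.brAt_eq_zero_right ha hb hb0 hall z)
  have ha0 : a ≠ 0 := by
    rintro rfl
    obtain ⟨z, hz⟩ := hne
    exact hz (brAt_zero_right _ _)
  -- The basis will be an element whose matrix coefficient has least degree in `λ`. Replacing `c` by
  -- `g(∂)c` multiplies the coefficient by `g(∂ + λ)`, up to factors in `∂`, so its degree grows by
  -- `deg g`; a minimizer is therefore indivisible.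
  let D : Set ℕ := {d | ∃ (b : A) (f : ℂ[X]) (q : ℂ[X][X]), b ∈ 𝒢 i ∧ b ≠ 0 ∧ f ≠ 0 ∧
    (∀ z, f • brAt z L b = valAt q z • b) ∧ q.natDegree = d}
  have hD : D.Nonempty := by
    obtain ⟨f, q, hf, hq⟩ := exists_matrix_element h hL0 ha ha0
    exact ⟨_, a, f, q, ha, ha0, hf, hq, rfl⟩
  obtain ⟨b, f, q, hb, hb0, hf, hq, hd⟩ := Nat.sInf_mem hD
  have hdiv : ∀ (c : A) (g : ℂ[X]), c ∈ 𝒢 i → g • c = b → g.natDegree = 0 := by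
    intro c g hc hgc
    have hc0 : c ≠ 0 := by
      rintro rfl
      rw [smul_zero] at hgc
      exact hb0 hgc.symm
    have hg0 : g ≠ 0 := by
      rintro rfl
      rw [zero_smul] at hgc
      exact hb0 hgc.symm
    obtain ⟨f', q', hf', hq'⟩ := exists_matrix_element h hL0 hc hc0
    have hmin : sInf D ≤ q'.natDegree := Nat.sInf_le ⟨c, f', q', hc, hc0, hf', hq', rfl⟩
    have hq'0 : q' ≠ 0 := by
      rintro rfl
      obtain ⟨z, hz⟩ := hact c hc hc0
      refine hz (h.torsion i _ (by simpa using h.grading.brAt_mem hL0 hc z) f' hf' ?_)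
      rw [hq']
      simp
    let G : ℂ[X][X] := aeval (C X + X : ℂ[X][X]) g
    have hG : ∀ z, valAt G z = g.comp (X + C z) := eval_aeval_add g
    have heq : C (f' * g) * q = C f * (G * q') := by
      refine eq_of_evalEval fun t z => ?_
      have e1 : (f' * g) • f • brAt z L b = (f' * (g * valAt q z)) • b := by
        rw [hq, smul_smul, mul_assoc]
      have e2 : (f' * g) • f • brAt z L b = (f * valAt G z * valAt q' z) • b := by
        rw [← hgc, brAt_smul_right, hG, smul_smul, smul_smul, smul_smul,
          show f' * g * f * g.comp (X + C z) = (g * f * g.comp (X + C z)) * f' by ring, mul_smul,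
          hq', smul_smul]
        ring_nf
      have e3 := e1.symm.trans e2
      have e4 : (f' * (g * valAt q z) - f * valAt G z * valAt q' z) • b = 0 := by
        rw [sub_smul, e3, sub_self]
      have e5 : f' * (g * valAt q z) - f * valAt G z * valAt q' z = 0 := by
        by_contra h6
        exact hb0 (h.torsion i b hb _ h6 e4)
      have e6 := congrArg (eval t) e5
      simp only [eval_sub, eval_mul, eval_valAt, eval_zero] at e6
      rw [evalEval_mul, evalEval_mul, evalEval_mul, evalEval_C, evalEval_C, eval_mul]
      linear_combination e6
    have hGdeg : G.natDegree = g.natDegree := by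
      have hh : G = (g.map C).comp (X + C X) := by
        simp only [G, comp, eval₂_map, aeval_def]
        rw [add_comm (C X) (X : ℂ[X][X])]
        rfl
      rw [hh, natDegree_comp, natDegree_X_add_C, mul_one, natDegree_map_eq_of_injective
        C_injective]
    have hG0 : G ≠ 0 := by
      intro h0
      have h1 := hG 0
      rw [h0] at h1
      simp at h1
      exact hg0 h1.symm
    have hdeg := congrArg natDegree heq
    rw [natDegree_C_mul (mul_ne_zero hf' hg0), natDegree_C_mul hf, natDegree_mul hG0 hq'0, hGdeg,
      hd] at hdeg
    omega
  have hbasis : IsBasis (𝒢 i) b := by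
    refine ⟨le_antisymm ((Submodule.span_singleton_le_iff_mem _ _).2 hb) fun c hc => ?_,
      fun f hf => by
        by_contra hf0
        exact hb0 (h.torsion i b hb f hf0 hf)⟩
    obtain ⟨f, g, hf, hfg⟩ := h.exists_smul_eq hc hb hb0
    -- With the common factor removed from `f c = g b`, a Bézout combination of `b` and `c` is a
    -- common divisor of both; indivisibility of `b` then makes `f'` a constant.
    obtain ⟨d, f', g', hd0, hcop, rfl, rfl⟩ : ∃ d f' g' : ℂ[X], d ≠ 0 ∧ IsCoprime f' g' ∧
        f = d * f' ∧ g = d * g' := by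
      classical
      obtain ⟨d, hd⟩ : ∃ d, d = EuclideanDomain.gcd f g := ⟨_, rfl⟩
      have hd0 : d ≠ 0 := by
        intro h0
        rw [h0] at hd
        exact hf (EuclideanDomain.gcd_eq_zero_iff.1 hd.symm).1
      obtain ⟨f', hf'⟩ := hd ▸ EuclideanDomain.gcd_dvd_left f g
      obtain ⟨g', hg'⟩ := hd ▸ EuclideanDomain.gcd_dvd_right f g
      refine ⟨d, f', g', hd0, ?_, hf', hg'⟩
      have hb := EuclideanDomain.gcd_eq_gcd_ab f g
      rw [← hd] at hb
      refine ⟨EuclideanDomain.gcdA f g, EuclideanDomain.gcdB f g, mul_left_cancel₀ hd0 ?_⟩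
      calc d * (EuclideanDomain.gcdA f g * f' + EuclideanDomain.gcdB f g * g')
          = (d * f') * EuclideanDomain.gcdA f g + (d * g') * EuclideanDomain.gcdB f g := by ring
        _ = d * 1 := by rw [← hf', ← hg', ← hb, mul_one]
    have h1 : f' • c = g' • b := by
      rw [← sub_eq_zero]
      refine h.torsion i _ (sub_mem (Submodule.smul_mem _ _ hc) (Submodule.smul_mem _ _ hb)) d hd0
        ?_
      rw [smul_sub, smul_smul, smul_smul, hfg, sub_self]
    obtain ⟨u, w, huw⟩ := hcop
    have h2 : f' • (u • b + w • c) = b := by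
      rw [smul_add, smul_smul, smul_smul, mul_comm f' w, mul_smul w, h1, smul_smul, ← add_smul,
        show f' * u + w * g' = 1 by rw [← huw]; ring, one_smul]
    have h3 : g' • (u • b + w • c) = c := by
      rw [smul_add, smul_smul, mul_comm g' u, mul_smul u, ← h1, smul_smul, smul_smul, ← add_smul,
        show u * f' + g' * w = 1 by rw [← huw]; ring, one_smul]
    have h4 := hdiv (u • b + w • c) f' (add_mem (Submodule.smul_mem _ _ hb)
      (Submodule.smul_mem _ _ hc)) h2
    rw [natDegree_eq_zero] at h4
    obtain ⟨κ, hκ⟩ := h4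
    have hκ0 : κ ≠ 0 := by
      rintro rfl
      rw [C_0] at hκ
      rw [← hκ, zero_smul] at h2
      exact hb0 h2.symm
    rw [Submodule.mem_span_singleton]
    refine ⟨g' * C κ⁻¹, ?_⟩
    rw [← h2, ← hκ, smul_smul, mul_assoc, ← C_mul, inv_mul_cancel₀ hκ0, C_1, mul_one, h3]
  obtain ⟨q, hq⟩ := exists_brAt_eq (a := L) (b := b) (v := b) fun z => by
    rw [hbasis.1]
    simpa using h.grading.brAt_mem hL0 hb z
  have hmod : ∀ t z w, q.evalEval (t + z) w * q.evalEval t z -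
      q.evalEval (t + w) z * q.evalEval t w = (z - w) * q.evalEval t (z + w) := by
    intro t z w
    have h1 := IsVirasoro.brAt_brAt hL z w b
    simp only [hq, brAt_smul_right, smul_smul, ← C_smul_eq, ← add_smul] at h1
    have h2 := congrArg (eval t) (hbasis.smul_injective h1)
    simp only [eval_mul, eval_add, eval_comp, eval_X, eval_C] at h2
    change q.evalEval (t + z) w * q.evalEval t z =
      (z - w) * q.evalEval t (z + w) + q.evalEval (t + w) z * q.evalEval t w at h2
    linear_combination h2
  obtain ⟨α, δ, hαδ⟩ := linear_of_module_equation hmod (by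
    rintro rfl
    obtain ⟨z, hz⟩ := hact b hb hb0
    rw [hq] at hz
    simp at hz)
  refine ⟨b, α, δ, hbasis, fun z => ?_⟩
  rw [hq]
  congr 1
  refine Polynomial.funext fun t => ?_
  rw [eval_valAt, hαδ, eval_add, eval_X, eval_C]
  ring

end Graded

/-! ### Generators of all components and their equivariant structure polynomials. -/

section Frame

variable {A : Type*} [AddCommGroup A] [Module ℂ A] [Module ℂ[X] A] [IsScalarTower ℂ ℂ[X] A]
  [LieConformalAlgebra A] {𝒢 : ℤ → Submodule ℂ[X] A}

theorem equivariant_of_brAt {L a b c : A} {α Δ α' Δ' α'' Δ'' : ℂ} {p : ℂ[X][X]}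
    (ha : ∀ z, brAt z L a = (X + C (α + Δ * z)) • a)
    (hb : ∀ z, brAt z L b = (X + C (α' + Δ' * z)) • b)
    (hc : ∀ z, brAt z L c = (X + C (α'' + Δ'' * z)) • c)
    (hfree : ∀ f : ℂ[X], f • c = 0 → f = 0) (hp : ∀ z, brAt z a b = valAt p z • c) :
    Equivariant p α Δ α' Δ' α'' Δ'' := by
  intro t z w
  have h1 := brAt_jacobi z w L a b
  rw [ha, hb, hp, brAt_smul_right, hc, brAt_smul_left, brAt_smul_right, hp, hp, smul_smul,
    smul_smul, smul_smul, ← add_smul, ← sub_eq_zero, ← sub_smul] at h1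
  have h2 := congrArg (eval t) (hfree _ h1)
  simp only [eval_mul, eval_add, eval_comp, eval_X, eval_C, eval_sub, eval_zero, eval_valAt] at h2
  linear_combination h2

/-- An element of a component of a simple graded algebra vanishes if the Virasoro element acts
trivially on it. -/
theorem eq_zero_of_brAt_eq_zero (h : IsThin 𝒢) (hs : IsGradedSimple 𝒢) {L : A}
    (hL0 : IsBasis (𝒢 0) L) (hL : ∀ z, brAt z L L = (X + C (2 * z)) • L) {i : ℤ} {a : A}
    (ha : a ∈ 𝒢 i) (hLa : ∀ z, brAt z L a = 0) : a = 0 := by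
  let J : ℤ → Submodule ℂ[X] A := fun i =>
    { carrier := {a | a ∈ 𝒢 i ∧ ∀ z, brAt z L a = 0}
      add_mem' := fun ⟨hx, hx'⟩ ⟨hy, hy'⟩ =>
        ⟨add_mem hx hy, fun z => by rw [brAt_add_right, hx', hy', add_zero]⟩
      zero_mem' := ⟨zero_mem _, fun z => brAt_zero_right _ _⟩
      smul_mem' := fun f x ⟨hx, hx'⟩ =>
        ⟨Submodule.smul_mem _ _ hx, fun z => by rw [brAt_smul_right, hx', smul_zero]⟩ }
  have hJ0 : J 0 = ⊥ := by
    rw [eq_bot_iff]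
    rintro x ⟨hx, hx'⟩
    obtain ⟨f, rfl⟩ := hL0.exists_smul_eq hx
    have h1 := hx' 0
    rw [brAt_smul_right, hL, smul_smul] at h1
    have h2 := hL0.2 _ h1
    simp at h2
    rw [h2, zero_smul]
    exact zero_mem _
  have h0 : 𝒢 0 ≠ ⊥ := fun h => hL0.ne_zero ((Submodule.mem_bot _).1 (h ▸ hL0.mem))
  have h1 := eq_bot_of_stable h.grading hs h0 (J := J) (fun i x hx => hx.1)
    (fun i j a b z ha hb => by
      -- If `L` acts trivially on `𝒢 i`, stability is immediate from Jacobi. Otherwise `𝒢 i` has a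
      -- primary generator `n`, and `[n_w b]` itself is shown to vanish.
      by_cases htriv : ∀ c ∈ 𝒢 i, ∀ z, brAt z L c = 0
      · refine ⟨h.grading.brAt_mem ha hb.1 z, fun w => ?_⟩
        rw [brAt_jacobi, htriv a ha, hb.2, brAt_zero_left, brAt_zero_right, add_zero]
      · push Not at htriv
        obtain ⟨c, hc, hc'⟩ := htriv
        obtain ⟨n, α, δ, hn⟩ := exists_primary h hL0.mem hL hc hc'
        have hzero : ∀ w, brAt w n b = 0 := by
          have hsub : ∀ w ∈ ({α}ᶜ : Set ℂ), brAt w n b = 0 := by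
            intro w hw
            -- At `λ = 0`, `[n_w b]` is an eigenvector of `L` with constant eigenvalue `α - w`. On a
            -- component with trivial action this forces vanishing for `w ≠ α`; on a primary
            -- component `L` acts as multiplication by `∂ + α'`, which has no constant eigenvalue.
            have h3 : brAt 0 L (brAt w n b) = (C (α - w) : ℂ[X]) • brAt w n b := by
              rw [brAt_jacobi, hb.2, hn.brAt_eq, brAt_smul_left, brAt_zero_right, add_zero]
              simp
              ring_nf
            have hmem := h.grading.brAt_mem hn.basis.mem hb.1 w
            by_cases ht : ∀ z, brAt z L (brAt w n b) = 0
            · rw [ht, C_smul_eq] at h3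
              exact (smul_eq_zero.1 h3.symm).resolve_left (sub_ne_zero.2 (Ne.symm hw))
            · push Not at ht
              obtain ⟨n', α', δ', hn'⟩ := exists_primary h hL0.mem hL hmem ht
              obtain ⟨f, hf⟩ := hn'.basis.exists_smul_eq hmem
              rw [← hf, brAt_smul_right, hn'.brAt_eq, smul_smul, smul_smul] at h3
              have h4 := hn'.basis.smul_injective h3
              simp only [C_0, add_zero, comp_X, mul_zero] at h4
              have h5 : f * (X + C (α' - (α - w))) = 0 := by
                rw [C_sub]
                linear_combination h4
              rw [← hf, (mul_eq_zero.1 h5).resolve_right (X_add_C_ne_zero _), zero_smul]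
          exact brAt_eq_zero_of_infinite (Set.finite_singleton α).infinite_compl hsub
        obtain ⟨g, rfl⟩ := hn.basis.exists_smul_eq ha
        rw [brAt_smul_left, hzero, smul_zero]
        exact zero_mem _) hJ0 i
  have h2 : a ∈ J i := ⟨ha, hLa⟩
  rw [h1] at h2
  exact (Submodule.mem_bot _).1 h2

/-- Generators `N i` of all components, with the action of the Virasoro element and the structure
polynomials. -/
structure Frame (𝒢 : ℤ → Submodule ℂ[X] A) (L : A) where
  /-- The generator of `𝒢 i`, zero if `𝒢 i = 0`. -/
  gen : ℤ → A
  /-- The scalar `α` in `[L_λ n] = (∂ + α + δλ)n`. -/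
  shift : ℤ → ℂ
  /-- The conformal weight `δ` in `[L_λ n] = (∂ + α + δλ)n`. -/
  weight : ℤ → ℂ
  /-- The structure polynomials. -/
  str : ℤ → ℤ → ℂ[X][X]
  thin : IsThin 𝒢
  span_gen : ∀ i, Submodule.span ℂ[X] {gen i} = 𝒢 i
  free : ∀ i, gen i ≠ 0 → ∀ f : ℂ[X], f • gen i = 0 → f = 0
  brAt_virasoro : ∀ i z, brAt z L (gen i) = (X + C (shift i + weight i * z)) • gen i
  brAt_gen : ∀ i j z, brAt z (gen i) (gen j) = valAt (str i j) z • gen (i + j)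
  gen_zero : gen 0 = L
  gen_zero_ne : gen 0 ≠ 0
  shift_zero : shift 0 = 0
  weight_zero : weight 0 = 2

theorem exists_frame (h : IsThin 𝒢) (hs : IsGradedSimple 𝒢) {L : A}
    (hL0 : IsBasis (𝒢 0) L) (hL : ∀ z, brAt z L L = (X + C (2 * z)) • L) :
    Nonempty (Frame 𝒢 L) := by
  have h1 : ∀ i, ∃ (n : A) (α δ : ℂ), Submodule.span ℂ[X] {n} = 𝒢 i ∧
      (n ≠ 0 → ∀ f : ℂ[X], f • n = 0 → f = 0) ∧
      (∀ z, brAt z L n = (X + C (α + δ * z)) • n) ∧ (i = 0 → n = L ∧ α = 0 ∧ δ = 2) := by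
    intro i
    by_cases hi : i = 0
    · subst hi
      exact ⟨L, 0, 2, hL0.1, fun _ => hL0.2, fun z => by rw [hL, zero_add],
        fun _ => ⟨rfl, rfl, rfl⟩⟩
    by_cases hbot : 𝒢 i = ⊥
    · exact ⟨0, 0, 0, by rw [hbot, Submodule.span_zero_singleton], fun h => absurd rfl h,
        fun z => by simp, fun h => absurd h hi⟩
    · obtain ⟨a, ha, ha0⟩ := Submodule.exists_mem_ne_zero_of_ne_bot hbot
      have hne : ∃ z, brAt z L a ≠ 0 := by
        by_contra! hall
        exact ha0 (eq_zero_of_brAt_eq_zero h hs hL0 hL ha hall)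
      obtain ⟨n, α, δ, hn⟩ := exists_primary h hL0.mem hL ha hne
      exact ⟨n, α, δ, hn.basis.1, fun _ => hn.basis.2, hn.brAt_eq, fun h => absurd h hi⟩
  choose n α δ hspan hfree hact hzero using h1
  have h2 : ∀ i j, ∃ p : ℂ[X][X], ∀ z, brAt z (n i) (n j) = valAt p z • n (i + j) := fun i j =>
    exists_brAt_eq fun z => by
      rw [hspan]
      refine h.grading.brAt_mem ?_ ?_ z
      · rw [← hspan]; exact Submodule.mem_span_singleton_self _
      · rw [← hspan]; exact Submodule.mem_span_singleton_self _
  choose p hp using h2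
  exact ⟨⟨n, α, δ, p, h, hspan, hfree, hact, hp, (hzero 0 rfl).1,
    (hzero 0 rfl).1 ▸ hL0.ne_zero, (hzero 0 rfl).2.1, (hzero 0 rfl).2.2⟩⟩

namespace Frame

variable {L : A} (F : Frame 𝒢 L)

theorem gen_mem (i : ℤ) : F.gen i ∈ 𝒢 i := by
  rw [← F.span_gen]
  exact Submodule.mem_span_singleton_self _

theorem exists_smul_eq {i : ℤ} {a : A} (ha : a ∈ 𝒢 i) : ∃ f : ℂ[X], f • F.gen i = a := by
  rw [← F.span_gen] at ha
  exact Submodule.mem_span_singleton.1 ha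

theorem gen_ne_zero {i : ℤ} {a : A} (ha : a ∈ 𝒢 i) (h : a ≠ 0) : F.gen i ≠ 0 := by
  intro h0
  obtain ⟨f, rfl⟩ := F.exists_smul_eq ha
  exact h (by rw [h0, smul_zero])

theorem isBasis {i : ℤ} (h : F.gen i ≠ 0) : IsBasis (𝒢 i) (F.gen i) := ⟨F.span_gen i, F.free i h⟩

theorem equivariant (i j : ℤ) (h : F.gen (i + j) ≠ 0) :
    Equivariant (F.str i j) (F.shift i) (F.weight i) (F.shift j) (F.weight j) (F.shift (i + j))
      (F.weight (i + j)) :=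
  equivariant_of_brAt (F.brAt_virasoro i) (F.brAt_virasoro j) (F.brAt_virasoro (i + j))
    (F.free _ h) (F.brAt_gen i j)

end Frame

end Frame

/-! ### Passing from values to coefficients for pairs of polynomials. -/

section PairCoeff

variable {A : Type*} [AddCommGroup A] [Module ℂ A] [Module ℂ[X] A] [IsScalarTower ℂ ℂ[X] A]
variable {B : Type*} [AddCommGroup B] [Module ℂ B] [Module ℂ[X] B] [IsScalarTower ℂ ℂ[X] B]

/-- The two polynomials are combined into one with coefficients in `A × B`, so that the criterion
for a single polynomial applies. -/
theorem coeff_pair_mem {R : Submodule ℂ[X] (A × B)} {P : PolynomialModule ℂ[X] A}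
    {Q : PolynomialModule ℂ[X] B}
    (h : ∀ z : ℂ, (PolynomialModule.eval (C z : ℂ[X]) P, PolynomialModule.eval (C z : ℂ[X]) Q) ∈ R)
    (n : ℕ) : (P.coeff n, Q.coeff n) ∈ R := by
  let W : PolynomialModule ℂ[X] (A × B) :=
    PolynomialModule.map ℂ[X] (LinearMap.inl ℂ[X] A B) P +
      PolynomialModule.map ℂ[X] (LinearMap.inr ℂ[X] A B) Q
  have h1 : ∀ z : ℂ, PolynomialModule.eval (C z : ℂ[X]) W =
      (PolynomialModule.eval (C z : ℂ[X]) P, PolynomialModule.eval (C z : ℂ[X]) Q) := by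
    intro z
    have e1 := PolynomialModule.eval_map (R' := ℂ[X]) (LinearMap.inl ℂ[X] A B) P (C z)
    have e2 := PolynomialModule.eval_map (R' := ℂ[X]) (LinearMap.inr ℂ[X] A B) Q (C z)
    rw [Algebra.algebraMap_self, RingHom.id_apply] at e1 e2
    rw [map_add, e1, e2]
    simp
  have h2 : W.coeff n = (P.coeff n, Q.coeff n) := by
    simp [W, PolynomialModule.map]
  rw [← h2]
  refine coeff_mem_of_eval_mem (N := R.restrictScalars ℂ) Set.infinite_univ (fun z _ => ?_) n
  rw [h1]
  exact h z

end PairCoeff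

section Pair

variable {A : Type*} [AddCommGroup A] [Module ℂ A] [Module ℂ[X] A] [IsScalarTower ℂ ℂ[X] A]
  [LieConformalAlgebra A]
variable {B : Type*} [AddCommGroup B] [Module ℂ B] [Module ℂ[X] B] [IsScalarTower ℂ ℂ[X] B]
  [LieConformalAlgebra B]

/-! ### The algebra generated by a local part in a product -/

/-- The componentwise bracket on `A × B` at `λ = z`. -/
def pairBr (z : ℂ) (u v : A × B) : A × B := (brAt z u.1 v.1, brAt z u.2 v.2)

theorem pairBr_add_left (z : ℂ) (u u' v : A × B) :
    pairBr z (u + u') v = pairBr z u v + pairBr z u' v :=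
  Prod.ext (brAt_add_left _ _ _ _) (brAt_add_left _ _ _ _)

theorem pairBr_add_right (z : ℂ) (u v v' : A × B) :
    pairBr z u (v + v') = pairBr z u v + pairBr z u v' :=
  Prod.ext (brAt_add_right _ _ _ _) (brAt_add_right _ _ _ _)

theorem pairBr_zero_left (z : ℂ) (v : A × B) : pairBr z 0 v = 0 :=
  Prod.ext (brAt_zero_left _ _) (brAt_zero_left _ _)

theorem pairBr_zero_right (z : ℂ) (u : A × B) : pairBr z u 0 = 0 :=
  Prod.ext (brAt_zero_right _ _) (brAt_zero_right _ _)

theorem pairBr_smul_left (z : ℂ) (f : ℂ[X]) (u v : A × B) :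
    pairBr z (f • u) v = (C (f.eval (-z)) : ℂ[X]) • pairBr z u v :=
  Prod.ext (brAt_smul_left _ _ _ _) (brAt_smul_left _ _ _ _)

theorem pairBr_smul_right (z : ℂ) (f : ℂ[X]) (u v : A × B) :
    pairBr z u (f • v) = f.comp (X + C z) • pairBr z u v :=
  Prod.ext (brAt_smul_right _ _ _ _) (brAt_smul_right _ _ _ _)

theorem pairBr_jacobi (z w : ℂ) (a b c : A × B) :
    pairBr z a (pairBr w b c) = pairBr (z + w) (pairBr z a b) c + pairBr w b (pairBr z a c) :=
  Prod.ext (brAt_jacobi _ _ _ _ _) (brAt_jacobi _ _ _ _ _)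

theorem pairBr_pairBr_left (z w : ℂ) (a b c : A × B) :
    pairBr w (pairBr z a b) c =
      pairBr z a (pairBr (w - z) b c) - pairBr (w - z) b (pairBr z a c) :=
  Prod.ext (brAt_brAt_left _ _ _ _ _) (brAt_brAt_left _ _ _ _ _)

theorem pairBr_mem_of_span_right {S : Set (A × B)} {P : Submodule ℂ[X] (A × B)} {z : ℂ}
    {u v : A × B} (h : ∀ v ∈ S, pairBr z u v ∈ P) (hv : v ∈ Submodule.span ℂ[X] S) :
    pairBr z u v ∈ P := by
  induction hv using Submodule.span_induction with
  | mem v hv => exact h v hv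
  | zero => rw [pairBr_zero_right]; exact zero_mem _
  | add v w _ _ hv hw => rw [pairBr_add_right]; exact add_mem hv hw
  | smul f v _ hv => rw [pairBr_smul_right]; exact Submodule.smul_mem _ _ hv

theorem pairBr_mem_of_span_left {S : Set (A × B)} {P : Submodule ℂ[X] (A × B)} {z : ℂ}
    {u v : A × B} (h : ∀ u ∈ S, pairBr z u v ∈ P) (hu : u ∈ Submodule.span ℂ[X] S) :
    pairBr z u v ∈ P := by
  induction hu using Submodule.span_induction with
  | mem v hv => exact h v hv
  | zero => rw [pairBr_zero_left]; exact zero_mem _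
  | add v w _ _ hv hw => rw [pairBr_add_left]; exact add_mem hv hw
  | smul f v _ hv => rw [pairBr_smul_left]; exact Submodule.smul_mem _ _ hv

/-- The span of the iterated brackets of `n + 1` factors `x`. -/
def up (x : A × B) : ℕ → Submodule ℂ[X] (A × B)
  | 0 => Submodule.span ℂ[X] {x}
  | n + 1 => Submodule.span ℂ[X] {v | ∃ z, ∃ u ∈ up x n, v = pairBr z x u}

theorem pairBr_mem_up {x u : A × B} {n : ℕ} (hu : u ∈ up x n) (z : ℂ) :
    pairBr z x u ∈ up x (n + 1) := Submodule.subset_span ⟨z, u, hu, rfl⟩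

/-- Elements `t`, `x`, `y` whose spans form the components of degree `0`, `1`, `-1` of a local
subalgebra. -/
structure IsLocalPart (t x y : A × B) : Prop where
  tt : ∀ z, pairBr z t t ∈ Submodule.span ℂ[X] {t}
  tx : ∀ z, pairBr z t x ∈ Submodule.span ℂ[X] {x}
  ty : ∀ z, pairBr z t y ∈ Submodule.span ℂ[X] {y}
  xt : ∀ z, pairBr z x t ∈ Submodule.span ℂ[X] {x}
  yt : ∀ z, pairBr z y t ∈ Submodule.span ℂ[X] {y}
  xy : ∀ z, pairBr z x y ∈ Submodule.span ℂ[X] {t}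
  yx : ∀ z, pairBr z y x ∈ Submodule.span ℂ[X] {t}

variable {t x y : A × B}

theorem IsLocalPart.swap (h : IsLocalPart t x y) : IsLocalPart t y x :=
  ⟨h.tt, h.ty, h.tx, h.yt, h.xt, h.yx, h.xy⟩

theorem IsLocalPart.t_up (h : IsLocalPart t x y) {n : ℕ} {u : A × B} (hu : u ∈ up x n) (z : ℂ) :
    pairBr z t u ∈ up x n := by
  induction n generalizing u z with
  | zero =>
    refine pairBr_mem_of_span_right ?_ hu
    rintro _ rfl
    exact h.tx z
  | succ n ih =>
    refine pairBr_mem_of_span_right ?_ hu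
    rintro _ ⟨w, v, hv, rfl⟩
    rw [pairBr_jacobi]
    refine add_mem ?_ (pairBr_mem_up (ih hv z) w)
    refine pairBr_mem_of_span_left ?_ (h.tx z)
    rintro _ rfl
    exact pairBr_mem_up hv _

theorem IsLocalPart.y_up_zero (h : IsLocalPart t x y) {u : A × B} (hu : u ∈ up x 0) (z : ℂ) :
    pairBr z y u ∈ Submodule.span ℂ[X] {t} := by
  refine pairBr_mem_of_span_right ?_ hu
  rintro _ rfl
  exact h.yx z

/-- Jacobi moves `y` past the outermost `x`; the commutator is a multiple of `t`, which preserves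
every level. Thus products of `x` alone exhaust the positive part, with no mixed words. -/
theorem IsLocalPart.y_up_succ (h : IsLocalPart t x y) {n : ℕ} {u : A × B} (hu : u ∈ up x (n + 1))
    (z : ℂ) : pairBr z y u ∈ up x n := by
  induction n generalizing u z with
  | zero =>
    refine pairBr_mem_of_span_right ?_ hu
    rintro _ ⟨w, v, hv, rfl⟩
    rw [pairBr_jacobi]
    refine add_mem ?_ ?_
    · refine pairBr_mem_of_span_left ?_ (h.yx z)
      rintro _ rfl
      exact h.t_up hv _
    · refine pairBr_mem_of_span_right ?_ (h.y_up_zero hv z)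
      rintro _ rfl
      exact h.xt w
  | succ n ih =>
    refine pairBr_mem_of_span_right ?_ hu
    rintro _ ⟨w, v, hv, rfl⟩
    rw [pairBr_jacobi]
    refine add_mem ?_ (pairBr_mem_up (ih hv z) w)
    refine pairBr_mem_of_span_left ?_ (h.yx z)
    rintro _ rfl
    exact h.t_up hv _

/-- The homogeneous components of the subalgebra generated by a local part. -/
def diag (t x y : A × B) : ℤ → Submodule ℂ[X] (A × B)
  | 0 => Submodule.span ℂ[X] {t}
  | (n + 1 : ℕ) => up x n
  | Int.negSucc n => up y n

theorem diag_succ (n : ℕ) : diag t x y ((n : ℤ) + 1) = up x n := rfl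

theorem diag_neg (n : ℕ) : diag t x y (-((n : ℤ) + 1)) = up y n := by
  rw [← Int.negSucc_eq]
  rfl

theorem diag_induction {P : ℤ → Prop} (i : ℤ) (h0 : P 0) (hp : ∀ n : ℕ, P ((n : ℤ) + 1))
    (hn : ∀ n : ℕ, P (-((n : ℤ) + 1))) : P i := by
  rcases lt_trichotomy i 0 with h | h | h
  · obtain ⟨n, hn'⟩ : ∃ n : ℕ, i = -((n : ℤ) + 1) := ⟨(-i - 1).toNat, by omega⟩
    rw [hn']; exact hn n
  · rw [h]; exact h0
  · obtain ⟨n, hn'⟩ : ∃ n : ℕ, i = (n : ℤ) + 1 := ⟨(i - 1).toNat, by omega⟩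
    rw [hn']; exact hp n

theorem diag_swap (i : ℤ) : diag t y x i = diag t x y (-i) := by
  induction i using diag_induction with
  | h0 => rfl
  | hp n => rw [diag_succ, diag_neg]
  | hn n => rw [diag_neg, neg_neg, diag_succ]

theorem IsLocalPart.t_mem (h : IsLocalPart t x y) (j : ℤ) {v : A × B} (hv : v ∈ diag t x y j)
    (z : ℂ) : pairBr z t v ∈ diag t x y j := by
  induction j using diag_induction with
  | h0 =>
    refine pairBr_mem_of_span_right ?_ hv
    rintro _ rfl
    exact h.tt z
  | hp n =>
    rw [diag_succ] at hv ⊢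
    exact h.t_up hv z
  | hn n =>
    rw [diag_neg] at hv ⊢
    exact h.swap.t_up hv z

theorem IsLocalPart.x_mem (h : IsLocalPart t x y) (j : ℤ) {v : A × B} (hv : v ∈ diag t x y j)
    (z : ℂ) : pairBr z x v ∈ diag t x y (1 + j) := by
  induction j using diag_induction with
  | h0 =>
    refine pairBr_mem_of_span_right ?_ hv
    rintro _ rfl
    exact h.xt z
  | hp n =>
    rw [diag_succ] at hv
    rw [show 1 + ((n : ℤ) + 1) = ((n + 1 : ℕ) : ℤ) + 1 by push_cast; ring, diag_succ]
    exact pairBr_mem_up hv z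
  | hn n =>
    rw [diag_neg] at hv
    rcases n with _ | n
    · exact h.swap.y_up_zero hv z
    · rw [show 1 + -(((n + 1 : ℕ) : ℤ) + 1) = -((n : ℤ) + 1) by push_cast; ring, diag_neg]
      exact h.swap.y_up_succ hv z

/-- Jacobi rewrites bracketing with `[x c]` through bracketing with `x` and with the shorter `c`, so
induction reduces to `x_mem`. -/
theorem IsLocalPart.up_mem (h : IsLocalPart t x y) {n : ℕ} {u : A × B} (hu : u ∈ up x n) (j : ℤ)
    {v : A × B} (hv : v ∈ diag t x y j) (z : ℂ) :
    pairBr z u v ∈ diag t x y ((n : ℤ) + 1 + j) := by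
  induction n generalizing u j v z with
  | zero =>
    refine pairBr_mem_of_span_left ?_ hu
    rintro _ rfl
    simpa using h.x_mem j hv z
  | succ n ih =>
    refine pairBr_mem_of_span_left ?_ hu
    rintro _ ⟨w, c, hc, rfl⟩
    rw [pairBr_pairBr_left]
    have h1 := h.x_mem _ (ih hc j hv (z - w)) w
    have h2 := ih hc _ (h.x_mem j hv w) (z - w)
    rw [show 1 + ((n : ℤ) + 1 + j) = ((n + 1 : ℕ) : ℤ) + 1 + j by push_cast; ring] at h1
    rw [show (n : ℤ) + 1 + (1 + j) = ((n + 1 : ℕ) : ℤ) + 1 + j by push_cast; ring] at h2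
    exact sub_mem h1 h2

theorem IsLocalPart.pairBr_mem (h : IsLocalPart t x y) {i j : ℤ} {u v : A × B}
    (hu : u ∈ diag t x y i) (hv : v ∈ diag t x y j) (z : ℂ) :
    pairBr z u v ∈ diag t x y (i + j) := by
  induction i using diag_induction with
  | h0 =>
    refine pairBr_mem_of_span_left ?_ hu
    rintro _ rfl
    rw [zero_add]
    exact h.t_mem j hv z
  | hp n =>
    rw [diag_succ] at hu
    exact h.up_mem hu j hv z
  | hn n =>
    rw [diag_neg] at hu
    have h1 : v ∈ diag t y x (-j) := by rwa [diag_swap, neg_neg]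
    have h2 := h.swap.up_mem hu (-j) h1 z
    rw [diag_swap] at h2
    rwa [show -((n : ℤ) + 1) + j = -((n : ℤ) + 1 + -j) by ring]

theorem IsLocalPart.iSup_closed (h : IsLocalPart t x y) {u v : A × B}
    (hu : u ∈ ⨆ i, diag t x y i) (hv : v ∈ ⨆ i, diag t x y i) (z : ℂ) :
    pairBr z u v ∈ ⨆ i, diag t x y i := by
  induction hu using Submodule.iSup_induction' with
  | zero => rw [pairBr_zero_left]; exact zero_mem _
  | add a b _ _ ha hb => rw [pairBr_add_left]; exact add_mem ha hb
  | mem i a ha =>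
    induction hv using Submodule.iSup_induction' with
    | zero => rw [pairBr_zero_right]; exact zero_mem _
    | add a b _ _ ha hb => rw [pairBr_add_right]; exact add_mem ha hb
    | mem j b hb => exact Submodule.mem_iSup_of_mem (i + j) (h.pairBr_mem ha hb z)

theorem mem_diag_one : x ∈ diag t x y 1 := Submodule.mem_span_singleton_self x

theorem mem_diag_neg_one : y ∈ diag t x y (-1) := Submodule.mem_span_singleton_self y

/-- A property of pairs of homogeneous elements which holds for `t`, `x`, `y` and is inherited by
brackets holds on all components. -/
theorem diag_le {P : ℤ → Submodule ℂ[X] (A × B)} (ht : t ∈ P 0) (hx : x ∈ P 1) (hy : y ∈ P (-1))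
    (hx' : ∀ j v z, v ∈ P j → pairBr z x v ∈ P (1 + j))
    (hy' : ∀ j v z, v ∈ P j → pairBr z y v ∈ P (-1 + j)) (i : ℤ) : diag t x y i ≤ P i := by
  induction i using diag_induction with
  | h0 => exact (Submodule.span_singleton_le_iff_mem _ _).2 ht
  | hp n =>
    rw [diag_succ]
    induction n with
    | zero => exact (Submodule.span_singleton_le_iff_mem _ _).2 hx
    | succ n ih =>
      refine Submodule.span_le.2 ?_
      rintro _ ⟨z, u, hu, rfl⟩
      rw [show (((n + 1 : ℕ) : ℤ) + 1) = 1 + ((n : ℤ) + 1) by push_cast; ring]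
      exact hx' _ _ _ (ih hu)
  | hn n =>
    rw [diag_neg]
    induction n with
    | zero => exact (Submodule.span_singleton_le_iff_mem _ _).2 hy
    | succ n ih =>
      refine Submodule.span_le.2 ?_
      rintro _ ⟨z, u, hu, rfl⟩
      rw [show -(((n + 1 : ℕ) : ℤ) + 1) = -1 + -((n : ℤ) + 1) by push_cast; ring]
      exact hy' _ _ _ (ih hu)

/-! ### Isomorphisms from graphs -/

/-- A submodule of `A × B` closed under the brackets which is the graph of a bijection between two
subalgebras is the graph of an isomorphism. -/
theorem Subalgebra.Iso.of_graph {S : Subalgebra A} {T : Subalgebra B}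
    {R : Submodule ℂ[X] (A × B)} (hR : ∀ u ∈ R, ∀ v ∈ R, ∀ z, pairBr z u v ∈ R)
    (hS : R.map (LinearMap.fst ℂ[X] A B) = S.toSubmodule)
    (hT : R.map (LinearMap.snd ℂ[X] A B) = T.toSubmodule)
    (h1 : ∀ a, (a, (0 : B)) ∈ R → a = 0) (h2 : ∀ b, ((0 : A), b) ∈ R → b = 0) : S.Iso T := by
  have hfst : ∀ u ∈ R, u.1 ∈ S.toSubmodule := fun u hu => hS ▸ ⟨u, hu, rfl⟩
  have hsnd : ∀ u ∈ R, u.2 ∈ T.toSubmodule := fun u hu => hT ▸ ⟨u, hu, rfl⟩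
  let f : R →ₗ[ℂ[X]] S.toSubmodule := (LinearMap.fst ℂ[X] A B).restrict hfst
  let g : R →ₗ[ℂ[X]] T.toSubmodule := (LinearMap.snd ℂ[X] A B).restrict hsnd
  have hf : Function.Bijective f := by
    constructor
    · rw [injective_iff_map_eq_zero]
      rintro ⟨⟨a, b⟩, hu⟩ h0
      obtain rfl : a = 0 := congrArg Subtype.val h0
      obtain rfl := h2 b hu
      rfl
    · rintro ⟨a, ha⟩
      rw [← hS] at ha
      obtain ⟨u, hu, rfl⟩ := ha
      exact ⟨⟨u, hu⟩, rfl⟩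
  have hg : Function.Bijective g := by
    constructor
    · rw [injective_iff_map_eq_zero]
      rintro ⟨⟨a, b⟩, hu⟩ h0
      obtain rfl : b = 0 := congrArg Subtype.val h0
      obtain rfl := h1 a hu
      rfl
    · rintro ⟨a, ha⟩
      rw [← hT] at ha
      obtain ⟨u, hu, rfl⟩ := ha
      exact ⟨⟨u, hu⟩, rfl⟩
  let e := (LinearEquiv.ofBijective f hf).symm.trans (LinearEquiv.ofBijective g hg)
  have he : ∀ (u : R), e (f u) = g u := by
    intro u
    have : (LinearEquiv.ofBijective f hf).symm (f u) = u :=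
      (LinearEquiv.ofBijective f hf).symm_apply_apply u
    simp only [e, LinearEquiv.trans_apply, this]
    rfl
  refine ⟨e, fun a b n => ?_⟩
  obtain ⟨u, rfl⟩ := hf.2 a
  obtain ⟨v, rfl⟩ := hf.2 b
  have hmem : ((bracket u.1.1 v.1.1).coeff n, (bracket u.1.2 v.1.2).coeff n) ∈ R :=
    coeff_pair_mem (fun z => hR u u.2 v v.2 z) n
  rw [he, he]
  have h3 := he ⟨_, hmem⟩
  exact congrArg Subtype.val h3

theorem Subalgebra.brAt_mem (S : Subalgebra A) {a b : A} (ha : a ∈ S.toSubmodule)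
    (hb : b ∈ S.toSubmodule) (z : ℂ) : brAt z a b ∈ S.toSubmodule :=
  eval_mem_of_coeff_mem (N := S.toSubmodule.restrictScalars ℂ) (S.bracket_mem a ha b hb) z

/-- A submodule closed under the brackets at all complex numbers is a subalgebra. -/
def Subalgebra.ofBrAt (N : Submodule ℂ[X] A) (h : ∀ a ∈ N, ∀ b ∈ N, ∀ z, brAt z a b ∈ N) :
    Subalgebra A where
  toSubmodule := N
  bracket_mem a ha b hb n := coeff_mem_of_eval_mem (N := N.restrictScalars ℂ) Set.infinite_univ
    (fun z _ => h a ha b hb z) n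

theorem diag_fst_le {S : Subalgebra A} (ht : t.1 ∈ S.toSubmodule) (hx : x.1 ∈ S.toSubmodule)
    (hy : y.1 ∈ S.toSubmodule) (i : ℤ) :
    diag t x y i ≤ S.toSubmodule.comap (LinearMap.fst ℂ[X] A B) :=
  diag_le (P := fun _ => S.toSubmodule.comap (LinearMap.fst ℂ[X] A B)) ht hx hy
    (fun _ _ _ hv => S.brAt_mem hx hv _) (fun _ _ _ hv => S.brAt_mem hy hv _) i

theorem diag_snd_le {S : Subalgebra B} (ht : t.2 ∈ S.toSubmodule) (hx : x.2 ∈ S.toSubmodule)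
    (hy : y.2 ∈ S.toSubmodule) (i : ℤ) :
    diag t x y i ≤ S.toSubmodule.comap (LinearMap.snd ℂ[X] A B) :=
  diag_le (P := fun _ => S.toSubmodule.comap (LinearMap.snd ℂ[X] A B)) ht hx hy
    (fun _ _ _ hv => S.brAt_mem hx hv _) (fun _ _ _ hv => S.brAt_mem hy hv _) i

/-- The first projection of the algebra generated by a local part is the subalgebra generated by
the components of degree `±1`, provided that it contains `t`. -/
theorem map_fst_iSup_diag (h : IsLocalPart t x y) {s : Set A}
    (ht : t.1 ∈ (Subalgebra.generatedBy s).toSubmodule)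
    (hx : x.1 ∈ s) (hy : y.1 ∈ s) (hs : s ⊆ Submodule.span ℂ[X] {x.1, y.1}) :
    (⨆ i, diag t x y i).map (LinearMap.fst ℂ[X] A B) =
      (Subalgebra.generatedBy s).toSubmodule := by
  have hsub : s ⊆ ((Subalgebra.generatedBy s).toSubmodule : Set A) := by
    intro a ha
    refine Submodule.mem_sInf.2 ?_
    rintro N ⟨_, _, hN⟩
    exact hN ha
  refine le_antisymm ?_ ?_
  · rw [Submodule.map_le_iff_le_comap]
    exact iSup_le (diag_fst_le ht (hsub hx) (hsub hy))
  · refine sInf_le ⟨Subalgebra.ofBrAt _ ?_, rfl, ?_⟩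
    · rintro _ ⟨u, hu, rfl⟩ _ ⟨v, hv, rfl⟩ z
      exact ⟨pairBr z u v, h.iSup_closed hu hv z, rfl⟩
    · refine hs.trans (Submodule.span_le.2 ?_)
      rintro _ (rfl | rfl)
      · exact ⟨x, Submodule.mem_iSup_of_mem 1 mem_diag_one, rfl⟩
      · exact ⟨y, Submodule.mem_iSup_of_mem (-1) mem_diag_neg_one, rfl⟩

end Pair

/-! ### Reducing statements about sums of components to single degrees. -/

section Independence

variable {A : Type*} [AddCommGroup A] [Module ℂ[X] A] {B : Type*} [AddCommGroup B] [Module ℂ[X] B]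

/-- Independence of a family of submodules, in terms of sums. -/
def SumInjective (𝒩 : ℤ → Submodule ℂ[X] A) : Prop :=
  ∀ f : ℤ →₀ A, (∀ i, f i ∈ 𝒩 i) → (f.sum fun _ a => a) = 0 → ∀ i, f i = 0

theorem SumInjective.of_iSupIndep {𝒩 : ℤ → Submodule ℂ[X] A} (h : iSupIndep 𝒩) :
    SumInjective 𝒩 := by
  intro f hf hsum i
  by_contra hi
  have h1 : f i = -∑ j ∈ f.support.erase i, f j := by
    rw [eq_neg_iff_add_eq_zero, Finset.add_sum_erase _ _ (Finsupp.mem_support_iff.2 hi)]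
    exact hsum
  have h2 : f i ∈ ⨆ (j) (_ : j ≠ i), 𝒩 j := by
    rw [h1]
    refine neg_mem (Submodule.sum_mem _ fun j hj => ?_)
    exact Submodule.mem_iSup_of_mem j
      (Submodule.mem_iSup_of_mem (Finset.ne_of_mem_erase hj) (hf j))
  exact hi ((Submodule.disjoint_def.1 (h i)) _ (hf i) h2)

/-- Independence on the side of the zero coordinate makes that coordinate vanish in each homogeneous
piece, so the hypothesis applies degree by degree. -/
theorem eq_zero_of_mem_iSup {𝒩 : ℤ → Submodule ℂ[X] A} {ℳ : ℤ → Submodule ℂ[X] B}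
    (hℳ : SumInjective ℳ) {D : ℤ → Submodule ℂ[X] (A × B)}
    (hD : ∀ i, D i ≤ (𝒩 i).prod (ℳ i)) (h0 : ∀ i a, (a, (0 : B)) ∈ D i → a = 0) {a : A}
    (ha : (a, (0 : B)) ∈ ⨆ i, D i) : a = 0 := by
  obtain ⟨f, hf, hsum⟩ := (Submodule.mem_iSup_iff_exists_finsupp _ _).1 ha
  have h1 : ∀ i, (f i).2 = 0 := by
    have := hℳ (f.mapRange Prod.snd rfl) (fun i => (hD i (hf i)).2) ?_
    · intro i
      simpa using this i
    · rw [Finsupp.sum_mapRange_index (fun _ => rfl)]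
      have h2 := congrArg Prod.snd hsum
      rw [Finsupp.sum, Prod.snd_sum] at h2
      exact h2
  have h2 : ∀ i, (f i).1 = 0 := fun i => h0 i _ (by
    have := hf i
    rwa [show f i = ((f i).1, (0 : B)) from Prod.ext rfl (h1 i)] at this)
  have h3 := congrArg Prod.fst hsum
  rw [Finsupp.sum, Prod.fst_sum] at h3
  exact h3.symm.trans (Finset.sum_eq_zero fun i _ => h2 i)

theorem eq_zero_of_mem_iSup' {𝒩 : ℤ → Submodule ℂ[X] A} {ℳ : ℤ → Submodule ℂ[X] B}
    (hℳ : SumInjective 𝒩) {D : ℤ → Submodule ℂ[X] (A × B)}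
    (hD : ∀ i, D i ≤ (𝒩 i).prod (ℳ i)) (h0 : ∀ i b, ((0 : A), b) ∈ D i → b = 0) {b : B}
    (hb : ((0 : A), b) ∈ ⨆ i, D i) : b = 0 := by
  obtain ⟨f, hf, hsum⟩ := (Submodule.mem_iSup_iff_exists_finsupp _ _).1 hb
  have h1 : ∀ i, (f i).1 = 0 := by
    have := hℳ (f.mapRange Prod.fst rfl) (fun i => (hD i (hf i)).1) ?_
    · intro i
      simpa using this i
    · rw [Finsupp.sum_mapRange_index (fun _ => rfl)]
      have h2 := congrArg Prod.fst hsum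
      rw [Finsupp.sum, Prod.fst_sum] at h2
      exact h2
  have h2 : ∀ i, (f i).2 = 0 := fun i => h0 i _ (by
    have := hf i
    rwa [show f i = ((0 : A), (f i).2) from Prod.ext (h1 i) rfl] at this)
  have h3 := congrArg Prod.snd hsum
  rw [Finsupp.sum, Prod.snd_sum] at h3
  exact h3.symm.trans (Finset.sum_eq_zero fun i _ => h2 i)

end Independence

/-! ### Local relations and the two kernels of the generated graph. -/

section LocalRelations

variable {A : Type*} [AddCommGroup A] [Module ℂ A] [Module ℂ[X] A] [IsScalarTower ℂ ℂ[X] A]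
  [LieConformalAlgebra A]
variable {B : Type*} [AddCommGroup B] [Module ℂ B] [Module ℂ[X] B] [IsScalarTower ℂ ℂ[X] B]
  [LieConformalAlgebra B]

/-- The polynomial `∂ + α + δλ`. -/
def linPoly (α δ : ℂ) : ℂ[X][X] := C X + C (C α) + C (C δ) * X

theorem valAt_linPoly (α δ z : ℂ) : valAt (linPoly α δ) z = X + C (α + δ * z) := by
  simp only [valAt, linPoly, eval_add, eval_mul, eval_C, eval_X, C_add, C_mul]
  ring

/-- The relations `[L_λ L] = (∂ + 2λ)L`, `[L_λ x] = (∂ + α + δλ)x`, `[L_λ y] = (∂ + α' + δ'λ)y`,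
`[x_λ y] = p(∂, λ)L`. -/
structure LocalRel (L x y : A) (α δ α' δ' : ℂ) (p : ℂ[X][X]) : Prop where
  LL : ∀ z, brAt z L L = valAt (linPoly 0 2) z • L
  Lx : ∀ z, brAt z L x = valAt (linPoly α δ) z • x
  Ly : ∀ z, brAt z L y = valAt (linPoly α' δ') z • y
  xy : ∀ z, brAt z x y = valAt p z • L

theorem LocalRel.isLocalPart {L x y : A} {L' x' y' : B} {α δ α' δ' : ℂ} {p : ℂ[X][X]}
    (h : LocalRel L x y α δ α' δ' p) (h' : LocalRel L' x' y' α δ α' δ' p) :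
    IsLocalPart (L, L') (x, x') (y, y') := by
  have key : ∀ (q : ℂ[X]) (u : A) (v : B),
      ((q • u, q • v) : A × B) ∈ Submodule.span ℂ[X] {((u, v) : A × B)} := fun q u v =>
    Submodule.mem_span_singleton.2 ⟨q, rfl⟩
  have key' : ∀ (q : ℂ[X]) (u : A) (v : B),
      ((-(q • u), -(q • v)) : A × B) ∈ Submodule.span ℂ[X] {((u, v) : A × B)} := fun q u v =>
    Submodule.mem_span_singleton.2 ⟨-q, Prod.ext (neg_smul _ _) (neg_smul _ _)⟩
  constructor <;> intro z <;> rw [pairBr]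
  · rw [h.LL, h'.LL]; exact key _ _ _
  · rw [h.Lx, h'.Lx]; exact key _ _ _
  · rw [h.Ly, h'.Ly]; exact key _ _ _
  · rw [brAt_skew h.Lx, brAt_skew h'.Lx]; exact key' _ _ _
  · rw [brAt_skew h.Ly, brAt_skew h'.Ly]; exact key' _ _ _
  · rw [h.xy, h'.xy]; exact key _ _ _
  · rw [brAt_skew h.xy, brAt_skew h'.xy]; exact key' _ _ _

/-- Applying `y` to `(0, b)` gives `(0, [y_w b])` one level lower, zero by induction; injectivity of
the lowering operators in `B` then gives `b = 0`. -/
theorem up_snd_eq_zero {t x y : A × B} (h : IsLocalPart t x y)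
    (hx : ∀ f : ℂ[X], f • x.1 = 0 → f = 0)
    (hlow : ∀ n, ∀ u ∈ up x (n + 1), (∀ w, brAt w y.2 u.2 = 0) → u.2 = 0) {n : ℕ} {b : B}
    (hb : ((0 : A), b) ∈ up x n) : b = 0 := by
  induction n generalizing b with
  | zero =>
    obtain ⟨f, hf⟩ := Submodule.mem_span_singleton.1 hb
    have h1 : f • x.1 = 0 := congrArg Prod.fst hf
    have h2 : f • x.2 = b := congrArg Prod.snd hf
    rw [← h2, hx f h1, zero_smul]
  | succ n ih =>
    refine hlow n _ hb fun w => ih ?_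
    have := h.y_up_succ hb w
    rwa [pairBr, brAt_zero_right] at this

/-- If `(c, d)` lies in the same degree with `d ≠ 0`, rank one gives `f a = g c`, and eliminating
the first coordinate leaves `(0, -g d)`. Hence `g = 0`, and torsion-freeness gives `a = 0`. -/
theorem fst_eq_zero_of_rank {𝒢 : ℤ → Submodule ℂ[X] A} (hthin : IsThin 𝒢)
    {D : Submodule ℂ[X] (A × B)} {j : ℤ} (hD : ∀ u ∈ D, u.1 ∈ 𝒢 j)
    (hinj : ∀ b, ((0 : A), b) ∈ D → b = 0) (hB : ∀ u ∈ D, ∀ g : ℂ[X], g • u.2 = 0 → g = 0 ∨ u.2 = 0)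
    (hne : (∃ u ∈ D, u.2 ≠ 0) ∨ ∀ u ∈ D, u.1 = 0) {a : A} (ha : (a, (0 : B)) ∈ D) : a = 0 := by
  rcases hne with ⟨⟨c, d⟩, hu, hd⟩ | hall
  · have hc : c ≠ 0 := by
      rintro rfl
      exact hd (hinj d hu)
    obtain ⟨f, g, hf, hfg⟩ := hthin.exists_smul_eq (hD _ ha) (hD _ hu) hc
    have h1 : ((0 : A), (-g) • d) ∈ D := by
      have := sub_mem (Submodule.smul_mem D f ha) (Submodule.smul_mem D g hu)
      have e : f • (a, (0 : B)) - g • (c, d) = ((0 : A), (-g) • d) := by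
        ext
        · simp only [Prod.fst_sub, Prod.smul_fst]
          rw [hfg, sub_self]
        · simp
      rwa [e] at this
    have h2 := (hB _ hu _ (hinj _ h1)).resolve_right hd
    rw [neg_eq_zero] at h2
    rw [h2, zero_smul] at hfg
    exact hthin.torsion j a (hD _ ha) f hf hfg
  · exact hall _ ha

end LocalRelations

/-! ### The model -/

namespace QuadModel

variable {m b s : ℂ}

theorem brAt_mono (i j : ℤ) (f g : ℂ[X]) (z : ℂ) :
    brAt z (mono i f : QuadModel m b s) (mono j g) =
      mono (i + j) (C (f.eval (-z)) * g.comp (X + C z) *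
        (C (m * i + b) * X + C ((m * (i + j) + 2 * b) * z + s * (i - j)))) :=
  eval_br_mono i j f g z

/-- The component of degree `i`. -/
def comp (m b s : ℂ) (i : ℤ) : Submodule ℂ[X] (QuadModel m b s) where
  carrier := {a | ∃ f, a = mono i f}
  add_mem' := by
    rintro _ _ ⟨f, rfl⟩ ⟨g, rfl⟩
    exact ⟨f + g, (mono_add f g i).symm⟩
  zero_mem' := ⟨0, (Finsupp.single_zero i).symm⟩
  smul_mem' := by
    rintro c _ ⟨f, rfl⟩
    exact ⟨c * f, smul_mono c f i⟩

theorem mono_zero (i : ℤ) : (mono i 0 : QuadModel m b s) = 0 := Finsupp.single_zero i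

theorem mono_eq_zero {i : ℤ} {f : ℂ[X]} : (mono i f : QuadModel m b s) = 0 ↔ f = 0 :=
  Finsupp.single_eq_zero

theorem mono_neg (i : ℤ) (f : ℂ[X]) : (mono i (-f) : QuadModel m b s) = -mono i f :=
  Finsupp.single_neg i f

theorem eq_sum_mono (a : QuadModel m b s) :
    a = ∑ i ∈ (show ℤ →₀ ℂ[X] from a).support, mono i (a.coord i) :=
  (Finsupp.sum_single (show ℤ →₀ ℂ[X] from a)).symm

theorem coord_sum {ι : Type*} (S : Finset ι) (f : ι → QuadModel m b s) (i : ℤ) :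
    (∑ j ∈ S, f j).coord i = ∑ j ∈ S, (f j).coord i := by
  classical
  induction S using Finset.induction_on with
  | empty => rfl
  | insert a S ha ih => rw [Finset.sum_insert ha, Finset.sum_insert ha, coord_add, ih]

theorem sumInjective_comp : SumInjective (comp m b s) := by
  intro f hf hsum i
  obtain ⟨c, hc⟩ := hf i
  have h1 := congrArg (fun a => coord a i) hsum
  simp only [Finsupp.sum, coord_sum, coord_zero] at h1
  have h2 : ∀ j ∈ f.support, j ≠ i → (f j).coord i = 0 := by
    intro j _ hj
    obtain ⟨d, hd⟩ := hf j
    rw [hd, coord_mono, if_neg hj]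
  by_cases hi : i ∈ f.support
  · rw [Finset.sum_eq_single_of_mem i hi h2, hc, coord_mono, if_pos rfl] at h1
    rw [hc, h1, mono_zero]
  · exact Finsupp.notMem_support_iff.1 hi

theorem smul_eq_zero_iff {i : ℤ} {a : QuadModel m b s} (ha : a ∈ comp m b s i) {g : ℂ[X]}
    (h : g • a = 0) : g = 0 ∨ a = 0 := by
  obtain ⟨f, rfl⟩ := ha
  rw [smul_mono, mono_eq_zero, mul_eq_zero] at h
  exact h.imp id fun h => mono_eq_zero.2 h

/-- The Virasoro element of the model is `L_0 / b`, whence the division by `b` in shifts and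
weights. -/
theorem localRel (hb : b ≠ 0) :
    LocalRel (mono 0 (C b⁻¹) : QuadModel m b s) (mono 1 1) (mono (-1) 1) (-s / b) (2 + m / b)
      (s / b) (2 - m / b)
      (C (C b) * (C (C (m + b)) * C X + C (C (2 * b)) * X + C (C (2 * s)))) := by
  constructor <;> intro z
  · rw [brAt_mono, valAt_linPoly, smul_mono]
    simp only [Int.cast_zero]
    congr 1
    refine Polynomial.funext fun t => ?_
    simp only [eval_mul, eval_add, eval_comp, eval_C, eval_X]
    field_simp
    ring
  · rw [brAt_mono, valAt_linPoly, smul_mono]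
    congr 1
    refine Polynomial.funext fun t => ?_
    simp only [eval_mul, eval_add, eval_C, eval_X, one_comp, eval_one]
    push_cast
    field_simp
    ring
  · rw [brAt_mono, valAt_linPoly, smul_mono]
    congr 1
    refine Polynomial.funext fun t => ?_
    simp only [eval_mul, eval_add, eval_C, eval_X, one_comp, eval_one]
    push_cast
    field_simp
    ring
  · rw [brAt_mono, smul_mono]
    congr 1
    refine Polynomial.funext fun t => ?_
    simp only [valAt, eval_mul, eval_add, eval_C, eval_X, one_comp, eval_one]
    push_cast
    field_simp
    ring

/-- Multiplying by `∂ + 2s` turns `L_{-1}`, of weight 0 when `b = 1/2`, into an element of weight 1;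
the weights 4 and 1 of the quadratic case thus occur inside `CL_2(1/2, s)`. -/
theorem localRel_half (s : ℂ) :
    LocalRel (mono 0 (C (1 / 2 : ℂ)⁻¹) : QuadModel 1 (1 / 2) s) (mono 1 1)
      (mono (-1) (X + C (2 * s))) (-(2 * s)) 4 (2 * s) 1
      (C (C (1 / 2)) * ((C X + X + C (C (2 * s))) *
        (C (C (3 / 2)) * C X + X + C (C (2 * s))))) := by
  constructor <;> intro z
  · rw [brAt_mono, valAt_linPoly, smul_mono]
    simp only [Int.cast_zero]
    congr 1
    refine Polynomial.funext fun t => ?_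
    simp only [eval_mul, eval_add, eval_comp, eval_C, eval_X]
    ring
  · rw [brAt_mono, valAt_linPoly, smul_mono]
    congr 1
    refine Polynomial.funext fun t => ?_
    simp only [eval_mul, eval_add, eval_C, eval_X, one_comp, eval_one]
    push_cast
    ring
  · rw [brAt_mono, valAt_linPoly, smul_mono]
    congr 1
    refine Polynomial.funext fun t => ?_
    simp only [eval_mul, eval_add, eval_C, eval_X, add_comp, X_comp, C_comp]
    push_cast
    ring
  · rw [brAt_mono, smul_mono]
    congr 1
    refine Polynomial.funext fun t => ?_
    simp only [valAt, eval_mul, eval_add, eval_C, eval_X, add_comp, X_comp, C_comp, eval_one]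
    push_cast
    ring

end QuadModel

/-! ### Raising and lowering in the models. -/

section ModelChains

variable {A : Type*} [AddCommGroup A] [Module ℂ A] [Module ℂ[X] A] [IsScalarTower ℂ ℂ[X] A]
  [LieConformalAlgebra A] {m b s : ℂ}

open QuadModel

/-- The second projection of `up x n`. -/
def upSnd {B : Type*} [AddCommGroup B] [Module ℂ B] [Module ℂ[X] B] [IsScalarTower ℂ ℂ[X] B]
    [LieConformalAlgebra B] (x : A × B) (n : ℕ) : Submodule ℂ[X] B :=
  (up x n).map (LinearMap.snd ℂ[X] A B)

variable {x : A × QuadModel m b s} {n : ℕ}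

theorem brAt_mem_upSnd {v : QuadModel m b s} (hv : v ∈ upSnd x n) (z : ℂ) :
    brAt z x.2 v ∈ upSnd x (n + 1) := by
  obtain ⟨u, hu, rfl⟩ := hv
  exact ⟨pairBr z x u, pairBr_mem_up hu z, rfl⟩

theorem mono_mem_of_C_mul {N : Submodule ℂ[X] (QuadModel m b s)} {κ : ℂ} (hκ : κ ≠ 0) {i : ℤ}
    {f : ℂ[X]} (h : mono i (C κ * f) ∈ N) : mono i f ∈ N := by
  have := N.smul_mem (C κ⁻¹) h
  rwa [smul_mono, ← mul_assoc, ← C_mul, inv_mul_cancel₀ hκ, C_1, one_mul] at this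

/-- The difference of the values at `λ = 1` and `λ = 0` is the `λ`-coefficient, assumed nonzero. -/
theorem mono_mem_upSnd_full {ε j : ℤ} (hx : x.2 = mono ε 1) (hv : mono j 1 ∈ upSnd x n)
    (h : m * (ε + j) + 2 * b ≠ 0) : mono (ε + j) 1 ∈ upSnd x (n + 1) := by
  have h1 := sub_mem (brAt_mem_upSnd hv 1) (brAt_mem_upSnd hv 0)
  rw [hx, brAt_mono, brAt_mono, sub_eq_add_neg, ← mono_neg, ← mono_add] at h1
  refine mono_mem_of_C_mul h ?_
  convert h1 using 2
  refine Polynomial.funext fun t => ?_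
  simp
  ring

/-- Once the `λ`-coefficient vanishes, the bracket is `(ε + b)(∂ + 2s)L_{ε+j}`, since `j = -2b - ε`.
-/
theorem mono_mem_upSnd_half {ε j : ℤ} (hx : x.2 = mono ε 1) (hv : mono j 1 ∈ upSnd x n)
    (h : m * (ε + j) + 2 * b = 0) (h' : m * ε + b ≠ 0) (hm : m = 1) :
    mono (ε + j) (X + C (2 * s)) ∈ upSnd x (n + 1) := by
  have h1 := brAt_mem_upSnd hv 0
  rw [hx, brAt_mono] at h1
  refine mono_mem_of_C_mul h' ?_
  convert h1 using 2
  refine Polynomial.funext fun t => ?_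
  subst hm
  simp
  linear_combination s * h

/-- A second difference isolates the `λ²`-coefficient; the factor `∂ + λ + 2s` contributes one power
of `λ`. So the degree after the exceptional one is full again. -/
theorem mono_mem_upSnd_back {ε j : ℤ} (hx : x.2 = mono ε 1)
    (hv : mono j (X + C (2 * s)) ∈ upSnd x n) (h : m * (ε + j) + 2 * b ≠ 0) :
    mono (ε + j) 1 ∈ upSnd x (n + 1) := by
  have h1 := sub_mem (add_mem (brAt_mem_upSnd hv 1) (brAt_mem_upSnd hv (-1)))
    (add_mem (brAt_mem_upSnd hv 0) (brAt_mem_upSnd hv 0))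
  simp only [hx, brAt_mono] at h1
  rw [← mono_add, ← mono_add, sub_eq_add_neg, ← mono_neg, ← mono_add] at h1
  refine mono_mem_of_C_mul (mul_ne_zero two_ne_zero h) ?_
  convert h1 using 2
  refine Polynomial.funext fun t => ?_
  simp
  ring

/-- The iterated brackets of `L_ε`, `ε = ±1`. -/
theorem mono_mem_upSnd {ε : ℤ} (hε : ε ≠ 0) (hx : x.2 = mono ε 1) (hm : m = 0 ∨ m = 1) (hb : b ≠ 0)
    (hεb : m * ε + b ≠ 0) (n : ℕ) :
    (m * ((ε * (n + 2) : ℤ) : ℂ) + 2 * b = 0 →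
      mono (ε * (n + 2)) (X + C (2 * s)) ∈ upSnd x (n + 1)) ∧
    (m * ((ε * (n + 2) : ℤ) : ℂ) + 2 * b ≠ 0 → mono (ε * (n + 2)) 1 ∈ upSnd x (n + 1)) := by
  have hm1 : ∀ i : ℂ, m * i + 2 * b = 0 → m = 1 := by
    intro i hi
    rcases hm with rfl | h
    · exfalso
      apply hb
      linear_combination hi / 2
    · exact h
  have hstep : ∀ (j : ℤ) (n : ℕ), mono j 1 ∈ upSnd x n →
      (m * ((ε + j : ℤ) : ℂ) + 2 * b = 0 → mono (ε + j) (X + C (2 * s)) ∈ upSnd x (n + 1)) ∧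
      (m * ((ε + j : ℤ) : ℂ) + 2 * b ≠ 0 → mono (ε + j) 1 ∈ upSnd x (n + 1)) := by
    intro j n hv
    push_cast
    exact ⟨fun h => mono_mem_upSnd_half hx hv h hεb (hm1 _ h), fun h => mono_mem_upSnd_full hx hv h⟩
  induction n with
  | zero =>
    have h0 : mono ε 1 ∈ upSnd x 0 := ⟨x, Submodule.mem_span_singleton_self x, hx⟩
    have := hstep ε 0 h0
    rw [show ε * (((0 : ℕ) : ℤ) + 2) = ε + ε by push_cast; ring]
    exact this
  | succ n ih =>
    rw [show ε * (((n + 1 : ℕ) : ℤ) + 2) = ε + ε * (n + 2) by push_cast; ring]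
    by_cases h : m * ((ε * (n + 2) : ℤ) : ℂ) + 2 * b = 0
    -- The next degree differs from the exceptional degree `-2b` by `ε ≠ 0`.
    · have h1 : m * ((ε + ε * (n + 2) : ℤ) : ℂ) + 2 * b = ε := by
        have h2 := hm1 _ h
        push_cast at h ⊢
        rw [h2] at h ⊢
        linear_combination h
      have h3 : m * ((ε + ε * (n + 2) : ℤ) : ℂ) + 2 * b ≠ 0 := by
        rw [h1]
        exact_mod_cast hε
      refine ⟨fun h4 => absurd h4 h3, fun _ => mono_mem_upSnd_back hx (ih.1 h) ?_⟩
      push_cast at h3 ⊢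
      exact h3
    · exact hstep _ _ (ih.2 h)

/-- The iterated brackets of `(∂ + 2s)L_{-1}` in `CL_2(1/2, s)`. -/
theorem mono_mem_upSnd_of_half {x : A × QuadModel 1 (1 / 2) s}
    (hx : x.2 = mono (-1) (X + C (2 * s))) (n : ℕ) :
    mono (-((n : ℤ) + 2)) 1 ∈ upSnd x (n + 1) := by
  induction n with
  | zero =>
    have hv : mono (-1) (X + C (2 * s)) ∈ upSnd x 0 :=
      ⟨x, Submodule.mem_span_singleton_self x, hx⟩
    -- Both arguments carry a factor linear in `λ`, so the bracket is cubic in `λ` with top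
    -- coefficient 1; the third difference is `3! = 6`.
    have h1 := sub_mem (add_mem (brAt_mem_upSnd hv 2)
      ((upSnd x 1).smul_mem (C (3 : ℂ)) (brAt_mem_upSnd hv 0)))
      (add_mem ((upSnd x 1).smul_mem (C (3 : ℂ)) (brAt_mem_upSnd hv 1)) (brAt_mem_upSnd hv (-1)))
    simp only [hx, brAt_mono, smul_mono] at h1
    rw [← mono_add, ← mono_add, sub_eq_add_neg, ← mono_neg, ← mono_add] at h1
    refine mono_mem_of_C_mul (κ := 6) (by norm_num) ?_
    convert h1 using 2
    · norm_num
    refine Polynomial.funext fun t => ?_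
    simp
    ring
  | succ n ih =>
    -- Only the left argument now contributes an extra `λ`: the `λ²`-coefficient is `n + 2`, doubled
    -- by the second difference.
    have h1 := sub_mem (add_mem (brAt_mem_upSnd ih 1) (brAt_mem_upSnd ih (-1)))
      (add_mem (brAt_mem_upSnd ih 0) (brAt_mem_upSnd ih 0))
    simp only [hx, brAt_mono] at h1
    rw [← mono_add, ← mono_add, sub_eq_add_neg, ← mono_neg, ← mono_add] at h1
    refine mono_mem_of_C_mul (κ := 2 * (n + 2)) ?_ ?_
    · exact mul_ne_zero two_ne_zero (by
        have h0 : ((n + 2 : ℕ) : ℂ) ≠ 0 := Nat.cast_ne_zero.2 (by omega)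
        rwa [Nat.cast_add, Nat.cast_ofNat] at h0)
    rw [show -(((n + 1 : ℕ) : ℤ) + 2) = -1 + -((n : ℤ) + 2) by push_cast; ring]
    convert h1 using 2
    refine Polynomial.funext fun t => ?_
    simp
    ring

theorem eq_zero_of_C_mul_X_add_C {p q : ℂ} (h : (C p * X + C q : ℂ[X]) = 0) : p = 0 ∧ q = 0 := by
  have h0 := congrArg (eval 0) h
  have h1 := congrArg (eval 1) h
  simp only [eval_add, eval_mul, eval_C, eval_X, mul_zero, zero_add, eval_zero] at h0 h1
  exact ⟨by rw [h0] at h1; linear_combination h1, h0⟩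

theorem comp_X_add_C_ne_zero {c : ℂ[X]} (hc : c ≠ 0) (w : ℂ) : c.comp (X + C w) ≠ 0 := by
  rwa [Ne, comp_X_add_C_eq_zero_iff]

/-- Lowering operators are injective away from the local part. -/
theorem eq_zero_of_lower {ε : ℤ} (hm : m = 0 ∨ m = 1) (hb : b ≠ 0) (hε : ε ≠ 0) (n : ℕ)
    {c : ℂ[X]} (h : ∀ w, brAt w (mono ε 1 : QuadModel m b s) (mono (-ε * (n + 2)) c) = 0) :
    c = 0 := by
  by_contra hc
  have hlin : ∀ w : ℂ, (C (m * ε + b) * X + C ((m * (ε + (-ε * (n + 2) : ℤ)) + 2 * b) * w +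
      s * (ε - (-ε * (n + 2) : ℤ))) : ℂ[X]) = 0 := by
    intro w
    have h1 := h w
    rw [brAt_mono, mono_eq_zero, eval_one, C_1, one_mul, mul_eq_zero] at h1
    exact h1.resolve_left (comp_X_add_C_ne_zero hc w)
  obtain ⟨h1, h2⟩ := eq_zero_of_C_mul_X_add_C (hlin 0)
  obtain ⟨-, h3⟩ := eq_zero_of_C_mul_X_add_C (hlin 1)
  push_cast at h2 h3
  -- The coefficients of `∂` and of `λ` can vanish together only under this condition.
  have h4 : m * (ε * (n + 3)) = 0 := by linear_combination 2 * h1 + h2 - h3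
  rcases hm with rfl | rfl
  · apply hb
    linear_combination h1
  · rw [one_mul, mul_eq_zero] at h4
    rcases h4 with h4 | h4
    · exact hε (Int.cast_eq_zero.1 h4)
    · have : ((n + 3 : ℕ) : ℂ) = 0 := by push_cast; exact h4
      exact absurd (Nat.cast_eq_zero.1 this) (by omega)

theorem eq_zero_of_lower_half (n : ℕ) {c : ℂ[X]}
    (h : ∀ w, brAt w (mono (-1) (X + C (2 * s)) : QuadModel 1 (1 / 2) s)
      (mono ((n : ℤ) + 2) c) = 0) : c = 0 := by
  by_contra hc
  -- At this value the scalar coming from the left factor `∂ + 2s` is `-1`.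
  have h1 := h (2 * s + 1)
  rw [brAt_mono, mono_eq_zero, mul_eq_zero, mul_eq_zero] at h1
  rcases h1 with (h1 | h1) | h1
  · rw [C_eq_zero] at h1
    simp at h1
  · exact comp_X_add_C_ne_zero hc _ h1
  · have := (eq_zero_of_C_mul_X_add_C h1).1
    push_cast at this
    norm_num at this

end ModelChains

/-! ### From a local match to an isomorphism of generated subalgebras. -/

section IsoModel

variable {A : Type*} [AddCommGroup A] [Module ℂ A] [Module ℂ[X] A] [IsScalarTower ℂ ℂ[X] A]
  [LieConformalAlgebra A] {𝒢 : ℤ → Submodule ℂ[X] A} {m b s : ℂ}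

open QuadModel

/-- Homogeneous elements of degrees `0`, `k`, `-k` of a thin algebra and of degrees `0`, `1`, `-1`
of the model satisfying the same local relations. -/
structure LocalMatch (𝒢 : ℤ → Submodule ℂ[X] A) (k : ℤ) (t x y : A × QuadModel m b s) : Prop where
  thin : IsThin 𝒢
  k_ne : k ≠ 0
  loc : IsLocalPart t x y
  t_fst : t.1 ∈ 𝒢 0
  x_fst : x.1 ∈ 𝒢 k
  y_fst : y.1 ∈ 𝒢 (-k)
  t_ne : t.1 ≠ 0
  x_ne : x.1 ≠ 0
  y_ne : y.1 ≠ 0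
  t_snd : t.2 ∈ comp m b s 0
  x_snd : x.2 ∈ comp m b s 1
  y_snd : y.2 ∈ comp m b s (-1)
  x_low : ∀ (n : ℕ) (c : ℂ[X]), (∀ w, brAt w x.2 (mono (-((n : ℤ) + 2)) c) = 0) → c = 0
  y_low : ∀ (n : ℕ) (c : ℂ[X]), (∀ w, brAt w y.2 (mono ((n : ℤ) + 2) c) = 0) → c = 0

namespace LocalMatch

variable {k : ℤ} {t x y : A × QuadModel m b s}

theorem diag_le_prod (h : LocalMatch 𝒢 k t x y) (i : ℤ) :
    diag t x y i ≤ (𝒢 (k * i)).prod (comp m b s i) := by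
  have hbr : ∀ {i j : ℤ} {u v : QuadModel m b s} (z : ℂ), u ∈ comp m b s i → v ∈ comp m b s j →
      brAt z u v ∈ comp m b s (i + j) := by
    rintro i j _ _ z ⟨f, rfl⟩ ⟨g, rfl⟩
    exact ⟨_, brAt_mono i j f g z⟩
  refine diag_le (P := fun i => (𝒢 (k * i)).prod (comp m b s i)) ⟨?_, h.t_snd⟩ ⟨?_, h.x_snd⟩
    ⟨?_, h.y_snd⟩ ?_ ?_ i
  · simpa using h.t_fst
  · simpa using h.x_fst
  · simpa using h.y_fst
  · rintro j v z ⟨hv, hv'⟩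
    refine ⟨?_, hbr z h.x_snd hv'⟩
    rw [mul_add, mul_one]
    exact h.thin.grading.brAt_mem h.x_fst hv z
  · rintro j v z ⟨hv, hv'⟩
    refine ⟨?_, hbr z h.y_snd hv'⟩
    rw [mul_add, mul_neg_one]
    exact h.thin.grading.brAt_mem h.y_fst hv z

theorem snd_eq_zero (h : LocalMatch 𝒢 k t x y) (i : ℤ)
    {v : QuadModel m b s} (hv : ((0 : A), v) ∈ diag t x y i) : v = 0 := by
  have hfree : ∀ {j : ℤ} {a : A}, a ∈ 𝒢 j → a ≠ 0 → ∀ f : ℂ[X], f • a = 0 → f = 0 := by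
    intro j a ha ha0 f hf
    by_contra hf0
    exact ha0 (h.thin.torsion j a ha f hf0 hf)
  induction i using diag_induction with
  | h0 =>
    obtain ⟨f, hf⟩ := Submodule.mem_span_singleton.1 hv
    have h1 : f • t.1 = 0 := congrArg Prod.fst hf
    have h2 : f • t.2 = v := congrArg Prod.snd hf
    rw [← h2, hfree h.t_fst h.t_ne f h1, zero_smul]
  | hp n =>
    refine up_snd_eq_zero h.loc (hfree h.x_fst h.x_ne) (fun n u hu hw => ?_) hv
    rw [← diag_succ (t := t) (y := y)] at hu
    obtain ⟨c, hc⟩ := (h.diag_le_prod _ hu).2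
    rw [show (((n + 1 : ℕ) : ℤ) + 1) = (n : ℤ) + 2 by push_cast; ring] at hc
    rw [hc, h.y_low n c (by rwa [hc] at hw), mono_zero]
  | hn n =>
    rw [diag_neg] at hv
    refine up_snd_eq_zero h.loc.swap (hfree h.y_fst h.y_ne) (fun n u hu hw => ?_) hv
    rw [← diag_neg (t := t) (x := x)] at hu
    obtain ⟨c, hc⟩ := (h.diag_le_prod _ hu).2
    rw [show -(((n + 1 : ℕ) : ℤ) + 1) = -((n : ℤ) + 2) by push_cast; ring] at hc
    rw [hc, h.x_low n c (by rwa [hc] at hw), mono_zero]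

theorem fst_eq_zero (h : LocalMatch 𝒢 k t x y) (i : ℤ)
    (hne : (∃ u ∈ diag t x y i, u.2 ≠ 0) ∨ ∀ u ∈ diag t x y i, u.1 = 0)
    {a : A} (ha : (a, (0 : QuadModel m b s)) ∈ diag t x y i) : a = 0 :=
  fst_eq_zero_of_rank h.thin (fun _ hu => (h.diag_le_prod i hu).1) (fun _ hb => h.snd_eq_zero i hb)
    (fun _ hu _ hg => smul_eq_zero_iff (h.diag_le_prod i hu).2 hg) hne ha

/-- The subalgebra generated by the components of degrees `±k` is isomorphic to the subalgebra of
the model generated by the corresponding elements. -/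
theorem iso (h : LocalMatch 𝒢 k t x y) {T : Subalgebra (QuadModel m b s)}
    (hne : ∀ i, (∃ u ∈ diag t x y i, u.2 ≠ 0) ∨ ∀ u ∈ diag t x y i, u.1 = 0)
    (hx : IsBasis (𝒢 k) x.1) (hy : IsBasis (𝒢 (-k)) y.1)
    (ht : t.1 ∈ (subalgebraAt 𝒢 k).toSubmodule)
    (htT : t.2 ∈ T.toSubmodule) (hxT : x.2 ∈ T.toSubmodule) (hyT : y.2 ∈ T.toSubmodule)
    (hT : ∀ a ∈ T.toSubmodule, ∀ i,
      mono i (a.coord i) ∈ (diag t x y i).map (LinearMap.snd ℂ[X] A (QuadModel m b s))) :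
    (subalgebraAt 𝒢 k).Iso T := by
  -- Degree `i` of the model corresponds to degree `k i` of the algebra; as `k ≠ 0`, these degrees
  -- are distinct.
  have hgrad : SumInjective fun i => 𝒢 (k * i) :=
    SumInjective.of_iSupIndep (h.thin.grading.isInternal.submodule_iSupIndep.comp
      (f := fun i => k * i) (mul_right_injective₀ h.k_ne))
  refine Subalgebra.Iso.of_graph (R := ⨆ i, diag t x y i)
    (fun u hu v hv z => h.loc.iSup_closed hu hv z) ?_ ?_ ?_ ?_
  · refine map_fst_iSup_diag h.loc ht (Or.inl h.x_fst) (Or.inr h.y_fst) ?_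
    rintro a (ha | ha)
    · obtain ⟨f, rfl⟩ := hx.exists_smul_eq ha
      exact Submodule.smul_mem _ _ (Submodule.subset_span (Or.inl rfl))
    · obtain ⟨f, rfl⟩ := hy.exists_smul_eq ha
      exact Submodule.smul_mem _ _ (Submodule.subset_span (Or.inr rfl))
  · refine le_antisymm ?_ ?_
    · rw [Submodule.map_le_iff_le_comap]
      exact iSup_le (diag_snd_le htT hxT hyT)
    · intro a ha
      rw [eq_sum_mono a]
      refine Submodule.sum_mem _ fun i _ => ?_
      exact Submodule.map_mono (le_iSup (diag t x y) i) (hT a ha i)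
  · intro a ha
    exact eq_zero_of_mem_iSup sumInjective_comp h.diag_le_prod
      (fun i a ha => h.fst_eq_zero i (hne i) ha) ha
  · intro v hv
    exact eq_zero_of_mem_iSup' hgrad h.diag_le_prod (fun i v hv => h.snd_eq_zero i hv) hv

end LocalMatch

end IsoModel

/-! ### Weights on one side of a pair of weights 3 and 1. -/

section PositiveWeights

variable {A : Type*} [AddCommGroup A] [Module ℂ A] [Module ℂ[X] A] [IsScalarTower ℂ ℂ[X] A]
  [LieConformalAlgebra A] {𝒢 : ℤ → Submodule ℂ[X] A} {m b s : ℂ} {L : A}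

open QuadModel

theorem LocalMatch.of_localRel (hm : m = 0 ∨ m = 1) (hb : b ≠ 0) (hthin : IsThin 𝒢) {k : ℤ}
    (hk : k ≠ 0) {x y : A} (hL : L ∈ 𝒢 0) (hx : x ∈ 𝒢 k) (hy : y ∈ 𝒢 (-k)) (hL0 : L ≠ 0)
    (hx0 : x ≠ 0) (hy0 : y ≠ 0)
    (h : LocalRel L x y (-s / b) (2 + m / b) (s / b) (2 - m / b)
      (C (C b) * (C (C (m + b)) * C X + C (C (2 * b)) * X + C (C (2 * s))))) :
    LocalMatch 𝒢 k (L, (mono 0 (C b⁻¹) : QuadModel m b s)) (x, mono 1 1) (y, mono (-1) 1) where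
  thin := hthin
  k_ne := hk
  loc := h.isLocalPart (localRel hb)
  t_fst := hL
  x_fst := hx
  y_fst := hy
  t_ne := hL0
  x_ne := hx0
  y_ne := hy0
  t_snd := ⟨_, rfl⟩
  x_snd := ⟨_, rfl⟩
  y_snd := ⟨_, rfl⟩
  x_low n c hc := by
    refine eq_zero_of_lower (s := s) (ε := 1) hm hb one_ne_zero n fun w => ?_
    rw [neg_mul, one_mul]
    exact hc w
  y_low n c hc := by
    refine eq_zero_of_lower (s := s) (ε := -1) hm hb (by norm_num) n fun w => ?_
    rw [neg_neg, one_mul]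
    exact hc w

namespace Frame

theorem virasoro_mem (F : Frame 𝒢 L) : L ∈ 𝒢 0 := F.gen_zero ▸ F.gen_mem 0

theorem virasoro_ne_zero (F : Frame 𝒢 L) : L ≠ 0 := F.gen_zero ▸ F.gen_zero_ne

theorem brAt_self (F : Frame 𝒢 L) (z : ℂ) : brAt z L L = (X + C (2 * z)) • L := by
  have := F.brAt_virasoro 0 z
  rwa [F.gen_zero, F.shift_zero, F.weight_zero, zero_add] at this

/-- The weight of a generator can be read off from any nonzero element on which the Virasoro
element acts by a linear polynomial with leading coefficient different from `0` and `1`. -/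
theorem weight_eq (F : Frame 𝒢 L) {i : ℤ} {a : A} (ha : a ∈ 𝒢 i) (ha0 : a ≠ 0) {α δ : ℂ}
    (hδ : δ ≠ 1)
    (h : ∀ z, brAt z L a = (X + C (α + δ * z)) • a) : F.weight i = δ := by
  have hb := F.isBasis (F.gen_ne_zero ha ha0)
  obtain ⟨g, rfl⟩ := F.exists_smul_eq ha
  have hg : g ≠ 0 := by
    rintro rfl
    exact ha0 (zero_smul _ _)
  have h1 : ∀ t z, g.eval (t + z) * (t + (F.shift i + F.weight i * z)) =
      (t + (α + δ * z)) * g.eval t := by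
    intro t z
    have h2 := h z
    rw [brAt_smul_right, F.brAt_virasoro, smul_smul, smul_smul] at h2
    have h3 := congrArg (eval t) (hb.smul_injective h2)
    simpa only [eval_mul, eval_comp, eval_add, eval_X, eval_C] using h3
  by_cases hdeg : g.degree = 0
  · rw [eq_C_of_degree_eq_zero hdeg] at h1 hg
    have hg' : g.coeff 0 ≠ 0 := fun h0 => hg (by rw [h0, C_0])
    simp only [eval_C] at h1
    apply mul_left_cancel₀ hg'
    linear_combination h1 0 1 - h1 0 0
  -- A root `r` of `g` forces the generator to have weight 0, and then `a` to have weight 1: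
  -- multiplication by a nonconstant polynomial preserves linearity of the action only in passing
  -- from weight 0 to weight 1.
  · exfalso
    obtain ⟨r, hr⟩ := IsAlgClosed.exists_root g hdeg
    have hr' : g.eval r = 0 := hr
    have h2 : g.comp (C r + X) * (C (r + F.shift i) + C (F.weight i) * X) = 0 := by
      refine Polynomial.funext fun z => ?_
      have := h1 r z
      rw [hr', mul_zero] at this
      simp only [eval_mul, eval_comp, eval_add, eval_C, eval_X, eval_zero]
      linear_combination this
    have h3 : g.comp (C r + X) ≠ 0 := by
      rw [add_comm]
      exact comp_X_add_C_ne_zero hg r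
    have h4 := (mul_eq_zero.1 h2).resolve_left h3
    rw [add_comm] at h4
    obtain ⟨h5, h6⟩ := eq_zero_of_C_mul_X_add_C h4
    have h7 : (C (1 - δ) * X + C (α + δ * r)) * g = 0 := by
      refine Polynomial.funext fun t => ?_
      have := h1 t (r - t)
      rw [add_sub_cancel, hr', zero_mul] at this
      simp only [eval_mul, eval_add, eval_C, eval_X, eval_zero]
      linear_combination -this
    have h8 := (eq_zero_of_C_mul_X_add_C ((mul_eq_zero.1 h7).resolve_right hg)).1
    exact hδ (by linear_combination -h8)

/-- Elements of weights `3` and `1` in opposite degrees whose bracket is linear generate components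
of all positive multiples of the degree. -/
theorem weight_of_localRel (F : Frame 𝒢 L) {d : ℤ} (hd : d ≠ 0) {x y : A}
    (hx : x ∈ 𝒢 d) (hy : y ∈ 𝒢 (-d))
    {α c : ℂ} (hc : c ≠ 0) (hLx : ∀ z, brAt z L x = (X + C (α + 3 * z)) • x)
    (hLy : ∀ z, brAt z L y = (X + C (-α + z)) • y)
    (hxy : ∀ z, brAt z x y = (C c * (X + C (z - α))) • L) :
    (∃ z, brAt z x x ≠ 0) ∧ ∀ n : ℕ, 1 ≤ n → F.gen (d * n) ≠ 0 ∧ F.weight (d * n) = 2 + n := by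
  have hxy0 : ∀ z, (C c * (X + C (z - α)) : ℂ[X]) • L ≠ 0 := by
    intro z h
    have := F.thin.torsion 0 L F.virasoro_mem _
      (mul_ne_zero (C_ne_zero.2 hc) (X_add_C_ne_zero _)) h
    exact F.virasoro_ne_zero this
  have hx0 : x ≠ 0 := by
    rintro rfl
    exact hxy0 0 (by rw [← hxy, brAt_zero_left])
  have hy0 : y ≠ 0 := by
    rintro rfl
    exact hxy0 0 (by rw [← hxy, brAt_zero_right])
  have hc2 : (2 / c : ℂ) ≠ 0 := div_ne_zero two_ne_zero hc
  -- The model with `m = b = 1`, `s = -α` has bracket `2(∂ + λ - α)`, which explains the factor `2 /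
  -- c`.
  have hrel : LocalRel L ((2 / c) • x) y (-(-α) / 1) (2 + 1 / 1) ((-α) / 1) (2 - 1 / 1)
      (C (C 1) * (C (C (1 + 1)) * C X + C (C (2 * 1)) * X + C (C (2 * (-α))))) := by
    refine ⟨fun z => ?_, fun z => ?_, fun z => ?_, fun z => ?_⟩
    · rw [F.brAt_self, valAt_linPoly, zero_add]
    · rw [brAt_csmul_right, hLx, valAt_linPoly, smul_comm]
      norm_num
    · rw [hLy, valAt_linPoly]
      norm_num
    · rw [brAt_csmul_left, hxy, ← C_smul_eq, smul_smul]
      congr 1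
      refine Polynomial.funext fun t => ?_
      simp only [eval_mul, eval_add, eval_C, eval_X]
      field_simp
      ring
  have hmatch := LocalMatch.of_localRel (m := 1) (b := 1) (s := -α) (Or.inr rfl) one_ne_zero F.thin
    hd F.virasoro_mem ((𝒢 d).smul_of_tower_mem (2 / c) hx) hy F.virasoro_ne_zero
    (smul_ne_zero hc2 hx0) hy0 hrel
  set t' : A × QuadModel 1 1 (-α) := (L, mono 0 (C 1⁻¹)) with ht'
  set x' : A × QuadModel 1 1 (-α) := ((2 / c) • x, mono 1 1) with hx'
  set y' : A × QuadModel 1 1 (-α) := (y, mono (-1) 1) with hy'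
  constructor
  · by_contra! h
    have h1 := pairBr_mem_up (n := 0)
      (show x' ∈ up x' 0 from Submodule.mem_span_singleton_self x') 0
    rw [← diag_succ (t := t') (y := y')] at h1
    have h2 : pairBr 0 x' x' = ((0 : A), brAt 0 (mono 1 1 : QuadModel 1 1 (-α)) (mono 1 1)) := by
      simp only [pairBr, hx', brAt_csmul_left, brAt_csmul_right, h, smul_zero]
    rw [h2] at h1
    have h3 := hmatch.snd_eq_zero _ h1
    rw [brAt_mono, mono_eq_zero, eval_one, one_comp, C_1, one_mul, one_mul] at h3
    have h4 := (eq_zero_of_C_mul_X_add_C h3).1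
    norm_num at h4
  · intro n hn
    obtain ⟨n, rfl⟩ : ∃ n', n = n' + 1 := ⟨n - 1, by omega⟩
    have h1 : (mono ((n : ℤ) + 1) 1 : QuadModel 1 1 (-α)) ∈ upSnd x' n := by
      cases n with
      | zero => exact ⟨x', Submodule.mem_span_singleton_self x', rfl⟩
      | succ n =>
        have := (mono_mem_upSnd (x := x') (ε := 1) one_ne_zero rfl (Or.inr rfl) one_ne_zero
          (by norm_num) n).2 ?_
        · convert this using 2
          push_cast
          ring
        · have : ((n + 4 : ℕ) : ℂ) ≠ 0 := Nat.cast_ne_zero.2 (by omega)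
          push_cast at this ⊢
          intro h
          exact this (by linear_combination h)
    obtain ⟨u, hu, hu2⟩ := h1
    rw [← diag_succ (t := t') (y := y')] at hu
    have hmem := (hmatch.diag_le_prod _ hu).1
    have hu2 : u.2 = mono ((n : ℤ) + 1) 1 := hu2
    -- The graph contains no nonzero `(0, v)`, so a nonzero model element has a nonzero partner in
    -- the algebra.
    have hu1 : u.1 ≠ 0 := by
      intro h0
      have : ((0 : A), u.2) ∈ diag t' x' y' ((n : ℤ) + 1) := by
        rw [← h0]
        exact hu
      have h3 := hmatch.snd_eq_zero _ this
      rw [hu2, mono_eq_zero] at h3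
      exact one_ne_zero h3
    have hact : ∀ z, brAt z L u.1 = (X + C ((n + 1) * α + (2 + (n + 1 : ℕ)) * z)) • u.1 := by
      intro z
      have h2 := sub_mem (hmatch.loc.t_mem _ hu z) (Submodule.smul_mem _
        (X + C ((n + 1) * α + (2 + (n + 1 : ℕ)) * z)) hu)
      -- The eigenvalue equation holds for the model coordinate, so the discrepancy is of the form
      -- `(a, 0)`, and therefore zero.
      have h3 : pairBr z t' u - (X + C ((n + 1) * α + (2 + (n + 1 : ℕ)) * z) : ℂ[X]) • u =
          (brAt z L u.1 - (X + C ((n + 1) * α + (2 + (n + 1 : ℕ)) * z) : ℂ[X]) • u.1, 0) := by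
        refine Prod.ext rfl ?_
        change brAt z (mono 0 (C 1⁻¹)) u.2 - _ • u.2 = 0
        rw [hu2, brAt_mono, smul_mono, zero_add, sub_eq_add_neg, ← mono_neg, ← mono_add,
          mono_eq_zero]
        refine Polynomial.funext fun t => ?_
        simp
        ring
      rw [h3] at h2
      exact sub_eq_zero.1 (hmatch.fst_eq_zero _ (Or.inl ⟨u, hu, by
        rw [hu2, Ne, mono_eq_zero]
        exact one_ne_zero⟩) h2)
    have hcast : d * ((n : ℤ) + 1) = d * ((n + 1 : ℕ) : ℤ) := by push_cast; ring
    rw [hcast] at hmem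
    refine ⟨F.gen_ne_zero hmem hu1, F.weight_eq hmem hu1 ?_ hact⟩
    intro h
    have : ((n + 2 : ℕ) : ℂ) = 0 := by
      push_cast at h ⊢
      linear_combination h
    exact absurd (Nat.cast_eq_zero.1 this) (by omega)

end Frame

end PositiveWeights

/-! ### Weights along the string below a highest vector. -/

section Ladder

variable {A : Type*} [AddCommGroup A] [Module ℂ A] [Module ℂ[X] A] [IsScalarTower ℂ ℂ[X] A]
  [LieConformalAlgebra A] {𝒢 : ℤ → Submodule ℂ[X] A} {L x y : A} {α c : ℂ}

theorem brAt_swap_linear (hxy : ∀ z, brAt z x y = (C c * (X + C (z - α))) • L) (z : ℂ) :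
    brAt z y x = (c * (z + α)) • L := by
  have hp : ∀ z, valAt (C (C c) * linPoly (-α) 1) z = C c * (X + C (z - α)) := by
    intro z
    rw [valAt, eval_mul, eval_C, ← valAt, valAt_linPoly]
    congr 3
    ring
  rw [brAt_skew (p := C (C c) * linPoly (-α) 1) (fun z => by rw [hp, hxy]) z, ← C_smul_eq,
    ← neg_smul]
  congr 1
  refine Polynomial.funext fun t => ?_
  rw [eval_neg, eval_valAt, evalEval_flipPoly, ← eval_valAt, hp]
  simp only [eval_mul, eval_add, eval_X, eval_C]
  ring

/-- The commutator of a raising and a lowering operator. -/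
theorem lower_raise_sub (hxy : ∀ z, brAt z x y = (C c * (X + C (z - α))) • L) (z w : ℂ) (a : A) :
    brAt z y (brAt w x a) - brAt w x (brAt z y a) = (c * (z + α)) • brAt (z + w) L a := by
  rw [brAt_jacobi, brAt_swap_linear hxy, brAt_csmul_left, add_sub_cancel_right]

/-- The two Jacobi terms cancel: `[y_w y]` is killed by the raising operators, as its vanishing in
`CL_1(s)` requires. -/
theorem brAt_brAt_self_eq_zero (hLy : ∀ z, brAt z L y = (X + C (-α + z)) • y)
    (hxy : ∀ z, brAt z x y = (C c * (X + C (z - α))) • L) (z w : ℂ) :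
    brAt z x (brAt w y y) = 0 := by
  have hyL : brAt w y L = C (w + α) • y := by
    rw [brAt_skew (p := linPoly (-α) 1) (fun z => by rw [hLy, valAt_linPoly, one_mul]) w,
      ← neg_smul]
    congr 1
    refine Polynomial.funext fun t => ?_
    rw [eval_neg, eval_valAt, evalEval_flipPoly, ← eval_valAt, valAt_linPoly]
    simp only [eval_add, eval_X, eval_C]
    ring
  rw [brAt_jacobi, hxy, brAt_smul_left, brAt_smul_right, hLy, hyL, smul_smul, smul_smul,
    ← add_smul]
  convert zero_smul ℂ[X] y
  refine Polynomial.funext fun t => ?_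
  simp only [eval_mul, eval_add, eval_X, eval_C, eval_comp, eval_zero]
  ring

namespace Frame

theorem smul_gen_injective (F : Frame 𝒢 L) {i : ℤ} (hi : F.gen i ≠ 0) {f g : ℂ[X]}
    (h : f • F.gen i = g • F.gen i) : f = g :=
  (F.isBasis hi).smul_injective h

variable {k i : ℤ}

/-- A vector killed by the raising operators of weight `3` is followed by a component of
weight `-1`. -/
theorem weight_after_highest (F : Frame 𝒢 L) (hk1 : F.weight (-k) = 1)
    (hks : F.shift (-k) = -F.shift k) (hc : c ≠ 0)
    (hxy : ∀ z, brAt z (F.gen k) (F.gen (-k)) = (C c * (X + C (z - F.shift k))) • L)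
    (hi : F.gen i ≠ 0) (hkill : ∀ z, brAt z (F.gen k) (F.gen i) = 0) (hk3 : F.weight k = 3) :
    F.gen (-k + i) ≠ 0 ∧ F.weight (-k + i) = -1 := by
  have h1 : ∀ z w, brAt w (F.gen k) (brAt z (F.gen (-k)) (F.gen i)) =
      (C (-c * (z + F.shift k)) * (X + C (F.shift i + F.weight i * (z + w))) : ℂ[X]) •
        F.gen i := by
    intro z w
    have h2 := lower_raise_sub hxy z w (F.gen i)
    rw [hkill, brAt_zero_right, zero_sub, F.brAt_virasoro, ← C_smul_eq, smul_smul] at h2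
    rw [← neg_inj, h2, ← neg_smul]
    congr 1
    rw [← neg_mul, ← C_neg]
    congr 2
    ring
  have hne : F.gen (-k + i) ≠ 0 := by
    intro h0
    have h2 := h1 (1 - F.shift k) 0
    rw [F.brAt_gen, h0, smul_zero, brAt_zero_right] at h2
    have h3 := F.free i hi _ h2.symm
    refine mul_ne_zero (C_ne_zero.2 ?_) (X_add_C_ne_zero _) h3
    rw [sub_add_cancel, mul_one]
    exact neg_ne_zero.2 hc
  refine ⟨hne, ?_⟩
  have hidx : k + (-k + i) = i := by ring
  have h2 : ∀ t z w, (F.str (-k) i).evalEval (t + w) z * (F.str k (-k + i)).evalEval t w =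
      -c * (z + F.shift k) * (t + (F.shift i + F.weight i * (z + w))) := by
    intro t z w
    have h3 := h1 z w
    rw [F.brAt_gen, brAt_smul_right, F.brAt_gen, hidx, smul_smul] at h3
    have h4 := congrArg (eval t) (F.smul_gen_injective hi h3)
    simpa only [eval_mul, eval_comp, eval_add, eval_X, eval_C, eval_valAt] using h4
  have hprod : ∃ t z w,
      (F.str (-k) i).evalEval (t + w) z * (F.str k (-k + i)).evalEval t w ≠ 0 := by
    -- Chosen so that `z + α = 1`, `z + w = 0` and `t` plus the shift is 1; the product is then
    -- `-c`.
    refine ⟨1 - F.shift i, 1 - F.shift k, -(1 - F.shift k), ?_⟩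
    rw [h2]
    ring_nf
    exact neg_ne_zero.2 hc
  have hq0 : F.str (-k) i ≠ 0 := by
    intro h0
    obtain ⟨t, z, w, h⟩ := hprod
    exact h (by rw [h0, evalEval_zero, zero_mul])
  have hl0 : F.str k (-k + i) ≠ 0 := by
    intro h0
    obtain ⟨t, z, w, h⟩ := hprod
    exact h (by rw [h0, evalEval_zero, mul_zero])
  have hq := F.equivariant (-k) i hne
  have hl := F.equivariant k (-k + i) (by rwa [hidx])
  rw [hidx] at hl
  have hs := hq.add_eq hq0
  obtain ⟨m, hm, hmh⟩ := hq.homogeneous hq0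
  obtain ⟨n, hn, hnh⟩ := hl.homogeneous hl0
  rw [hk1] at hm
  rw [hk3] at hn
  refine weight_neg_one (φ := fun t z => (F.str (-k) i).evalEval (t - F.shift (-k + i))
      (z + F.shift (-k)))
    (ℓ := fun t w => (F.str k (-k + i)).evalEval (t - F.shift i) (w + F.shift k))
    (neg_ne_zero.2 hc) (fun t z w => ?_) hmh hnh (δ := F.weight i) ?_ ?_
  · have h3 := h2 (t - F.shift i) (z - F.shift k) (w + F.shift k)
    have e1 : t - F.shift i + (w + F.shift k) = t + w - F.shift (-k + i) := by
      rw [hs, hks]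
      ring
    rw [e1] at h3
    simp only [hks, ← sub_eq_add_neg]
    rw [h3]
    ring
  · linear_combination hm
  · linear_combination hn

/-- If `y` killed the generator of degree `i`, the commutator relation would factor as in
`weight_zero_or_one`. A nonzero bracket with `y`, of weight 1, lowers the weight by the degree of
its structure polynomial. -/
theorem weight_step (F : Frame 𝒢 L) (hk1 : F.weight (-k) = 1) (hc : c ≠ 0)
    (hxy : ∀ z, brAt z (F.gen k) (F.gen (-k)) = (C c * (X + C (z - F.shift k))) • L)
    (hi : F.gen i ≠ 0) (h0 : F.weight i ≠ 0) (h1 : F.weight i ≠ 1) :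
    F.gen (-k + i) ≠ 0 ∧ ∃ n : ℕ, F.weight (-k + i) = F.weight i - n := by
  have hex : ∃ z, brAt z (F.gen (-k)) (F.gen i) ≠ 0 := by
    by_contra! hkill
    have h2 : ∀ z w, brAt z (F.gen (-k)) (brAt w (F.gen k) (F.gen i)) =
        (C (c * (z + F.shift k)) * (X + C (F.shift i + F.weight i * (z + w))) : ℂ[X]) •
          F.gen i := by
      intro z w
      have h2 := lower_raise_sub hxy z w (F.gen i)
      rwa [hkill, brAt_zero_right, sub_zero, F.brAt_virasoro, ← C_smul_eq, smul_smul] at h2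
    have hidx : -k + (k + i) = i := by ring
    have h3 : ∀ t z w, (F.str k i).evalEval (t + z) w * (F.str (-k) (k + i)).evalEval t z =
        c * (z + F.shift k) * (t + (F.shift i + F.weight i * (z + w))) := by
      intro t z w
      have h3 := h2 z w
      rw [F.brAt_gen, brAt_smul_right, F.brAt_gen, hidx, smul_smul] at h3
      have h4 := congrArg (eval t) (F.smul_gen_injective hi h3)
      simpa only [eval_mul, eval_comp, eval_add, eval_X, eval_C, eval_valAt] using h4
    refine absurd (weight_zero_or_one (δ := F.weight i)
      (φ := fun t z => (F.str (-k) (k + i)).evalEval (t - F.shift i) (z - F.shift k))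
      (ℓ := fun t w => (F.str k i).evalEval (t - F.shift i - F.shift k) (w + F.shift k)) hc
      fun t z w => ?_) (not_or.2 ⟨h0, h1⟩)
    have h4 := h3 (t - F.shift i) (z - F.shift k) (w + F.shift k)
    have e1 : t - F.shift i + (z - F.shift k) = t + z - F.shift i - F.shift k := by ring
    rw [e1] at h4
    rw [mul_comm, h4]
    ring
  obtain ⟨z, hz⟩ := hex
  rw [F.brAt_gen] at hz
  have hne : F.gen (-k + i) ≠ 0 := by
    intro h
    exact hz (by rw [h, smul_zero])
  have hq0 : F.str (-k) i ≠ 0 := by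
    intro h
    exact hz (by rw [h, valAt, eval_zero, zero_smul])
  obtain ⟨m, hm, -⟩ := (F.equivariant (-k) i hne).homogeneous hq0
  rw [hk1] at hm
  exact ⟨hne, m, by linear_combination -hm⟩

/-- The string starts at weight `-1` in degree `-3k` and never increases, so it avoids 0 and 1,
where `weight_step` could fail. -/
theorem negative_weights (F : Frame 𝒢 L) (hk1 : F.weight (-k) = 1)
    (hks : F.shift (-k) = -F.shift k) (hc : c ≠ 0)
    (hxy : ∀ z, brAt z (F.gen k) (F.gen (-k)) = (C c * (X + C (z - F.shift k))) • L)
    (hk3 : F.weight k = 3) (h2 : F.gen (-k * 2) ≠ 0)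
    (hkill : ∀ z, brAt z (F.gen k) (F.gen (-k * 2)) = 0) (n : ℕ) :
    F.gen (-k * (n + 3)) ≠ 0 ∧ ∃ j : ℕ, F.weight (-k * (n + 3)) = -(j + 1) := by
  induction n with
  | zero =>
    have h := F.weight_after_highest hk1 hks hc hxy h2 hkill hk3
    rw [show -k + -k * 2 = -k * (((0 : ℕ) : ℤ) + 3) by push_cast; ring] at h
    exact ⟨h.1, 0, by rw [h.2]; norm_num⟩
  | succ n ih =>
    obtain ⟨hne, j, hj⟩ := ih
    have hj1 : ∀ q : ℕ, F.weight (-k * (n + 3)) ≠ q := by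
      intro q hq
      have : ((j + 1 + q : ℕ) : ℂ) = 0 := by
        push_cast
        rw [hj] at hq
        linear_combination -hq
      exact absurd (Nat.cast_eq_zero.1 this) (by omega)
    have h := F.weight_step hk1 hc hxy hne (by exact_mod_cast hj1 0) (by exact_mod_cast hj1 1)
    rw [show -k + -k * ((n : ℤ) + 3) = -k * (((n + 1 : ℕ) : ℤ) + 3) by push_cast; ring] at h
    obtain ⟨h3, m, hm⟩ := h
    refine ⟨h3, j + m, ?_⟩
    rw [hm, hj]
    push_cast
    ring

end Frame

end Ladder

/-! ### Iterated brackets leading to degree zero. -/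

section Chains

variable {A : Type*} [AddCommGroup A] [Module ℂ A] [Module ℂ[X] A] [IsScalarTower ℂ ℂ[X] A]
  [LieConformalAlgebra A] {𝒢 : ℤ → Submodule ℂ[X] A} {L : A}

namespace Frame

/-- Iterated brackets `[N_{i₁} _{z₁} [N_{i₂} _{z₂} ⋯ v]]`. -/
def chain (F : Frame 𝒢 L) (l : List (ℤ × ℂ)) (v : A) : A :=
  l.foldr (fun q a => brAt q.2 (F.gen q.1) a) v

/-- The degree of an iterated bracket. -/
def chainDeg (l : List (ℤ × ℂ)) : ℤ := (l.map Prod.fst).sum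

theorem chain_cons (F : Frame 𝒢 L) (q : ℤ × ℂ) (l : List (ℤ × ℂ)) (v : A) :
    F.chain (q :: l) v = brAt q.2 (F.gen q.1) (F.chain l v) := rfl

theorem chain_append (F : Frame 𝒢 L) (l l' : List (ℤ × ℂ)) (v : A) :
    F.chain (l ++ l') v = F.chain l (F.chain l' v) :=
  List.foldr_append

theorem chain_add (F : Frame 𝒢 L) (l : List (ℤ × ℂ)) (u v : A) :
    F.chain l (u + v) = F.chain l u + F.chain l v := by
  induction l with
  | nil => rfl
  | cons q l ih => rw [chain_cons, ih, brAt_add_right]; rfl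

theorem chain_csmul (F : Frame 𝒢 L) (l : List (ℤ × ℂ)) (r : ℂ) (v : A) :
    F.chain l (r • v) = r • F.chain l v := by
  induction l with
  | nil => rfl
  | cons q l ih => rw [chain_cons, ih, brAt_csmul_right]; rfl

theorem chainDeg_cons (q : ℤ × ℂ) (l : List (ℤ × ℂ)) : chainDeg (q :: l) = q.1 + chainDeg l := by
  simp [chainDeg]

theorem chainDeg_append (l l' : List (ℤ × ℂ)) :
    chainDeg (l ++ l') = chainDeg l + chainDeg l' := by
  simp [chainDeg]

theorem chainDeg_perm {l l' : List (ℤ × ℂ)} (h : l.Perm l') : chainDeg l = chainDeg l' :=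
  (h.map _).sum_eq

theorem chain_mem (F : Frame 𝒢 L) {i : ℤ} {v : A} (hv : v ∈ 𝒢 i) (l : List (ℤ × ℂ)) :
    F.chain l v ∈ 𝒢 (chainDeg l + i) := by
  induction l with
  | nil => simpa [chainDeg, chain] using hv
  | cons q l ih =>
    rw [chainDeg_cons, add_assoc]
    exact F.thin.grading.brAt_mem (F.gen_mem _) ih _

/-- If all shorter chains of the same degree vanish, the factors of a chain commute. -/
theorem chain_perm (F : Frame 𝒢 L) {v : A} {e : ℤ} {n : ℕ}
    (hmin : ∀ l : List (ℤ × ℂ), chainDeg l = e → l.length < n → F.chain l v = 0)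
    {l l' : List (ℤ × ℂ)} (h : l.Perm l') :
    ∀ pre : List (ℤ × ℂ), chainDeg (pre ++ l) = e → (pre ++ l).length ≤ n →
      F.chain (pre ++ l) v = F.chain (pre ++ l') v := by
  induction h with
  | nil => exact fun _ _ _ => rfl
  | cons q h ih =>
    intro pre he hn
    have := ih (pre ++ [q]) (by simpa using he) (by simpa using hn)
    simpa using this
  | swap q r l =>
    intro pre he hn
    rw [chain_append, chain_append, chain_cons, chain_cons, chain_cons, chain_cons, brAt_jacobi,
      F.brAt_gen, brAt_smul_left, C_smul_eq, chain_add, chain_csmul]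
    -- The commutator of two generators is a multiple of the generator of the summed degree; the
    -- multiple acts on the left as a scalar, so the correction is a shorter chain of the same
    -- degree.
    have h0 := hmin (pre ++ (r.1 + q.1, r.2 + q.2) :: l)
      (by
        rw [← he]
        simp only [chainDeg_append, chainDeg_cons]
        ring)
      (by
        simp only [List.length_append, List.length_cons] at hn ⊢
        omega)
    rw [chain_append, chain_cons] at h0
    rw [h0, smul_zero, zero_add]
  | trans h1 h2 ih1 ih2 =>
    intro pre he hn
    rw [ih1 pre he hn]
    refine ih2 pre ?_ ?_
    · rw [← he, chainDeg_append, chainDeg_append, chainDeg_perm h1]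
    · rw [List.length_append] at hn ⊢
      rwa [← h1.length_eq]

/-- Otherwise the chains applied to `v` would span a nonzero stable family vanishing in degree 0. -/
theorem exists_chain_ne_zero (F : Frame 𝒢 L) (hs : IsGradedSimple 𝒢) {i : ℤ} {v : A}
    (hv : v ∈ 𝒢 i) (hv0 : v ≠ 0) : ∃ l, chainDeg l = -i ∧ F.chain l v ≠ 0 := by
  by_contra! hall
  let J : ℤ → Submodule ℂ[X] A := fun j =>
    Submodule.span ℂ[X] {a | ∃ l, chainDeg l + i = j ∧ a = F.chain l v}
  have h0 : 𝒢 0 ≠ ⊥ := fun h =>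
    F.virasoro_ne_zero ((Submodule.mem_bot _).1 (h ▸ F.virasoro_mem))
  have hJ0 : J 0 = ⊥ := by
    rw [eq_bot_iff, Submodule.span_le]
    rintro _ ⟨l, hl, rfl⟩
    exact hall l (by omega)
  have h1 := eq_bot_of_stable F.thin.grading hs h0 (J := J) (fun j => by
      rw [Submodule.span_le]
      rintro _ ⟨l, rfl, rfl⟩
      exact F.chain_mem hv l)
    (fun j r a b z ha hb => by
      obtain ⟨f, rfl⟩ := F.exists_smul_eq ha
      rw [brAt_smul_left]
      refine Submodule.smul_mem _ _ ?_
      induction hb using Submodule.span_induction with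
      | mem b hb =>
        obtain ⟨l, hl, rfl⟩ := hb
        exact Submodule.subset_span ⟨(j, z) :: l, by rw [chainDeg_cons, ← hl, add_assoc], rfl⟩
      | zero => rw [brAt_zero_right]; exact zero_mem _
      | add u w _ _ hu hw => rw [brAt_add_right]; exact add_mem hu hw
      | smul g u _ hu => rw [brAt_smul_right]; exact Submodule.smul_mem _ _ hu) hJ0 i
  have h2 : v ∈ J i := Submodule.subset_span ⟨[], by simp [chainDeg], rfl⟩
  rw [h1] at h2
  exact hv0 ((Submodule.mem_bot _).1 h2)

/-- Two commuting generators with a nonzero product into degree `0`. -/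
theorem exists_commuting (F : Frame 𝒢 L) (hs : IsGradedSimple 𝒢) {k : ℤ} (hk : k ≠ 0)
    (hv : F.gen (-k * 2) ≠ 0) (hkill : ∀ z, brAt z (F.gen k) (F.gen (-k * 2)) = 0)
    (hkill2 : ∀ z, brAt z (F.gen (k * 2)) (F.gen (-k * 2)) = 0) :
    ∃ d j i : ℤ, 0 < d * k ∧ d ≠ k ∧ j + (d + i) = 0 ∧
      (∀ z w, brAt z (F.gen d) (brAt w (F.gen j) (F.gen i)) =
        brAt w (F.gen j) (brAt z (F.gen d) (F.gen i))) ∧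
      ∃ z w, brAt w (F.gen j) (brAt z (F.gen d) (F.gen i)) ≠ 0 := by
  set v := F.gen (-k * 2)
  have hvm : v ∈ 𝒢 (-k * 2) := F.gen_mem _
  have hex : ∃ n, ∃ l : List (ℤ × ℂ), l.length = n ∧ chainDeg l = k * 2 ∧ F.chain l v ≠ 0 := by
    obtain ⟨l, hl, h⟩ := F.exists_chain_ne_zero hs hvm hv
    exact ⟨_, l, rfl, by rw [hl]; ring, h⟩
  classical
  obtain ⟨l, hln, hle, hl0⟩ := Nat.find_spec hex
  have hmin : ∀ l' : List (ℤ × ℂ), chainDeg l' = k * 2 → l'.length < l.length →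
      F.chain l' v = 0 := by
    intro l' he hlt
    by_contra h
    rw [hln] at hlt
    exact Nat.find_min hex hlt ⟨l', rfl, he, h⟩
  have hperm : ∀ l', l.Perm l' → F.chain l' v ≠ 0 := by
    intro l' hp
    have := F.chain_perm hmin hp [] hle le_rfl
    rw [List.nil_append, List.nil_append] at this
    rwa [← this]
  -- The degrees of the factors sum to `2k`, so some factor lies on the side of `k`.
  obtain ⟨q, hq, hqpos⟩ : ∃ q ∈ l, 0 < q.1 * k := by
    by_contra! hall
    have h1 : chainDeg l * k ≤ 0 := by
      clear hln hle hl0 hmin hperm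
      induction l with
      | nil => simp [chainDeg]
      | cons q l ih =>
        rw [chainDeg_cons, add_mul]
        exact add_nonpos (hall q (by simp)) (ih fun r hr => hall r (by simp [hr]))
    rw [hle] at h1
    nlinarith [sq_nonneg k, mul_self_pos.2 hk]
  have hp := List.perm_cons_erase hq
  set l₁ := l.erase q
  have hqk : q.1 ≠ k := by
    intro h
    -- By commutativity the factor may act first, where degree `k` kills `v`.
    have h1 := hperm (l₁ ++ [q]) (hp.trans (List.perm_append_singleton q l₁).symm)
    rw [chain_append] at h1
    apply h1
    have : F.chain [q] v = 0 := by
      change brAt q.2 (F.gen q.1) v = 0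
      rw [h, hkill]
    have h0 : F.chain l₁ 0 = 0 := by
      simpa only [zero_smul] using F.chain_csmul l₁ 0 0
    rw [this, h0]
  have hdeg : chainDeg (q :: l₁) = k * 2 := by rw [← chainDeg_perm hp, hle]
  cases hl₁ : l₁ with
  | nil =>
    exfalso
    rw [hl₁] at hp hdeg
    have h1 := hperm _ hp
    have h2 : q.1 = k * 2 := by simpa [chainDeg] using hdeg
    apply h1
    change brAt q.2 (F.gen q.1) v = 0
    rw [h2, hkill2]
  | cons r l₂ =>
    rw [hl₁] at hp hdeg
    have hp' : l.Perm (r :: q :: l₂) := hp.trans (List.Perm.swap r q l₂)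
    have h1 := hperm _ hp'
    rw [chain_cons, chain_cons] at h1
    set x := F.chain l₂ v
    have hx : x ∈ 𝒢 (chainDeg l₂ + -k * 2) := F.chain_mem hvm l₂
    have hx0 : x ≠ 0 := by
      intro h
      exact h1 (by rw [h, brAt_zero_right, brAt_zero_right])
    rw [chainDeg_cons, chainDeg_cons] at hdeg
    refine ⟨q.1, r.1, chainDeg l₂ + -k * 2, hqpos, hqk, by linarith, fun z w => ?_, ?_⟩
    -- Merging the two factors gives a chain one step shorter, so their commutator vanishes on `x`,
    -- and by rank one on the whole component of `x`.
    · have h2 : ∀ ω, brAt ω (F.gen (q.1 + r.1)) x = 0 := by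
        intro ω
        refine hmin ((q.1 + r.1, ω) :: l₂) ?_ ?_
        · rw [chainDeg_cons]
          linarith
        · rw [hp.length_eq]
          simp
      rw [brAt_jacobi, F.brAt_gen, brAt_smul_left,
        F.thin.brAt_eq_zero_right (F.gen_mem _) hx hx0 h2, smul_zero, zero_add]
    · by_contra! hall
      obtain ⟨f, hf⟩ := F.exists_smul_eq hx
      apply h1
      rw [← hf, brAt_smul_right, brAt_smul_right, hall, smul_zero]

end Frame

end Chains

/-! ### Self-commutation of the weight one generator opposite to weight three. -/

section Crux

variable {A : Type*} [AddCommGroup A] [Module ℂ A] [Module ℂ[X] A] [IsScalarTower ℂ ℂ[X] A]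
  [LieConformalAlgebra A] {𝒢 : ℤ → Submodule ℂ[X] A} {L : A} {c : ℂ}

theorem valAt_eq_C {p : ℂ[X][X]} {c : ℂ} (h : ∀ t z, p.evalEval t z = c) (z : ℂ) :
    valAt p z = C c :=
  Polynomial.funext fun t => by rw [eval_valAt, h, eval_C]

theorem brAt_swap_const {x y : A} (hxy : ∀ z, brAt z x y = c • L) (z : ℂ) :
    brAt z y x = (-c) • L := by
  rw [brAt_skew (p := C (C c)) (fun z => by rw [valAt, eval_C, C_smul_eq, hxy]) z, neg_smul,
    ← C_smul_eq]
  congr 2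
  refine Polynomial.funext fun t => ?_
  rw [eval_valAt, evalEval_flipPoly, ← eval_valAt, valAt, eval_C, eval_C]

namespace Frame

theorem virasoro_isBasis (F : Frame 𝒢 L) : IsBasis (𝒢 0) L := by
  have h := F.isBasis F.gen_zero_ne
  rwa [F.gen_zero] at h

theorem equivariant_neg (F : Frame 𝒢 L) (d : ℤ) : Equivariant (F.str d (-d)) (F.shift d)
    (F.weight d) (F.shift (-d)) (F.weight (-d)) 0 2 := by
  have h := F.equivariant d (-d) (by rw [add_neg_cancel]; exact F.gen_zero_ne)
  rwa [add_neg_cancel, F.shift_zero, F.weight_zero] at h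

theorem brAt_gen_neg (F : Frame 𝒢 L) (d : ℤ) (z : ℂ) :
    brAt z (F.gen d) (F.gen (-d)) = valAt (F.str d (-d)) z • L := by
  rw [F.brAt_gen, add_neg_cancel, F.gen_zero]

/-- The structure polynomials of a commuting pair. -/
theorem weights_of_commuting (F : Frame 𝒢 L) {d j i : ℤ} (hsum : j + (d + i) = 0)
    (hcomm : ∀ z w, brAt z (F.gen d) (brAt w (F.gen j) (F.gen i)) =
      brAt w (F.gen j) (brAt z (F.gen d) (F.gen i)))
    (hne : ∃ z w, brAt w (F.gen j) (brAt z (F.gen d) (F.gen i)) ≠ 0) :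
    (F.weight d + F.weight (-d) = 3 ∧ ∃ c : ℂ, c ≠ 0 ∧
      ∀ z, brAt z (F.gen d) (F.gen (-d)) = c • L) ∨
    (F.weight d = 1 ∧ F.weight (-d) = 3 ∧ ∃ c : ℂ, c ≠ 0 ∧
      ∀ z, brAt z (F.gen d) (F.gen (-d)) = (c * (z - F.shift d)) • L) := by
  obtain rfl : i = -d - j := by omega
  have e1 : j + (-d - j) = -d := by ring
  have e2 : d + (-d - j) = -j := by ring
  have hl : ∀ z w, brAt z (F.gen d) (brAt w (F.gen j) (F.gen (-d - j))) =
      ((valAt (F.str j (-d - j)) w).comp (X + C z) * valAt (F.str d (-d)) z) • L := by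
    intro z w
    rw [F.brAt_gen, brAt_smul_right, e1, F.brAt_gen_neg, smul_smul]
  have hr : ∀ z w, brAt w (F.gen j) (brAt z (F.gen d) (F.gen (-d - j))) =
      ((valAt (F.str d (-d - j)) z).comp (X + C w) * valAt (F.str j (-j)) w) • L := by
    intro z w
    rw [F.brAt_gen, brAt_smul_right, e2, F.brAt_gen_neg, smul_smul]
  -- Commutation becomes a factorization identity because both orders end on the free generator `L`.
  have hABDE : ∀ t z w, (F.str j (-d - j)).evalEval (t + z) w * (F.str d (-d)).evalEval t z =
      (F.str d (-d - j)).evalEval (t + w) z * (F.str j (-j)).evalEval t w := by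
    intro t z w
    have h := hcomm z w
    rw [hl, hr] at h
    have h2 := congrArg (eval t) (F.virasoro_isBasis.smul_injective h)
    simpa only [eval_mul, eval_comp, eval_add, eval_X, eval_C, eval_valAt] using h2
  obtain ⟨z, w, hne⟩ := hne
  have hj0 : F.gen (-j) ≠ 0 := by
    intro h
    rw [F.brAt_gen, e2, h, smul_zero, brAt_zero_right] at hne
    exact hne rfl
  have hD0 : F.str d (-d - j) ≠ 0 := by
    intro h
    rw [hr, h, valAt, eval_zero, zero_comp, zero_mul, zero_smul] at hne
    exact hne rfl
  have hE0 : F.str j (-j) ≠ 0 := by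
    intro h
    rw [hr, h, valAt, valAt, eval_zero, mul_zero, zero_smul] at hne
    exact hne rfl
  have hD := F.equivariant d (-d - j) (by rwa [e2])
  have hB := F.equivariant_neg d
  by_cases hd : F.weight d = 1
  · rw [hd] at hB hD
    rcases linear_of_commuting hABDE hB hD (F.equivariant_neg j) hD0 hE0 with
      ⟨h1, c, hc, h2⟩ | ⟨h1, c, hc, h2⟩
    · refine Or.inl ⟨by rw [hd, h1]; norm_num, c, hc, fun z => ?_⟩
      rw [F.brAt_gen_neg, valAt_eq_C h2, C_smul_eq]
    · refine Or.inr ⟨hd, h1, c, hc, fun z => ?_⟩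
      rw [F.brAt_gen_neg, ← C_smul_eq]
      congr 1
      exact Polynomial.funext fun t => by rw [eval_valAt, h2, eval_C]
  · obtain ⟨h1, c, hc, h2⟩ := const_of_commuting hABDE hB hD (F.equivariant_neg j) hD0 hE0 hd
    refine Or.inl ⟨h1, c, hc, fun z => ?_⟩
    rw [F.brAt_gen_neg, valAt_eq_C h2, C_smul_eq]

/-- Generators in opposite degrees with a constant bracket have very special weights. -/
theorem weight_of_brAt_const (F : Frame 𝒢 L) {d : ℤ} (hw : F.weight d + F.weight (-d) = 3)
    (hc : c ≠ 0) (h : ∀ z, brAt z (F.gen d) (F.gen (-d)) = c • L) :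
    F.weight d = 0 ∨ F.weight d = 3 ∨ F.weight d = 1 / 2 := by
  by_cases h0 : F.weight d = 0
  · exact Or.inl h0
  have hgen : F.gen d ≠ 0 := by
    intro h1
    have := h 0
    rw [h1, brAt_zero_left] at this
    exact smul_ne_zero hc F.virasoro_ne_zero this.symm
  have hsw := brAt_swap_const h
  have hzL : ∀ z, brAt z (F.gen d) L =
      (C (F.weight d - 1) * X + C (F.weight d * z - F.shift d)) • F.gen d := by
    intro z
    rw [brAt_skew (p := linPoly (F.shift d) (F.weight d))
      (fun z => by rw [F.brAt_virasoro, valAt_linPoly]) z, ← neg_smul]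
    congr 1
    refine Polynomial.funext fun t => ?_
    rw [eval_neg, eval_valAt, evalEval_flipPoly, ← eval_valAt, valAt_linPoly]
    simp only [eval_add, eval_mul, eval_X, eval_C]
    ring
  have e1 : -d + (d + d) = d := by ring
  have h1 : ∀ z w, brAt w (F.gen (-d)) (brAt z (F.gen d) (F.gen d)) =
      (C (-c * F.weight d) * (X + C (2 * z + w))) • F.gen d := by
    intro z w
    rw [brAt_jacobi, hsw, brAt_csmul_left, F.brAt_virasoro, brAt_csmul_right, hzL, ← C_smul_eq,
      ← C_smul_eq, smul_smul, smul_smul, ← add_smul]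
    congr 1
    refine Polynomial.funext fun t => ?_
    simp only [eval_add, eval_mul, eval_X, eval_C]
    ring
  have h2 : ∀ t z w, (F.str d d).evalEval (t + w) z * (F.str (-d) (d + d)).evalEval t w =
      -c * F.weight d * (t + (2 * z + w)) := by
    intro t z w
    have h3 := h1 z w
    rw [F.brAt_gen, brAt_smul_right, F.brAt_gen, e1, smul_smul] at h3
    have h4 := congrArg (eval t) (F.smul_gen_injective hgen h3)
    simpa only [eval_mul, eval_comp, eval_add, eval_X, eval_C, eval_valAt] using h4
  have hκ : -c * F.weight d ≠ 0 := mul_ne_zero (neg_ne_zero.2 hc) h0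
  -- Substituting `w = -s - t` removes `t` from the first factor and from the right side, so the
  -- second factor must be constant.
  obtain ⟨u, hu, hflip⟩ := const_of_nowhere_zero (q := flipPoly (F.str (-d) (d + d)))
    (f := fun s z => (F.str d d).evalEval (-s) z) hκ (fun s z t => by
      rw [evalEval_flipPoly]
      have := h2 t z (-s - t)
      rw [show t + (-s - t) = -s by ring] at this
      rw [this]
      ring)
  have hℓ : ∀ t w, (F.str (-d) (d + d)).evalEval t w = u := by
    intro t w
    have := hflip t (-w - t)
    rwa [evalEval_flipPoly, show -(-w - t) - t = w by ring] at this
  have hr0 : F.gen (d + d) ≠ 0 := by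
    intro h3
    have h4 := h1 (1 / 2) 0
    rw [F.brAt_gen, h3, smul_zero, brAt_zero_right] at h4
    exact mul_ne_zero (C_ne_zero.2 hκ) (X_add_C_ne_zero _) (F.free d hgen _ h4.symm)
  have hwr : F.weight (d + d) = 2 * F.weight d - 2 := by
    have h3 := F.equivariant (-d) (d + d) (by rwa [e1])
    rw [e1] at h3
    have h4 := (h3.eq_const (by rw [hℓ]; exact hu)).1
    linear_combination h4 - hw
  have hq : ∀ z, brAt z (F.gen d) (F.gen d) =
      (C (-c * F.weight d / u) * (X + C (2 * z))) • F.gen (d + d) := by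
    intro z
    rw [F.brAt_gen]
    congr 1
    refine Polynomial.funext fun t => ?_
    have := h2 t z 0
    rw [hℓ, add_zero, add_zero] at this
    simp only [eval_valAt, eval_add, eval_mul, eval_X, eval_C]
    field_simp
    linear_combination this
  have hyr : ∀ w, brAt w (F.gen (-d)) (F.gen (d + d)) = u • F.gen d := by
    intro w
    rw [F.brAt_gen, e1, valAt_eq_C hℓ, C_smul_eq]
  have e2 : -d + (d + (d + d)) = d + d := by ring
  have h3 : ∀ z w, brAt w (F.gen (-d)) (brAt z (F.gen d) (F.gen (d + d))) =
      (C (-c) * (C (F.weight d + 1) * X + C ((4 * F.weight d - 2) * z +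
        (2 * F.weight d - 2) * w + F.shift (d + d)))) • F.gen (d + d) := by
    intro z w
    rw [brAt_jacobi, hsw, brAt_csmul_left, F.brAt_virasoro, hyr, brAt_csmul_right, hq, hwr,
      ← C_smul_eq, ← C_smul_eq, smul_smul, smul_smul, ← add_smul]
    congr 1
    refine Polynomial.funext fun t => ?_
    simp only [eval_add, eval_mul, eval_X, eval_C]
    field_simp
    ring
  have h4 : ∀ t z w, (F.str d (d + d)).evalEval (t + w) z *
      (F.str (-d) (d + (d + d))).evalEval t w = -c * ((F.weight d + 1) * t +
        ((4 * F.weight d - 2) * z + (2 * F.weight d - 2) * w + F.shift (d + d))) := by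
    intro t z w
    have h5 := h3 z w
    rw [F.brAt_gen, brAt_smul_right, F.brAt_gen, e2, smul_smul] at h5
    have h6 := congrArg (eval t) (F.smul_gen_injective hr0 h5)
    simpa only [eval_mul, eval_comp, eval_add, eval_X, eval_C, eval_valAt] using h6
  -- On `w = -t` the product separates the variables `z` and `t`, so the coefficients `3 - δ` and
  -- `4δ - 2` cannot both be nonzero.
  have h5 := mul_eq_zero_of_separated (f := fun z => (F.str d (d + d)).evalEval 0 z)
    (g := fun t => (F.str (-d) (d + (d + d))).evalEval t (-t))
    (a := -c * (3 - F.weight d)) (b := -c * (4 * F.weight d - 2)) (c := -c * F.shift (d + d))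
    (fun t z => by
      have := h4 t z (-t)
      rw [add_neg_cancel] at this
      rw [this]
      ring)
  rcases mul_eq_zero.1 h5 with h6 | h6
  · right; left
    have := (mul_eq_zero.1 h6).resolve_left (neg_ne_zero.2 hc)
    linear_combination -this
  · right; right
    have := (mul_eq_zero.1 h6).resolve_left (neg_ne_zero.2 hc)
    linear_combination this / 4

/-- The restriction applies to both `d` and `-d`; weight `1/2` would put the excluded weight `5/2`
on the opposite side. -/
theorem weights_of_brAt_const (F : Frame 𝒢 L) {d : ℤ} (hw : F.weight d + F.weight (-d) = 3)
    (hc : c ≠ 0) (h : ∀ z, brAt z (F.gen d) (F.gen (-d)) = c • L) :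
    (F.weight d = 0 ∧ F.weight (-d) = 3) ∨ (F.weight d = 3 ∧ F.weight (-d) = 0) := by
  have h1 := F.weight_of_brAt_const hw hc h
  have h2 := F.weight_of_brAt_const (d := -d) (by rw [neg_neg, add_comm, hw]) (neg_ne_zero.2 hc)
    (by rw [neg_neg]; exact brAt_swap_const h)
  rcases h1 with h1 | h1 | h1
  · exact Or.inl ⟨h1, by linear_combination hw - h1⟩
  · exact Or.inr ⟨h1, by linear_combination hw - h1⟩
  · exfalso
    have h3 : F.weight (-d) = 5 / 2 := by linear_combination hw - h1
    rw [h3] at h2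
    norm_num at h2

/-- Multiplication by `∂ + α` turns a generator of weight `0` into an element of weight `1`. -/
theorem brAt_raise_weight (F : Frame 𝒢 L) {d : ℤ} (h0 : F.weight d = 0) (z : ℂ) :
    brAt z L ((X + C (F.shift d)) • F.gen d) =
      (X + C (F.shift d + z)) • ((X + C (F.shift d) : ℂ[X]) • F.gen d) := by
  rw [brAt_smul_right, F.brAt_virasoro, h0, smul_smul, smul_smul]
  congr 1
  refine Polynomial.funext fun t => ?_
  simp only [eval_add, eval_mul, eval_X, eval_C, eval_comp]
  ring

/-- In a simple graded algebra of rank at most one the generator of weight `1` opposite to a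
generator of weight `3` commutes with itself. -/
theorem brAt_self_eq_zero (F : Frame 𝒢 L) (hs : IsGradedSimple 𝒢) {k : ℤ} (hk : k ≠ 0)
    (hk3 : F.weight k = 3) (hk1 : F.weight (-k) = 1) (hks : F.shift (-k) = -F.shift k)
    (hc : c ≠ 0)
    (hxy : ∀ z, brAt z (F.gen k) (F.gen (-k)) = (C c * (X + C (z - F.shift k))) • L) (z : ℂ) :
    brAt z (F.gen (-k)) (F.gen (-k)) = 0 := by
  by_contra hz
  have hLx : ∀ z, brAt z L (F.gen k) = (X + C (F.shift k + 3 * z)) • F.gen k := by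
    intro z
    rw [F.brAt_virasoro, hk3]
  have hLy : ∀ z, brAt z L (F.gen (-k)) = (X + C (-F.shift k + z)) • F.gen (-k) := by
    intro z
    rw [F.brAt_virasoro, hk1, hks, one_mul]
  obtain ⟨⟨ζ, hζ⟩, hpos⟩ := F.weight_of_localRel hk (F.gen_mem k) (F.gen_mem (-k)) hc hLx hLy hxy
  have hmem : brAt z (F.gen (-k)) (F.gen (-k)) ∈ 𝒢 (-k * 2) := by
    rw [mul_two]
    exact F.thin.grading.brAt_mem (F.gen_mem _) (F.gen_mem _) z
  have hv := F.gen_ne_zero hmem hz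
  have hkill : ∀ w, brAt w (F.gen k) (F.gen (-k * 2)) = 0 :=
    F.thin.brAt_eq_zero_right (F.gen_mem _) hmem hz
      (fun w => brAt_brAt_self_eq_zero hLy hxy w z)
  have hmem2 : brAt ζ (F.gen k) (F.gen k) ∈ 𝒢 (k * 2) := by
    rw [mul_two]
    exact F.thin.grading.brAt_mem (F.gen_mem _) (F.gen_mem _) ζ
  have hkill2 : ∀ w, brAt w (F.gen (k * 2)) (F.gen (-k * 2)) = 0 :=
    F.thin.brAt_eq_zero_left (F.gen_mem _) hmem2 hζ (fun w => by
      rw [brAt_brAt_left, hkill, hkill, brAt_zero_right, brAt_zero_right, sub_zero])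
  have hneg := F.negative_weights hk1 hks hc hxy hk3 hv hkill
  obtain ⟨d, j, i, hdk, hdne, hsum, hcomm, hne⟩ := F.exists_commuting hs hk hv hkill hkill2
  have hd0 : d ≠ 0 := by
    rintro rfl
    simp at hdk
  have habs : d * (k.natAbs : ℤ) = k * (d.natAbs : ℤ) := by
    rcases lt_or_gt_of_ne hk with h1 | h1
    · have h2 : d < 0 := by nlinarith
      rw [Int.ofNat_natAbs_of_nonpos h1.le, Int.ofNat_natAbs_of_nonpos h2.le]
      ring
    · have h2 : 0 < d := by nlinarith
      rw [Int.natAbs_of_nonneg h1.le, Int.natAbs_of_nonneg h2.le]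
      ring
  have hkabs : 1 ≤ k.natAbs := Int.natAbs_pos.2 hk
  have hdabs : 1 ≤ d.natAbs := Int.natAbs_pos.2 hd0
  -- A weight 3 element in degree `-d` would give a positive weight in degree `-3d|k| = -3k|d|`,
  -- where the string below `v` has a negative one. The factor 3 ensures that this degree is far
  -- enough down the string.
  have hneg3 : ∀ {x y : A} {α u : ℂ}, x ∈ 𝒢 (-d) → y ∈ 𝒢 d → u ≠ 0 →
      (∀ z, brAt z L x = (X + C (α + 3 * z)) • x) → (∀ z, brAt z L y = (X + C (-α + z)) • y) →
      (∀ z, brAt z x y = (C u * (X + C (z - α))) • L) → False := by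
    intro x y α u hx hy hu h1 h2 h3
    have h4 := ((F.weight_of_localRel (neg_ne_zero.2 hd0) hx (by rwa [neg_neg]) hu h1 h2 h3).2
      (3 * k.natAbs) (by omega)).2
    obtain ⟨n, hn⟩ : ∃ n : ℕ, 3 * d.natAbs = n + 3 := ⟨3 * d.natAbs - 3, by omega⟩
    obtain ⟨-, j, hj⟩ := hneg n
    have h5 : -d * ((3 * k.natAbs : ℕ) : ℤ) = -k * ((n : ℤ) + 3) := by
      have h6 : ((3 * d.natAbs : ℕ) : ℤ) = (n : ℤ) + 3 := by exact_mod_cast hn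
      rw [← h6, Nat.cast_mul, Nat.cast_mul]
      linear_combination (-3 : ℤ) * habs
    rw [h5, hj] at h4
    have h7 : ((2 + 3 * k.natAbs + j + 1 : ℕ) : ℂ) = 0 := by
      push_cast at h4 ⊢
      linear_combination -h4
    exact absurd (Nat.cast_eq_zero.1 h7) (by omega)
  rcases F.weights_of_commuting hsum hcomm hne with ⟨hw, u, hu, hB⟩ | ⟨h1, h3, u, hu, hB⟩
  · have hstr : F.str d (-d) ≠ 0 := by
      intro h
      have := hB 0
      rw [F.brAt_gen_neg, h, valAt, eval_zero, zero_smul] at this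
      exact smul_ne_zero hu F.virasoro_ne_zero this.symm
    have hsh : F.shift (-d) = -F.shift d := by
      have := (F.equivariant_neg d).add_eq hstr
      linear_combination -this
    -- In either case multiplying the weight 0 generator by `∂ + α` gives weight 1 and makes the
    -- bracket linear, yielding a pair of weights 3 and 1.
    rcases F.weights_of_brAt_const hw hu hB with ⟨h0, h3⟩ | ⟨h3, h0⟩
    · refine hneg3 (α := F.shift (-d)) (u := -u) (F.gen_mem (-d))
        ((𝒢 d).smul_mem (X + C (F.shift d)) (F.gen_mem d)) (neg_ne_zero.2 hu)
        (fun z => by rw [F.brAt_virasoro, h3]) (fun z => ?_) (fun z => ?_)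
      · rw [F.brAt_raise_weight h0, hsh, neg_neg]
      · rw [brAt_smul_right, brAt_swap_const hB, ← C_smul_eq, smul_smul, hsh]
        congr 1
        refine Polynomial.funext fun t => ?_
        simp only [eval_add, eval_mul, eval_X, eval_C, eval_comp]
        ring
    · have h4 := ((F.weight_of_localRel hd0 (F.gen_mem d)
        ((𝒢 (-d)).smul_mem (X + C (F.shift (-d))) (F.gen_mem (-d))) hu (α := F.shift d)
        (fun z => by rw [F.brAt_virasoro, h3])
        (fun z => by rw [F.brAt_raise_weight h0, hsh])
        (fun z => by
          rw [brAt_smul_right, hB, ← C_smul_eq, smul_smul, hsh]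
          congr 1
          refine Polynomial.funext fun t => ?_
          simp only [eval_add, eval_mul, eval_X, eval_C, eval_comp]
          ring)).2 k.natAbs hkabs).2
      -- The degree `d|k| = k|d|` has weight both `2 + |k|` and `2 + |d|`; since `d` and `k` have
      -- the same sign, `d = k`, which is excluded.
      have h5 := (hpos d.natAbs hdabs).2
      rw [habs, h5] at h4
      have h6 : d.natAbs = k.natAbs := by
        have : (d.natAbs : ℂ) = k.natAbs := by linear_combination h4
        exact_mod_cast this
      rw [h6] at habs
      exact hdne (mul_right_cancel₀ (by exact_mod_cast Nat.one_le_iff_ne_zero.1 hkabs) habs)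
  · have hstr : F.str d (-d) ≠ 0 := by
      intro h
      have := hB (F.shift d + 1)
      rw [F.brAt_gen_neg, h, valAt, eval_zero, zero_smul] at this
      refine smul_ne_zero ?_ F.virasoro_ne_zero this.symm
      rw [add_sub_cancel_left, mul_one]
      exact hu
    have hsh : F.shift (-d) = -F.shift d := by
      have := (F.equivariant_neg d).add_eq hstr
      linear_combination -this
    refine hneg3 (α := F.shift (-d)) (u := u) (F.gen_mem (-d)) (F.gen_mem d) hu
      (fun z => by rw [F.brAt_virasoro, h3])
      (fun z => by rw [F.brAt_virasoro, h1, hsh, neg_neg, one_mul]) (fun z => ?_)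
    have hp : ∀ z, valAt (C (C u) * linPoly (-F.shift d) 1 - C (C u) * C X) z =
        C (u * (z - F.shift d)) := by
      intro z
      rw [valAt, eval_sub, eval_mul, eval_mul, eval_C, eval_C, ← valAt, valAt_linPoly]
      refine Polynomial.funext fun t => ?_
      simp only [eval_add, eval_sub, eval_mul, eval_X, eval_C]
      ring
    rw [brAt_skew (fun z => by rw [hp, C_smul_eq, hB]) z, ← neg_smul, hsh]
    congr 1
    refine Polynomial.funext fun t => ?_
    rw [eval_neg, eval_valAt, evalEval_flipPoly, ← eval_valAt, hp]
    simp only [eval_add, eval_mul, eval_X, eval_C]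
    ring

end Frame

end Crux

/-! ### Isomorphisms with `CL_1`, `CL_2`, `SCL_2` and `𝒱`. -/

section ModelIsomorphisms

variable {A : Type*} [AddCommGroup A] [Module ℂ A] [Module ℂ[X] A] [IsScalarTower ℂ ℂ[X] A]
  [LieConformalAlgebra A] {𝒢 : ℤ → Submodule ℂ[X] A} {m b s : ℂ} {L : A}

open QuadModel

theorem mono_mem_of_one {N : Submodule ℂ[X] (QuadModel m b s)} {i : ℤ} (h : mono i 1 ∈ N)
    (f : ℂ[X]) : mono i f ∈ N := by
  have := N.smul_mem f h
  rwa [smul_mono, mul_one] at this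

theorem exists_snd_ne_zero {D : Submodule ℂ[X] (A × QuadModel m b s)} {i : ℤ} {f : ℂ[X]}
    (hf : f ≠ 0) (h : mono i f ∈ D.map (LinearMap.snd ℂ[X] A (QuadModel m b s))) :
    ∃ u ∈ D, u.2 ≠ 0 := by
  obtain ⟨u, hu, hu2⟩ := h
  refine ⟨u, hu, fun h0 => hf (mono_eq_zero (m := m) (b := b) (s := s) (i := i) |>.1 ?_)⟩
  rw [← hu2]
  exact h0

theorem subalgebraAt_neg (k : ℤ) : subalgebraAt 𝒢 (-k) = subalgebraAt 𝒢 k := by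
  rw [subalgebraAt, subalgebraAt, neg_neg, Set.union_comm]

theorem mem_subalgebraAt {k : ℤ} {a : A} (h : a ∈ 𝒢 k ∨ a ∈ 𝒢 (-k)) :
    a ∈ (subalgebraAt 𝒢 k).toSubmodule := by
  refine Submodule.mem_sInf.2 ?_
  rintro _ ⟨S, rfl, hS⟩
  exact hS h

/-- The components of the diagonal subalgebra project onto those of the model, except in degree
`-2b`. -/
theorem mono_mem_map_diag {t x y : A × QuadModel m b s} (hm : m = 0 ∨ m = 1) (hb : b ≠ 0)
    (ht : t.2 = mono 0 (C b⁻¹)) (hx : x.2 = mono 1 1) (hy : y.2 = mono (-1) 1)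
    (i : ℤ) (hi : -1 ≤ i ∨ -m + b ≠ 0) (hmb : m + b ≠ 0) :
    (2 ≤ |i| → m * i + 2 * b = 0 →
      mono i (X + C (2 * s)) ∈ (diag t x y i).map (LinearMap.snd ℂ[X] A (QuadModel m b s))) ∧
    ((2 ≤ |i| → m * i + 2 * b ≠ 0) →
      mono i 1 ∈ (diag t x y i).map (LinearMap.snd ℂ[X] A (QuadModel m b s))) := by
  induction i using diag_induction with
  | h0 =>
    refine ⟨fun h => absurd h (by norm_num), fun _ => mono_mem_of_C_mul (inv_ne_zero hb) ?_⟩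
    rw [mul_one, ← ht]
    exact ⟨t, Submodule.mem_span_singleton_self t, rfl⟩
  | hp n =>
    rw [diag_succ]
    cases n with
    | zero =>
      exact ⟨fun h => absurd h (by norm_num),
        fun _ => ⟨x, Submodule.mem_span_singleton_self x, hx⟩⟩
    | succ n =>
      have h := mono_mem_upSnd one_ne_zero hx hm hb (by rwa [Int.cast_one, mul_one]) n
      rw [one_mul, show (n : ℤ) + 2 = ((n + 1 : ℕ) : ℤ) + 1 by push_cast; ring] at h
      exact ⟨fun _ => h.1, fun h' => h.2 (h' (by rw [abs_of_nonneg] <;> push_cast <;> omega))⟩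
  | hn n =>
    rw [diag_neg]
    cases n with
    | zero =>
      refine ⟨fun h => absurd h (by norm_num), fun _ => ?_⟩
      exact ⟨y, Submodule.mem_span_singleton_self y, hy⟩
    | succ n =>
      have hmb' : -m + b ≠ 0 := hi.resolve_left (by push_cast; omega)
      have h := mono_mem_upSnd (ε := -1) (by norm_num) hy hm hb (by simpa using hmb') n
      rw [show -1 * ((n : ℤ) + 2) = -(((n + 1 : ℕ) : ℤ) + 1) by push_cast; ring] at h
      exact ⟨fun _ => h.1,
        fun h' => h.2 (h' (by rw [abs_neg, abs_of_nonneg] <;> push_cast <;> omega))⟩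

/-- The difference of the values at `λ = 1` and `λ = 0` is `γ L`. -/
theorem virasoro_mem_subalgebraAt {k : ℤ} {x y : A} {β γ δ : ℂ} (hx : x ∈ 𝒢 k) (hy : y ∈ 𝒢 (-k))
    (hγ : γ ≠ 0) (h : ∀ z, brAt z x y = (C β * X + C (γ * z + δ)) • L) :
    L ∈ (subalgebraAt 𝒢 k).toSubmodule := by
  have h1 := fun z => Subalgebra.brAt_mem _ (mem_subalgebraAt (Or.inl hx))
    (mem_subalgebraAt (𝒢 := 𝒢) (Or.inr hy)) z
  have h2 := Submodule.smul_mem _ (C γ⁻¹) (sub_mem (h1 1) (h1 0))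
  rw [h, h, ← sub_smul, smul_smul] at h2
  convert h2
  conv_lhs => rw [← one_smul ℂ[X] L]
  congr 1
  refine Polynomial.funext fun t => ?_
  simp only [eval_mul, eval_sub, eval_add, eval_C, eval_X, eval_one]
  field_simp
  ring

section Linear

variable {k : ℤ} {x y : A}

/-- The relations of `CL_2(b,s)` and `𝒱(s)` for homogeneous bases in opposite degrees. -/
structure LinearPair (𝒢 : ℤ → Submodule ℂ[X] A) (k : ℤ) (L x y : A) (m b s : ℂ) : Prop where
  m_eq : m = 0 ∨ m = 1
  b_ne : b ≠ 0
  thin : IsThin 𝒢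
  k_ne : k ≠ 0
  basis_L : IsBasis (𝒢 0) L
  basis_x : IsBasis (𝒢 k) x
  basis_y : IsBasis (𝒢 (-k)) y
  rel : LocalRel L x y (-s / b) (2 + m / b) (s / b) (2 - m / b)
    (C (C b) * (C (C (m + b)) * C X + C (C (2 * b)) * X + C (C (2 * s))))

theorem LinearPair.localMatch (h : LinearPair 𝒢 k L x y m b s) :
    LocalMatch 𝒢 k (L, (mono 0 (C b⁻¹) : QuadModel m b s)) (x, mono 1 1) (y, mono (-1) 1) :=
  LocalMatch.of_localRel h.m_eq h.b_ne h.thin h.k_ne h.basis_L.mem h.basis_x.mem h.basis_y.mem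
    h.basis_L.ne_zero h.basis_x.ne_zero h.basis_y.ne_zero h.rel

theorem LinearPair.virasoro_mem (h : LinearPair 𝒢 k L x y m b s) :
    L ∈ (subalgebraAt 𝒢 k).toSubmodule := by
  refine virasoro_mem_subalgebraAt (β := b * (m + b)) (γ := 2 * b ^ 2) (δ := 2 * b * s)
    h.basis_x.mem h.basis_y.mem (mul_ne_zero two_ne_zero (pow_ne_zero 2 h.b_ne)) fun z => ?_
  rw [h.rel.xy]
  congr 1
  refine Polynomial.funext fun t => ?_
  simp only [eval_mul, eval_add, eval_C, eval_X]
  ring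

theorem LinearPair.iso_whole (h : LinearPair 𝒢 k L x y m b s)
    (hi : ∀ i : ℤ, 2 ≤ |i| → m * i + 2 * b ≠ 0) :
    (subalgebraAt 𝒢 k).Iso (Subalgebra.whole (QuadModel m b s)) := by
  have h1 : m + b ≠ 0 := by
    intro h0
    refine hi 2 (by norm_num) ?_
    push_cast
    linear_combination 2 * h0
  have h2 : -m + b ≠ 0 := by
    intro h0
    refine hi (-2) (by norm_num) ?_
    push_cast
    linear_combination 2 * h0
  have h3 := fun i => (mono_mem_map_diag (A := A) (s := s) (t := (L, mono 0 (C b⁻¹)))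
    (x := (x, mono 1 1)) (y := (y, mono (-1) 1)) h.m_eq h.b_ne rfl rfl rfl i (Or.inr h2)
    h1).2 (hi i)
  exact h.localMatch.iso (fun i => Or.inl (exists_snd_ne_zero one_ne_zero (h3 i))) h.basis_x
    h.basis_y h.virasoro_mem trivial trivial trivial
    fun a _ i => mono_mem_of_one (h3 i) _

/-- When `|2b| ≥ 3` the exceptional degree `-2b` lies outside the local part, so only `(∂ +
2s)L_{-2b}` is reached there. For `|2b| = 1` it is the degree of a generator, and all of `CL_2` is
obtained. -/
theorem LinearPair.iso_SCL2 (h : LinearPair 𝒢 k L x y 1 b s) {n : ℤ} (hn : 2 * b = n)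
    (hn3 : 3 ≤ |n|) : (subalgebraAt 𝒢 k).Iso (SCL2 b s) := by
  have hne : ∀ i : ℤ, |i| ≤ 2 → (i : ℂ) ≠ -2 * b := by
    intro i hi h0
    have : i = -n := by
      have : (i : ℂ) = ((-n : ℤ) : ℂ) := by
        rw [h0]
        push_cast
        linear_combination -hn
      exact_mod_cast this
    rw [this, abs_neg] at hi
    omega
  have h1 : (1 : ℂ) + b ≠ 0 := by
    intro h0
    refine hne 2 (by norm_num) ?_
    push_cast
    linear_combination 2 * h0
  have h2 : -(1 : ℂ) + b ≠ 0 := by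
    intro h0
    refine hne (-2) (by norm_num) ?_
    push_cast
    linear_combination 2 * h0
  have h3 := fun i => mono_mem_map_diag (A := A) (s := s) (t := (L, mono 0 (C b⁻¹)))
    (x := (x, mono 1 1)) (y := (y, mono (-1) 1)) h.m_eq h.b_ne rfl rfl rfl i (Or.inr h2) h1
  have hcoord : ∀ (j : ℤ) (f : ℂ[X]), |j| ≤ 2 →
      (mono j f : QuadModel 1 b s) ∈ (SCL2 b s).toSubmodule := by
    intro j f hj i hi
    rw [coord_mono, if_neg]
    · exact dvd_zero _
    · rintro rfl
      exact hne j hj hi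
  refine h.localMatch.iso (fun i => Or.inl ?_) h.basis_x h.basis_y h.virasoro_mem
    (hcoord 0 _ (by norm_num)) (hcoord 1 _ (by norm_num)) (hcoord (-1) _ (by norm_num))
    fun a ha i => ?_
  · by_cases hi : (1 : ℂ) * i + 2 * b = 0
    · by_cases hi2 : 2 ≤ |i|
      · exact exists_snd_ne_zero (X_add_C_ne_zero _) ((h3 i).1 hi2 hi)
      · exact exists_snd_ne_zero one_ne_zero ((h3 i).2 fun h => absurd h hi2)
    · exact exists_snd_ne_zero one_ne_zero ((h3 i).2 fun _ => hi)
  · by_cases hi : (1 : ℂ) * i + 2 * b = 0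
    · have hi' : (i : ℂ) = -2 * b := by linear_combination hi
      obtain ⟨g, hg⟩ := ha i hi'
      have hi2 : 2 ≤ |i| := by
        by_contra hlt
        exact hne i (by omega) hi'
      rw [hg, mul_comm, ← smul_mono]
      exact Submodule.smul_mem _ _ ((h3 i).1 hi2 hi)
    · exact mono_mem_of_one ((h3 i).2 fun _ => hi) _

theorem fst_eq_zero_of_up {B : Type*} [AddCommGroup B] [Module ℂ B] [Module ℂ[X] B]
    [IsScalarTower ℂ ℂ[X] B] [LieConformalAlgebra B] {y : A × B}
    (hy : ∀ z, brAt z y.1 y.1 = 0) (n : ℕ) : ∀ u ∈ up y (n + 1), u.1 = 0 := by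
  have hle : up y (n + 1) ≤ LinearMap.ker (LinearMap.fst ℂ[X] A B) := by
    induction n with
    | zero =>
      refine Submodule.span_le.2 ?_
      rintro _ ⟨z, u, hu, rfl⟩
      obtain ⟨f, rfl⟩ := Submodule.mem_span_singleton.1 hu
      change brAt z y.1 (f • y.1) = 0
      rw [brAt_smul_right, hy, smul_zero]
    | succ n ih =>
      refine Submodule.span_le.2 ?_
      rintro _ ⟨z, u, hu, rfl⟩
      have hu : u.1 = 0 := ih hu
      change brAt z y.1 u.1 = 0
      rw [hu, brAt_zero_right]
  exact fun u hu => hle hu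

/-- Below degree `-1` the rank argument has no nonzero model element to compare with; there `[y_λ y]
= 0` makes the first coordinates vanish directly. -/
theorem LinearPair.iso_CL1 {s : ℂ} (h : LinearPair 𝒢 k L x y 1 1 (-s))
    (hy : ∀ z, brAt z y y = 0) : (subalgebraAt 𝒢 k).Iso (CL1 s) := by
  have h3 : ∀ i : ℤ, -1 ≤ i → (mono i 1 : QuadModel 1 1 (-s)) ∈
      (diag (L, mono 0 (C 1⁻¹)) (x, mono 1 1) (y, mono (-1) 1) i).map
        (LinearMap.snd ℂ[X] A (QuadModel 1 1 (-s))) := by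
    intro i hi
    refine (mono_mem_map_diag h.m_eq h.b_ne rfl rfl rfl i (Or.inl hi) (by norm_num)).2 ?_
    intro _ h0
    have h1 : ((i + 2 : ℤ) : ℂ) = 0 := by
      push_cast
      linear_combination h0
    have h2 : i + 2 = 0 := by exact_mod_cast h1
    omega
  have hcoord : ∀ (j : ℤ) (f : ℂ[X]), -1 ≤ j →
      (mono j f : QuadModel 1 1 (-s)) ∈ (CL1 s).toSubmodule := by
    intro j f hj i hi
    rw [coord_mono, if_neg (by omega)]
  refine h.localMatch.iso (fun i => ?_) h.basis_x h.basis_y h.virasoro_mem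
    (hcoord 0 _ (by norm_num)) (hcoord 1 _ (by norm_num)) (hcoord (-1) _ le_rfl) fun a ha i => ?_
  · by_cases hi : -1 ≤ i
    · exact Or.inl (exists_snd_ne_zero one_ne_zero (h3 i hi))
    · obtain ⟨n, rfl⟩ : ∃ n : ℕ, i = -(((n + 1 : ℕ) : ℤ) + 1) :=
        ⟨(-i - 2).toNat, by push_cast; omega⟩
      rw [diag_neg]
      exact Or.inr (fst_eq_zero_of_up hy n)
  · by_cases hi : -1 ≤ i
    · exact mono_mem_of_one (h3 i hi) _
    · rw [ha i (by omega), mono_zero]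
      exact zero_mem _

end Linear

/-- The isomorphism in the case of a quadratic bracket. -/
theorem iso_SCL2_half {k : ℤ} {x y : A} (hthin : IsThin 𝒢) (hk : k ≠ 0) (hL : IsBasis (𝒢 0) L)
    (hx : IsBasis (𝒢 k) x) (hy : IsBasis (𝒢 (-k)) y)
    (hrel : LocalRel L x y (-(2 * s)) 4 (2 * s) 1
      (C (C (1 / 2)) * ((C X + X + C (C (2 * s))) *
        (C (C (3 / 2)) * C X + X + C (C (2 * s)))))) :
    (subalgebraAt 𝒢 k).Iso (SCL2 (1 / 2) s) := by
  have hmatch : LocalMatch 𝒢 k (L, (mono 0 (C (1 / 2 : ℂ)⁻¹) : QuadModel 1 (1 / 2) s))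
      (x, mono 1 1) (y, mono (-1) (X + C (2 * s))) := by
    refine ⟨hthin, hk, hrel.isLocalPart (localRel_half s), hL.mem, hx.mem, hy.mem, hL.ne_zero,
      hx.ne_zero, hy.ne_zero, ⟨_, rfl⟩, ⟨_, rfl⟩, ⟨_, rfl⟩, fun n c hc => ?_,
      fun n c hc => eq_zero_of_lower_half n hc⟩
    refine eq_zero_of_lower (b := 1 / 2) (s := s) (ε := 1) (Or.inr rfl) (by norm_num)
      one_ne_zero n fun w => ?_
    rw [neg_mul, one_mul]
    exact hc w
  set t' : A × QuadModel 1 (1 / 2) s := (L, mono 0 (C (1 / 2 : ℂ)⁻¹)) with ht'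
  set x' : A × QuadModel 1 (1 / 2) s := (x, mono 1 1) with hx'
  set y' : A × QuadModel 1 (1 / 2) s := (y, mono (-1) (X + C (2 * s))) with hy'
  have hidx : ∀ i : ℤ, (i : ℂ) = -2 * (1 / 2) ↔ i = -1 := by
    intro i
    rw [show (-2 * (1 / 2) : ℂ) = ((-1 : ℤ) : ℂ) by norm_num]
    exact Int.cast_inj
  have h3 : ∀ i : ℤ, i ≠ -1 →
      mono i 1 ∈ (diag t' x' y' i).map (LinearMap.snd ℂ[X] A (QuadModel 1 (1 / 2) s)) := by
    intro i hi
    induction i using diag_induction with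
    | h0 =>
      refine mono_mem_of_C_mul (κ := (1 / 2 : ℂ)⁻¹) (by norm_num) ?_
      rw [mul_one]
      exact ⟨t', Submodule.mem_span_singleton_self t', rfl⟩
    | hp n =>
      rw [diag_succ]
      cases n with
      | zero => exact ⟨x', Submodule.mem_span_singleton_self x', rfl⟩
      | succ n =>
        have h := (mono_mem_upSnd (x := x') one_ne_zero rfl (Or.inr rfl) (by norm_num)
          (by norm_num) n).2 ?_
        · rwa [one_mul, show (n : ℤ) + 2 = ((n + 1 : ℕ) : ℤ) + 1 by push_cast; ring] at h
        · have : ((n + 3 : ℕ) : ℂ) ≠ 0 := Nat.cast_ne_zero.2 (by omega)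
          push_cast at this ⊢
          intro h
          exact this (by linear_combination h)
    | hn n =>
      rw [diag_neg]
      cases n with
      | zero => exact absurd rfl hi
      | succ n =>
        have h := mono_mem_upSnd_of_half (x := y') rfl n
        rwa [show (n : ℤ) + 2 = ((n + 1 : ℕ) : ℤ) + 1 by push_cast; ring] at h
  have h4 : mono (-1) (X + C (2 * s)) ∈
      (diag t' x' y' (-1)).map (LinearMap.snd ℂ[X] A (QuadModel 1 (1 / 2) s)) :=
    ⟨y', mem_diag_neg_one, rfl⟩
  have hcoord : ∀ (j : ℤ) (f : ℂ[X]), j ≠ -1 →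
      (mono j f : QuadModel 1 (1 / 2) s) ∈ (SCL2 (1 / 2) s).toSubmodule := by
    intro j f hj i hi
    rw [coord_mono, if_neg]
    · exact dvd_zero _
    · rintro rfl
      exact hj ((hidx j).1 hi)
  have hLmem : L ∈ (subalgebraAt 𝒢 k).toSubmodule := by
    have h1 := fun z => Subalgebra.brAt_mem _ (mem_subalgebraAt (Or.inl hx.mem))
      (mem_subalgebraAt (𝒢 := 𝒢) (Or.inr hy.mem)) z
    -- The `λ²`-coefficient of the bracket is `1/2`, so its second difference is exactly `L`.
    have h2 := sub_mem (add_mem (h1 1) (h1 (-1))) (add_mem (h1 0) (h1 0))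
    rw [hrel.xy, hrel.xy, hrel.xy, ← add_smul, ← add_smul, ← sub_smul] at h2
    convert h2
    conv_lhs => rw [← one_smul ℂ[X] L]
    congr 1
    refine Polynomial.funext fun t => ?_
    simp only [eval_mul, eval_sub, eval_add, eval_C, eval_X, eval_one]
    ring
  refine hmatch.iso (fun i => Or.inl ?_) hx hy hLmem (hcoord 0 _ (by norm_num))
    (hcoord 1 _ (by norm_num)) ?_ fun a ha i => ?_
  · by_cases hi : i = -1
    · rw [hi]
      exact exists_snd_ne_zero (X_add_C_ne_zero _) h4
    · exact exists_snd_ne_zero one_ne_zero (h3 i hi)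
  · intro i hi
    rw [(hidx i).1 hi]
    change X + C (2 * s) ∣ coord (mono (-1) (X + C (2 * s))) (-1)
    rw [coord_mono, if_pos rfl]
  · by_cases hi : i = -1
    · obtain ⟨g, hg⟩ := ha i ((hidx i).2 hi)
      rw [hg, mul_comm, ← smul_mono, hi]
      exact Submodule.smul_mem _ _ h4
    · exact mono_mem_of_one (h3 i hi) _

end ModelIsomorphisms

/-! ### Assembling the cases. -/

section Classification

variable {A : Type*} [AddCommGroup A] [Module ℂ A] [Module ℂ[X] A] [IsScalarTower ℂ ℂ[X] A]
  [LieConformalAlgebra A] {𝒢 : ℤ → Submodule ℂ[X] A} {L : A}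

theorem IsBasis.csmul {N : Submodule ℂ[X] A} {x : A} (h : IsBasis N x) {c : ℂ} (hc : c ≠ 0) :
    IsBasis N (c • x) := by
  have hu : IsUnit (C c : ℂ[X]) := isUnit_C.2 (IsUnit.mk0 c hc)
  rw [← C_smul_eq]
  refine ⟨?_, fun f hf => ?_⟩
  · rw [Submodule.span_singleton_smul_eq hu, h.1]
  · rw [smul_smul] at hf
    exact (mul_eq_zero.1 (h.2 _ hf)).resolve_right (C_ne_zero.2 hc)

theorem totalDeg_C_mul {u : ℂ} (hu : u ≠ 0) (p : ℂ[X][X]) :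
    totalDeg (C (C u) * p) = totalDeg p := by
  have hs : (C (C u) * p).support = p.support := by
    ext n
    rw [mem_support_iff, mem_support_iff, coeff_C_mul, Ne, mul_eq_zero, C_eq_zero]
    simp [hu]
  rw [totalDeg, totalDeg, hs]
  exact Finset.sup_congr rfl fun n _ => by rw [coeff_C_mul, natDegree_C_mul hu]

/-- `S` is isomorphic to one of the standard algebras. -/
def IsStandard (S : Subalgebra A) : Prop :=
  (∃ s : ℂ, S.Iso (CL1 s)) ∨
  (∃ b s : ℂ, b ≠ 0 ∧ S.Iso (Subalgebra.whole (CL2 b s))) ∨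
  (∃ b s : ℂ, b ≠ 0 ∧ (∃ n : ℤ, 2 * b = n) ∧ S.Iso (SCL2 b s)) ∨
  (∃ s : ℂ, S.Iso (Subalgebra.whole (LoopVir s)))

namespace Frame

variable {k : ℤ}

theorem totalDeg_str (F : Frame 𝒢 L) {d : ℕ} (hk : k ∈ degSet 𝒢 d) :
    k ≠ 0 ∧ F.gen k ≠ 0 ∧ F.gen (-k) ≠ 0 ∧ totalDeg (F.str k (-k)) = d := by
  obtain ⟨hpos, x, y, L', p, hx, hy, hL', hxy, -, hd⟩ := hk
  have hgx := F.gen_ne_zero hx.mem hx.ne_zero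
  have hgy := F.gen_ne_zero hy.mem hy.ne_zero
  refine ⟨hpos.ne', hgx, hgy, ?_⟩
  obtain ⟨a, ha, hax⟩ := hx.exists_const (F.isBasis hgx)
  obtain ⟨b, hb, hby⟩ := hy.exists_const (F.isBasis hgy)
  obtain ⟨e, he, heL⟩ := F.virasoro_isBasis.exists_const hL'
  have h1 : F.str k (-k) = C (C (a * b * e)) * p := by
    refine eq_of_evalEval fun t z => ?_
    have h2 := F.brAt_gen_neg k z
    rw [hax, hby, brAt_csmul_left, brAt_csmul_right, brAt_of_bracket_eq hxy, heL, ← C_smul_eq,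
      ← C_smul_eq, ← C_smul_eq, smul_smul, smul_smul, smul_smul] at h2
    have h3 := congrArg (eval t) (F.virasoro_isBasis.smul_injective h2)
    rw [← eval_valAt, ← h3, ← eval_valAt, valAt, eval_mul, eval_C]
    simp only [eval_mul, eval_C]
    ring
  rw [h1, totalDeg_C_mul (mul_ne_zero (mul_ne_zero ha hb) he), hd]

theorem evalEval_str_swap (F : Frame 𝒢 L) (k : ℤ) (t z : ℂ) :
    (F.str (-k) (-(-k))).evalEval t z = -(F.str k (-k)).evalEval t (-z - t) := by
  have h1 := F.brAt_gen_neg (-k) z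
  rw [show F.gen (-(-k)) = F.gen k by rw [neg_neg], brAt_skew (F.brAt_gen_neg k), ← neg_smul] at h1
  have h2 := congrArg (eval t) (F.virasoro_isBasis.smul_injective h1)
  rw [eval_neg, eval_valAt, eval_valAt, evalEval_flipPoly] at h2
  exact h2.symm

theorem linearPair (F : Frame 𝒢 L) (hk : k ≠ 0) (hgx : F.gen k ≠ 0) (hgy : F.gen (-k) ≠ 0)
    {m b s c : ℂ} (hm : m = 0 ∨ m = 1) (hb : b ≠ 0) (hc : c ≠ 0) (hs : s = -F.shift k * b)
    (hw : F.weight k = 2 + m / b) (hw' : F.weight (-k) = 2 - m / b)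
    (hsh : F.shift (-k) = -F.shift k)
    (hstr : ∀ t z, (F.str k (-k)).evalEval t z =
      c * ((F.weight k - 1) / 2 * t + (z - F.shift k))) :
    LinearPair 𝒢 k L ((2 * b ^ 2 / c) • F.gen k) (F.gen (-k)) m b s := by
  -- The model bracket has `λ`-coefficient `2b²`, the given one `c`.
  have hκ : 2 * b ^ 2 / c ≠ 0 := div_ne_zero (mul_ne_zero two_ne_zero (pow_ne_zero 2 hb)) hc
  refine ⟨hm, hb, F.thin, hk, F.virasoro_isBasis, (F.isBasis hgx).csmul hκ, F.isBasis hgy,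
    fun z => ?_, fun z => ?_, fun z => ?_, fun z => ?_⟩
  · rw [F.brAt_self, valAt_linPoly, zero_add]
  · rw [brAt_csmul_right, F.brAt_virasoro, valAt_linPoly, hw, smul_comm, hs]
    congr 4
    field_simp
  · rw [F.brAt_virasoro, valAt_linPoly, hw', hsh, hs]
    congr 4
    field_simp
  · rw [brAt_csmul_left, F.brAt_gen_neg, ← C_smul_eq, smul_smul]
    congr 1
    refine Polynomial.funext fun t => ?_
    rw [eval_mul, eval_C, eval_valAt, hstr, hw, hs]
    simp only [eval_mul, eval_add, eval_C, eval_X]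
    field_simp
    ring

/-- Weight 2 gives `𝒱`. Otherwise `2 + 1/b` is the weight: `b = 1` gives `CL_1`, integral `2b` with
`|2b| ≥ 3` gives `SCL_2`, and the remaining values give `CL_2`. The value `b = -1` is weight 1,
excluded here and handled by exchanging `k` and `-k`. -/
theorem isStandard_of_linear (F : Frame 𝒢 L) (hsimple : IsGradedSimple 𝒢) (hk : k ≠ 0)
    (hgx : F.gen k ≠ 0) (hgy : F.gen (-k) ≠ 0) {c : ℂ} (hc : c ≠ 0) (hw1 : F.weight k ≠ 1)
    (hw : F.weight k + F.weight (-k) = 4) (hsh : F.shift (-k) = -F.shift k)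
    (hstr : ∀ t z, (F.str k (-k)).evalEval t z =
      c * ((F.weight k - 1) / 2 * t + (z - F.shift k))) :
    IsStandard (subalgebraAt 𝒢 k) := by
  by_cases h2 : F.weight k = 2
  · have h := F.linearPair (m := 0) (b := 1) hk hgx hgy (Or.inl rfl) one_ne_zero hc rfl
      (by rw [h2]; norm_num) (by rw [zero_div, sub_zero]; linear_combination hw - h2) hsh hstr
    refine Or.inr (Or.inr (Or.inr ⟨_, h.iso_whole fun i _ => ?_⟩))
    norm_num
  set b := 1 / (F.weight k - 2) with hbdef
  have hsub : F.weight k - 2 ≠ 0 := sub_ne_zero.2 h2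
  have hb : b ≠ 0 := one_div_ne_zero hsub
  have hwb : F.weight k = 2 + 1 / b := by rw [hbdef, one_div_one_div]; ring
  have h := fun s hs => F.linearPair (m := 1) (b := b) (s := s) hk hgx hgy (Or.inr rfl) hb hc hs hwb
    (by linear_combination hw - hwb) hsh hstr
  by_cases hb1 : b = 1
  · have hk3 : F.weight k = 3 := by rw [hwb, hb1]; norm_num
    have hk1 : F.weight (-k) = 1 := by linear_combination hw - hk3
    have h' := h (-F.shift k) (by rw [hb1, mul_one])
    rw [hb1] at h'
    refine Or.inl ⟨_, h'.iso_CL1 (F.brAt_self_eq_zero hsimple hk hk3 hk1 hsh hc fun z => ?_)⟩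
    rw [F.brAt_gen_neg]
    congr 1
    refine Polynomial.funext fun t => ?_
    rw [eval_valAt, hstr, hk3]
    simp only [eval_mul, eval_add, eval_C, eval_X]
    ring
  have hb1' : b ≠ -1 := by
    intro h0
    apply hw1
    rw [hwb, h0]
    norm_num
  by_cases hex : ∃ n : ℤ, 2 * b = n ∧ 3 ≤ |n|
  · obtain ⟨n, hn, hn3⟩ := hex
    exact Or.inr (Or.inr (Or.inl ⟨b, _, hb, ⟨n, hn⟩, (h _ rfl).iso_SCL2 hn hn3⟩))
  · refine Or.inr (Or.inl ⟨b, _, hb, (h _ rfl).iso_whole fun i hi h0 => hex ⟨-i, ?_, ?_⟩⟩)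
    · push_cast
      linear_combination h0
    · rw [abs_neg]
      rcases hi.eq_or_lt with h3 | h3
      · exfalso
        rcases eq_or_eq_neg_of_abs_eq h3.symm with rfl | rfl
        · apply hb1'
          push_cast at h0
          linear_combination h0 / 2
        · apply hb1
          push_cast at h0
          linear_combination h0 / 2
      · omega

theorem isStandard_of_quadratic (F : Frame 𝒢 L) (hk : k ≠ 0) (hgx : F.gen k ≠ 0)
    (hgy : F.gen (-k) ≠ 0) {c : ℂ} (hc : c ≠ 0) (hw4 : F.weight k = 4) (hw1 : F.weight (-k) = 1)
    (hsh : F.shift (-k) = -F.shift k)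
    (hstr : ∀ t z, (F.str k (-k)).evalEval t z =
      c * (3 / 2 * t ^ 2 + 5 / 2 * t * (z - F.shift k) + (z - F.shift k) ^ 2)) :
    IsStandard (subalgebraAt 𝒢 k) := by
  have hκ : 1 / (2 * c) ≠ 0 := one_div_ne_zero (mul_ne_zero two_ne_zero hc)
  refine Or.inr (Or.inr (Or.inl ⟨1 / 2, -F.shift k / 2, by norm_num, ⟨1, by norm_num⟩,
    iso_SCL2_half F.thin hk F.virasoro_isBasis ((F.isBasis hgx).csmul hκ) (F.isBasis hgy)
      ⟨fun z => ?_, fun z => ?_, fun z => ?_, fun z => ?_⟩⟩))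
  · rw [F.brAt_self, valAt_linPoly, zero_add]
  · rw [brAt_csmul_right, F.brAt_virasoro, valAt_linPoly, hw4, smul_comm]
    congr 4
    ring
  · rw [F.brAt_virasoro, valAt_linPoly, hw1, hsh]
    congr 4
    ring
  · rw [brAt_csmul_left, F.brAt_gen_neg, ← C_smul_eq, smul_smul]
    congr 1
    refine Polynomial.funext fun t => ?_
    rw [eval_mul, eval_C, eval_valAt, hstr]
    simp only [eval_mul, eval_add, eval_C, eval_X]
    field_simp
    ring

theorem isStandard (F : Frame 𝒢 L) (hsimple : IsGradedSimple 𝒢)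
    (hk : k ∈ degSet 𝒢 1 ∪ degSet 𝒢 2) : IsStandard (subalgebraAt 𝒢 k) := by
  have hsh : F.str k (-k) ≠ 0 → F.shift (-k) = -F.shift k := by
    intro h
    linear_combination -((F.equivariant_neg k).add_eq h)
  have hne : ∀ {d : ℕ}, totalDeg (F.str k (-k)) = d + 1 → F.str k (-k) ≠ 0 := by
    intro d hd h0
    rw [h0] at hd
    simp [totalDeg] at hd
  rcases hk with hk | hk
  · obtain ⟨hk0, hgx, hgy, hd⟩ := F.totalDeg_str hk
    obtain ⟨hw, c, hc, hstr⟩ := (F.equivariant_neg k).of_totalDeg_eq_one hd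
    have hsh := hsh (hne hd)
    by_cases hw1 : F.weight k = 1
    -- Weight 1 in degree `k` means weight 3 in degree `-k`; the generated subalgebra is symmetric
    -- in the two degrees.
    · rw [← subalgebraAt_neg]
      have hw3 : F.weight (-k) = 3 := by linear_combination hw - hw1
      refine F.isStandard_of_linear hsimple (neg_ne_zero.2 hk0) hgy (by rwa [neg_neg]) hc
        (by rw [hw3]; norm_num) (by rw [neg_neg, add_comm, hw]) (by rw [neg_neg, hsh, neg_neg])
        fun t z => ?_
      rw [F.evalEval_str_swap, hstr, hw1, hw3, hsh]
      ring
    · exact F.isStandard_of_linear hsimple hk0 hgx hgy hc hw1 hw hsh hstr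
  · obtain ⟨hk0, hgx, hgy, hd⟩ := F.totalDeg_str hk
    obtain ⟨hw, hw14, c, hc, hstr⟩ := (F.equivariant_neg k).of_totalDeg_eq_two hd
    have hsh := hsh (hne hd)
    rcases hw14 with hw1 | hw4
    · rw [← subalgebraAt_neg]
      refine F.isStandard_of_quadratic (neg_ne_zero.2 hk0) hgy (by rwa [neg_neg])
        (neg_ne_zero.2 hc) (by linear_combination hw - hw1) (by rw [neg_neg, hw1])
        (by rw [neg_neg, hsh, neg_neg]) fun t z => ?_
      rw [F.evalEval_str_swap, hstr, hw1, hsh]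
      ring
    · refine F.isStandard_of_quadratic hk0 hgx hgy hc hw4 (by linear_combination hw - hw4) hsh
        fun t z => ?_
      rw [hstr, hw4]
      ring

end Frame

theorem exists_frame_of_isVirasoro (hgrading : IsGrading 𝒢) (hsimple : IsGradedSimple 𝒢)
    (hrank : ∀ i : ℤ, Module.rank ℂ[X] (𝒢 i) ≤ 1) (hvir : IsVirasoro (𝒢 0)) :
    ∃ L : A, Nonempty (Frame 𝒢 L) := by
  obtain ⟨L, hL, hLL⟩ := hvir
  refine ⟨L, exists_frame ⟨hgrading, fun i a ha f hf h =>
    smul_eq_zero_of_simple hgrading hsimple hL ha hf h, hrank⟩ hsimple hL fun z => ?_⟩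
  rw [brAt_of_bracket_eq hLL]
  congr 1
  have h2 : (2 : ℂ[X][X]) = C (C 2) := rfl
  rw [valAt, h2, eval_add, eval_mul, eval_C, eval_C, eval_X, ← C_mul]

end Classification

end LieConformalAlgebra

end

theorem proposition3p6 {A : Type*} [AddCommGroup A] [Module ℂ A] [Module ℂ[X] A]
    [IsScalarTower ℂ ℂ[X] A] [LieConformalAlgebra A]
    (𝒢 : ℤ → Submodule ℂ[X] A) (hgrading : IsGrading 𝒢) (hsimple : IsGradedSimple 𝒢)
    (hrank : ∀ i : ℤ, Module.rank ℂ[X] (𝒢 i) ≤ 1) (hvir : IsVirasoro (𝒢 0))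
    (k : ℤ) (hk : k ∈ degSet 𝒢 1 ∪ degSet 𝒢 2) :
    (∃ s : ℂ, (subalgebraAt 𝒢 k).Iso (CL1 s)) ∨
    (∃ b s : ℂ, b ≠ 0 ∧ (subalgebraAt 𝒢 k).Iso (Subalgebra.whole (CL2 b s))) ∨
    (∃ b s : ℂ, b ≠ 0 ∧ (∃ n : ℤ, 2 * b = n) ∧ (subalgebraAt 𝒢 k).Iso (SCL2 b s)) ∨
    (∃ s : ℂ, (subalgebraAt 𝒢 k).Iso (Subalgebra.whole (LoopVir s))) := by
  obtain ⟨L, ⟨F⟩⟩ := exists_frame_of_isVirasoro hgrading hsimple hrank hvir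
  exact F.isStandard hsimple hk
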